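/- Let $\mathcal{O}_K$ be a principal ideal domain with field of fractions $K$. For a commutative ring $R$, a genus one model of degree $n$ over $R$ is: for $n=2$, a generalised binary quartic $y^2+P(x_1,x_2)y=Q(x_1,x_2)$ with $P,Q$ binary forms over $R$ of degrees $2$ and $4$; for $n=3$, a ternary cubic over $R$; for $n=4$, an ordered pair $(Q_1,Q_2)$ of quadratic forms over $R$ in four variables. A model over $K$ is integral if its coefficients lie in $\mathcal{O}_K$. The discriminant $\Delta$ of a model of degree $n$ is the integer coefficient polynomial in its coefficients with $1728\Delta=c_4^3-c_6^2$, where the integer coefficient polynomials $c_4,c_6$ are as follows. For a binary quartic $F=ax^4+bx^3z+cx^2z^2+dxz^3+ez^4$ put $c_4(F)=2^4(12ae-3bd+c^2)$ and $c_6(F)=2^5(72ace-27ad^2-27b^2e+9bcd-2c^3)$. For $n=2$, $c_i(P,Q)=c_i(\frac14P^2+Q)$ for $i = 4, 6$. For $n=3$, $H(H(F))=48c_4(F)^2F+16c_6(F)H(F)$, where $H(F)$ is the determinant of the matrix of second partial derivatives of $F$, and the sign of $c_4$ is fixed by requiring $\Delta$ to have integer coefficients. For $n=4$, $c_4(Q_1,Q_2)=2^{-4}c_4(F)$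 and $c_6(Q_1,Q_2)=2^{-6}c_6(F)$, where $F(x,z)=\det(Ax+Bz)$ and $A,B$ are the matrices of second partial derivatives of $Q_1,Q_2$. Let $E$ be an elliptic curve over $K$ and let $D$ be a $K$-rational divisor on $E$ of degree $n\in\{2,3,4\}$, with Riemann--Roch space $\mathcal{L}(D)$. A model $\Phi$ of degree $n$ over $K$ represents the pair $(E,[D])$, where $[D]$ is the linear equivalence class of $D$, if for some $K$-basis $f_1,\dots,f_n$ of $\mathcal{L}(D)$ the following holds. If $n=3$ or $4$, the image of $(f_1:\dots:f_n):E\to\mathbb{P}^{n-1}$ is the subscheme defined by $\Phi$. If $n=2$, there is $y\in\mathcal{L}(2D)$ such that the image of $(f_1:f_2:y):E\to\mathbb{P}(1,1,2)$ is the subscheme defined by $\Phi$. Theorem. Let $E/K$ be an elliptic curve with integral Weierstrass equation $$y^2+a_1xy+a_3y=x^3+a_2x^2+a_4x+a_6,\qquad a_i\in\mathcal{O}_K,$$ and let $D$ be a $K$-rational divisor on $E$ of degree $n=2$, $3$ or $4$. Then $(E,[D])$ is represented by an integral genus one model of degree $n$ with the same discriminant as this Weierstrass equation. -/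

import Mathlib

noncomputable section

namespace GenusOne

universe u v

/-! ### Places, divisors and Riemann-Roch spaces of a function field `F / K` -/

/-- A place of `F / K`: a valuation subring of `F`, different from `F`, that contains `K`.
When `F` is the function field of a smooth projective curve over `K`, its places are the closed
points of the curve. -/
structure Place (K : Type u) (F : Type v) [Field K] [Field F] [Algebra K F] where
  ring : ValuationSubring F
  algebraMap_mem : ∀ a : K, algebraMap K F a ∈ ring
  ne_top : ring ≠ ⊤

section Divisors

variable {K : Type u} {F : Type v} [Field K] [Field F] [Algebra K F]

instance (p : Place K F) : Algebra K p.ring :=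
  ((algebraMap K F).codRestrict p.ring p.algebraMap_mem).toAlgebra

/-- The degree of a place is the degree over `K` of its residue field. -/
def Place.degree (p : Place K F) : ℕ :=
  Module.finrank K (IsLocalRing.ResidueField p.ring)

/-- `π` is a uniformiser at `p`: it generates the maximal ideal of the valuation ring. -/
def Place.IsUniformizer (p : Place K F) (π : F) : Prop :=
  ∃ h : π ∈ p.ring, IsLocalRing.maximalIdeal p.ring = Ideal.span {(⟨π, h⟩ : p.ring)}

variable (K F) in
/-- The divisors of `F / K`: finite formal integer combinations of places. When `F` is the function
field of a smooth projective curve over `K`, these are the `K`-rational divisors of the curve. -/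
abbrev Divisor : Type _ := Place K F →₀ ℤ

/-- The degree of a divisor. -/
def Divisor.degree (D : Divisor K F) : ℤ :=
  D.sum fun p m => m * (p.degree : ℤ)

/-- The Riemann-Roch space `ℒ(D)`: the functions `f` with `ord_p f + D(p) ≥ 0` at each place `p`. -/
def riemannRoch (D : Divisor K F) : Submodule K F where
  carrier := {f | ∀ (p : Place K F) (π : F), p.IsUniformizer π → f * π ^ D p ∈ p.ring}
  zero_mem' := fun p π _ => by
    rw [zero_mul]
    exact p.ring.zero_mem
  add_mem' := fun {f g} hf hg p π hπ => by
    rw [add_mul]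
    exact p.ring.add_mem _ _ (hf p π hπ) (hg p π hπ)
  smul_mem' := fun a f hf p π hπ => by
    rw [Algebra.smul_def, mul_assoc]
    exact p.ring.mul_mem _ _ (p.algebraMap_mem a) (hf p π hπ)

/-- Let the homogeneous coordinates `x i` of a weighted projective space have weights `w i`, and
let `f` be a tuple of functions, giving a rational map from the curve with function field `F` to
that space. This says that the image of the curve is the subscheme defined by the ideal `I`: a
homogeneous form vanishes on the image if and only if it lies in `I`. -/
def ImageDefinedBy {σ : Type*} (w : σ → ℕ) (f : σ → F) (I : Ideal (MvPolynomial σ K)) : Prop :=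
  ∀ (d : ℕ) (G : MvPolynomial σ K), MvPolynomial.IsWeightedHomogeneous w G d →
    (MvPolynomial.aeval f G = 0 ↔ G ∈ I)

end Divisors

/-! ### Genus one models of degree 2 -/

/-- The generalised binary quartic
`y² + (l x² + m x z + n z²) y = a x⁴ + b x³ z + c x² z² + d x z³ + e z⁴`. -/
@[ext]
structure BinaryQuartic (R : Type u) where
  l : R
  m : R
  n : R
  a : R
  b : R
  c : R
  d : R
  e : R

namespace BinaryQuartic

/-- Change of coefficient ring. -/
def map {R : Type u} {S : Type v} [CommRing R] [CommRing S] (φ : R →+* S) (Φ : BinaryQuartic R) :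
    BinaryQuartic S :=
  ⟨φ Φ.l, φ Φ.m, φ Φ.n, φ Φ.a, φ Φ.b, φ Φ.c, φ Φ.d, φ Φ.e⟩

variable {R : Type u} [CommRing R]

open MvPolynomial in
/-- The form `y² + P(x, z) y - Q(x, z)` in the variables `x = X 0`, `z = X 1`, `y = X 2`. -/
def equation (Φ : BinaryQuartic R) : MvPolynomial (Fin 3) R :=
  X 2 ^ 2 + (C Φ.l * X 0 ^ 2 + C Φ.m * X 0 * X 1 + C Φ.n * X 1 ^ 2) * X 2
    - (C Φ.a * X 0 ^ 4 + C Φ.b * X 0 ^ 3 * X 1 + C Φ.c * X 0 ^ 2 * X 1 ^ 2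
        + C Φ.d * X 0 * X 1 ^ 3 + C Φ.e * X 1 ^ 4)

/-- The `a`-invariants of a generalised binary quartic. -/
def aInvariants (Φ : BinaryQuartic R) : WeierstrassCurve R where
  a₁ := Φ.m
  a₂ := Φ.c - Φ.l * Φ.n
  a₃ := Φ.l * Φ.d + Φ.n * Φ.b
  a₄ := -4 * Φ.a * Φ.e + Φ.b * Φ.d - (Φ.l ^ 2 * Φ.e + Φ.l * Φ.n * Φ.c + Φ.n ^ 2 * Φ.a)
  a₆ := -4 * Φ.a * Φ.c * Φ.e + Φ.a * Φ.d ^ 2 + Φ.b ^ 2 * Φ.e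
    - (Φ.l ^ 2 * Φ.c * Φ.e + Φ.m ^ 2 * Φ.a * Φ.e + Φ.n ^ 2 * Φ.a * Φ.c + Φ.l * Φ.n * Φ.b * Φ.d)
    + Φ.l * Φ.m * Φ.b * Φ.e + Φ.m * Φ.n * Φ.a * Φ.d

/-- The invariant `c₄`. -/
def c₄ (Φ : BinaryQuartic R) : R := Φ.aInvariants.c₄

/-- The invariant `c₆`. -/
def c₆ (Φ : BinaryQuartic R) : R := Φ.aInvariants.c₆

/-- The discriminant, which satisfies `1728 Δ = c₄ ^ 3 - c₆ ^ 2`. -/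
def Δ (Φ : BinaryQuartic R) : R := Φ.aInvariants.Δ

/-- The classical invariant `I` of the binary quartic `a x⁴ + b x³ z + c x² z² + d x z³ + e z⁴`. -/
def quarticI (a b c d e : R) : R := 12 * a * e - 3 * b * d + c ^ 2

/-- The classical invariant `J` of the binary quartic `a x⁴ + b x³ z + c x² z² + d x z³ + e z⁴`. -/
def quarticJ (a b c d e : R) : R :=
  72 * a * c * e - 27 * a * d ^ 2 - 27 * b ^ 2 * e + 9 * b * c * d - 2 * c ^ 3

/-- `c₄ = I(P² + 4 Q)`, that is, `c₄ = 2⁴ I(P² / 4 + Q)` when `2` is invertible. -/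
theorem c₄_eq (Φ : BinaryQuartic R) :
    Φ.c₄ = quarticI (Φ.l ^ 2 + 4 * Φ.a) (2 * Φ.l * Φ.m + 4 * Φ.b)
      (Φ.m ^ 2 + 2 * Φ.l * Φ.n + 4 * Φ.c) (2 * Φ.m * Φ.n + 4 * Φ.d) (Φ.n ^ 2 + 4 * Φ.e) := by
  simp only [c₄, aInvariants, quarticI, WeierstrassCurve.c₄, WeierstrassCurve.b₂,
    WeierstrassCurve.b₄]
  ring

/-- `2 c₆ = J(P² + 4 Q)`, that is, `c₆ = 2⁵ J(P² / 4 + Q)` when `2` is invertible. -/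
theorem two_mul_c₆ (Φ : BinaryQuartic R) :
    2 * Φ.c₆ = quarticJ (Φ.l ^ 2 + 4 * Φ.a) (2 * Φ.l * Φ.m + 4 * Φ.b)
      (Φ.m ^ 2 + 2 * Φ.l * Φ.n + 4 * Φ.c) (2 * Φ.m * Φ.n + 4 * Φ.d) (Φ.n ^ 2 + 4 * Φ.e) := by
  simp only [c₆, aInvariants, quarticJ, WeierstrassCurve.c₆, WeierstrassCurve.b₂,
    WeierstrassCurve.b₄, WeierstrassCurve.b₆]
  ring

/-- `Φ` represents the curve with function field `F` together with the class of the divisor `D` of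
degree 2: for some basis `x, z` of `ℒ(D)` and some `y` in `ℒ(2 D)`, the map `(x : z : y)` to
`ℙ(1, 1, 2)`, which lies over the map `(x : z)` to `ℙ¹`, has as its image the curve defined
by `Φ`. -/
def Represents {K : Type u} {F : Type v} [Field K] [Field F] [Algebra K F]
    (Φ : BinaryQuartic K) (D : Divisor K F) : Prop :=
  ∃ (b : Module.Basis (Fin 2) K (riemannRoch D)) (y : riemannRoch (2 • D)),
    ImageDefinedBy ![1, 1, 2] ![(b 0 : F), (b 1 : F), (y : F)] (Ideal.span {Φ.equation})

end BinaryQuartic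

/-! ### Genus one models of degree 3 -/

/-- The ternary cubic `a x³ + b y³ + c z³ + a₂ x² y + a₃ x² z + b₁ x y² + b₃ y² z + c₁ x z²
+ c₂ y z² + m x y z`. -/
@[ext]
structure TernaryCubic (R : Type u) where
  a : R
  b : R
  c : R
  a₂ : R
  a₃ : R
  b₁ : R
  b₃ : R
  c₁ : R
  c₂ : R
  m : R

namespace TernaryCubic

/-- Change of coefficient ring. -/
def map {R : Type u} {S : Type v} [CommRing R] [CommRing S] (φ : R →+* S) (Φ : TernaryCubic R) :
    TernaryCubic S :=
  ⟨φ Φ.a, φ Φ.b, φ Φ.c, φ Φ.a₂, φ Φ.a₃, φ Φ.b₁, φ Φ.b₃, φ Φ.c₁, φ Φ.c₂, φ Φ.m⟩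

variable {R : Type u} [CommRing R]

open MvPolynomial in
/-- The cubic form itself, in the variables `x = X 0`, `y = X 1`, `z = X 2`. -/
def equation (Φ : TernaryCubic R) : MvPolynomial (Fin 3) R :=
  C Φ.a * X 0 ^ 3 + C Φ.b * X 1 ^ 3 + C Φ.c * X 2 ^ 3
    + C Φ.a₂ * X 0 ^ 2 * X 1 + C Φ.a₃ * X 0 ^ 2 * X 2 + C Φ.b₁ * X 0 * X 1 ^ 2
    + C Φ.b₃ * X 1 ^ 2 * X 2 + C Φ.c₁ * X 0 * X 2 ^ 2 + C Φ.c₂ * X 1 * X 2 ^ 2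
    + C Φ.m * X 0 * X 1 * X 2

/-- The `a`-invariants of a ternary cubic. -/
def aInvariants (Φ : TernaryCubic R) : WeierstrassCurve R :=
  let ⟨a, b, c, a₂, a₃, b₁, b₃, c₁, c₂, m⟩ := Φ
  { a₁ := m
    a₂ := -(a₂ * c₂ + a₃ * b₃ + b₁ * c₁)
    a₃ := 9 * a * b * c - (a * b₃ * c₂ + b * a₃ * c₁ + c * a₂ * b₁)
      - (a₂ * b₃ * c₁ + a₃ * b₁ * c₂)
    a₄ := -3 * (a * b * c₁ * c₂ + a * c * b₁ * b₃ + b * c * a₂ * a₃)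
      + a * (b₁ * c₂ ^ 2 + b₃ ^ 2 * c₁) + b * (a₂ * c₁ ^ 2 + a₃ ^ 2 * c₂)
      + c * (a₂ ^ 2 * b₃ + a₃ * b₁ ^ 2)
      + a₂ * c₂ * a₃ * b₃ + b₁ * c₁ * a₂ * c₂ + a₃ * b₃ * b₁ * c₁
    a₆ := -27 * a ^ 2 * b ^ 2 * c ^ 2 + 9 * a ^ 2 * b * c * b₃ * c₂ - a ^ 2 * b * c₂ ^ 3
      - a ^ 2 * c * b₃ ^ 3 + 9 * a * b ^ 2 * c * a₃ * c₁ - a * b ^ 2 * c₁ ^ 3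
      + 9 * a * b * c ^ 2 * a₂ * b₁ + 3 * a * b * c * a₂ * b₃ * c₁
      - 3 * a * b * c * a₂ * c₂ * m + 3 * a * b * c * a₃ * b₁ * c₂
      - 3 * a * b * c * a₃ * b₃ * m - 3 * a * b * c * b₁ * c₁ * m + a * b * c * m ^ 3
      + 2 * a * b * a₂ * c₁ * c₂ ^ 2 - a * b * a₃ * b₃ * c₁ * c₂ + a * b * a₃ * c₂ ^ 2 * m
      + 2 * a * b * b₁ * c₁ ^ 2 * c₂ + a * b * b₃ * c₁ ^ 2 * m - a * b * c₁ * c₂ * m ^ 2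
      - a * c ^ 2 * b₁ ^ 3 - a * c * a₂ * b₁ * b₃ * c₂ + a * c * a₂ * b₃ ^ 2 * m
      + 2 * a * c * a₃ * b₁ * b₃ ^ 2 + 2 * a * c * b₁ ^ 2 * b₃ * c₁
      + a * c * b₁ ^ 2 * c₂ * m - a * c * b₁ * b₃ * m ^ 2 - a * a₂ * b₃ ^ 2 * c₁ * c₂
      - a * a₃ * b₁ * b₃ * c₂ ^ 2 - a * b₁ ^ 2 * c₁ * c₂ ^ 2 - a * b₁ * b₃ ^ 2 * c₁ ^ 2
      + a * b₁ * b₃ * c₁ * c₂ * m - b ^ 2 * c * a₃ ^ 3 - b * c ^ 2 * a₂ ^ 3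
      + 2 * b * c * a₂ ^ 2 * a₃ * c₂ + b * c * a₂ ^ 2 * c₁ * m
      + 2 * b * c * a₂ * a₃ ^ 2 * b₃ - b * c * a₂ * a₃ * b₁ * c₁ - b * c * a₂ * a₃ * m ^ 2
      + b * c * a₃ ^ 2 * b₁ * m - b * a₂ ^ 2 * c₁ ^ 2 * c₂ - b * a₂ * a₃ ^ 2 * c₂ ^ 2
      - b * a₂ * a₃ * b₃ * c₁ ^ 2 + b * a₂ * a₃ * c₁ * c₂ * m - b * a₃ ^ 2 * b₁ * c₁ * c₂
      - c * a₂ ^ 2 * a₃ * b₃ ^ 2 - c * a₂ ^ 2 * b₁ * b₃ * c₁ - c * a₂ * a₃ * b₁ ^ 2 * c₂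
      + c * a₂ * a₃ * b₁ * b₃ * m - c * a₃ ^ 2 * b₁ ^ 2 * b₃ - a₂ * a₃ * b₁ * b₃ * c₁ * c₂ }

/-- The invariant `c₄`. -/
def c₄ (Φ : TernaryCubic R) : R := Φ.aInvariants.c₄

/-- The invariant `c₆`. -/
def c₆ (Φ : TernaryCubic R) : R := Φ.aInvariants.c₆

/-- The discriminant, which satisfies `1728 Δ = c₄ ^ 3 - c₆ ^ 2`. -/
def Δ (Φ : TernaryCubic R) : R := Φ.aInvariants.Δ

/-- `Φ` represents the curve with function field `F` together with the class of the divisor `D` of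
degree 3: for some basis `x, y, z` of `ℒ(D)`, the map `(x : y : z)` to `ℙ²` has as its image the
curve defined by `Φ`. -/
def Represents {K : Type u} {F : Type v} [Field K] [Field F] [Algebra K F]
    (Φ : TernaryCubic K) (D : Divisor K F) : Prop :=
  ∃ b : Module.Basis (Fin 3) K (riemannRoch D),
    ImageDefinedBy 1 (fun i => (b i : F)) (Ideal.span {Φ.equation})

end TernaryCubic

/-! ### Genus one models of degree 4 -/

/-- The quadratic form `∑ cᵢⱼ xᵢ xⱼ` (over `i ≤ j`) in four variables `x₁, x₂, x₃, x₄`. -/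
@[ext]
structure Quadric (R : Type u) where
  c₁₁ : R
  c₁₂ : R
  c₁₃ : R
  c₁₄ : R
  c₂₂ : R
  c₂₃ : R
  c₂₄ : R
  c₃₃ : R
  c₃₄ : R
  c₄₄ : R

namespace Quadric

/-- Change of coefficient ring. -/
def map {R : Type u} {S : Type v} [CommRing R] [CommRing S] (φ : R →+* S) (Q : Quadric R) :
    Quadric S :=
  ⟨φ Q.c₁₁, φ Q.c₁₂, φ Q.c₁₃, φ Q.c₁₄, φ Q.c₂₂, φ Q.c₂₃, φ Q.c₂₄, φ Q.c₃₃, φ Q.c₃₄, φ Q.c₄₄⟩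

variable {R : Type u} [CommRing R]

open MvPolynomial in
/-- The quadratic form itself, in the variables `x₁ = X 0`, `x₂ = X 1`, `x₃ = X 2`, `x₄ = X 3`. -/
def form (Q : Quadric R) : MvPolynomial (Fin 4) R :=
  C Q.c₁₁ * X 0 ^ 2 + C Q.c₁₂ * X 0 * X 1 + C Q.c₁₃ * X 0 * X 2 + C Q.c₁₄ * X 0 * X 3
    + C Q.c₂₂ * X 1 ^ 2 + C Q.c₂₃ * X 1 * X 2 + C Q.c₂₄ * X 1 * X 3
    + C Q.c₃₃ * X 2 ^ 2 + C Q.c₃₄ * X 2 * X 3 + C Q.c₄₄ * X 3 ^ 2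

/-- The matrix of second partial derivatives. -/
def hessianMatrix (Q : Quadric R) : Matrix (Fin 4) (Fin 4) R :=
  !![2 * Q.c₁₁, Q.c₁₂, Q.c₁₃, Q.c₁₄;
     Q.c₁₂, 2 * Q.c₂₂, Q.c₂₃, Q.c₂₄;
     Q.c₁₃, Q.c₂₃, 2 * Q.c₃₃, Q.c₃₄;
     Q.c₁₄, Q.c₂₄, Q.c₃₄, 2 * Q.c₄₄]

/-- The polynomial `pf(Q)`. -/
def pf (Q : Quadric R) : R := Q.c₁₂ * Q.c₃₄ + Q.c₁₃ * Q.c₂₄ + Q.c₁₄ * Q.c₂₃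

/-- The integer coefficient polynomial `rd(Q)` with `det (hessianMatrix Q) = pf(Q)² + 4 rd(Q)`. -/
def rd (Q : Quadric R) : R :=
  4 * Q.c₁₁ * Q.c₂₂ * Q.c₃₃ * Q.c₄₄
    - (Q.c₁₁ * Q.c₂₂ * Q.c₃₄ ^ 2 + Q.c₁₁ * Q.c₃₃ * Q.c₂₄ ^ 2 + Q.c₁₁ * Q.c₄₄ * Q.c₂₃ ^ 2
      + Q.c₂₂ * Q.c₃₃ * Q.c₁₄ ^ 2 + Q.c₂₂ * Q.c₄₄ * Q.c₁₃ ^ 2 + Q.c₃₃ * Q.c₄₄ * Q.c₁₂ ^ 2)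
    + (Q.c₁₁ * Q.c₂₃ * Q.c₂₄ * Q.c₃₄ + Q.c₂₂ * Q.c₁₃ * Q.c₁₄ * Q.c₃₄
      + Q.c₃₃ * Q.c₁₂ * Q.c₁₄ * Q.c₂₄ + Q.c₄₄ * Q.c₁₂ * Q.c₁₃ * Q.c₂₃)
    - (Q.c₁₂ * Q.c₃₄ * Q.c₁₃ * Q.c₂₄ + Q.c₁₂ * Q.c₃₄ * Q.c₁₄ * Q.c₂₃
      + Q.c₁₃ * Q.c₂₄ * Q.c₁₄ * Q.c₂₃)

theorem det_hessianMatrix (Q : Quadric R) :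
    Q.hessianMatrix.det = Q.pf ^ 2 + 4 * Q.rd := by
  rw [Matrix.det_succ_row_zero]
  simp [Fin.sum_univ_succ, Matrix.det_fin_three, hessianMatrix, Fin.succAbove, pf, rd]
  ring

end Quadric

/-- A quadric intersection: an ordered pair of quadrics in four variables. -/
@[ext]
structure QuadricIntersection (R : Type u) where
  Q₁ : Quadric R
  Q₂ : Quadric R

namespace QuadricIntersection

/-- Change of coefficient ring. -/
def map {R : Type u} {S : Type v} [CommRing R] [CommRing S] (φ : R →+* S)
    (Φ : QuadricIntersection R) : QuadricIntersection S :=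
  ⟨Φ.Q₁.map φ, Φ.Q₂.map φ⟩

variable {R : Type u} [CommRing R]

open Polynomial in
/-- The quadric `Q₁ + t Q₂` over the polynomial ring `R[t]`. -/
def pencil (Φ : QuadricIntersection R) : Quadric R[X] where
  c₁₁ := C Φ.Q₁.c₁₁ + X * C Φ.Q₂.c₁₁
  c₁₂ := C Φ.Q₁.c₁₂ + X * C Φ.Q₂.c₁₂
  c₁₃ := C Φ.Q₁.c₁₃ + X * C Φ.Q₂.c₁₃
  c₁₄ := C Φ.Q₁.c₁₄ + X * C Φ.Q₂.c₁₄
  c₂₂ := C Φ.Q₁.c₂₂ + X * C Φ.Q₂.c₂₂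
  c₂₃ := C Φ.Q₁.c₂₃ + X * C Φ.Q₂.c₂₃
  c₂₄ := C Φ.Q₁.c₂₄ + X * C Φ.Q₂.c₂₄
  c₃₃ := C Φ.Q₁.c₃₃ + X * C Φ.Q₂.c₃₃
  c₃₄ := C Φ.Q₁.c₃₄ + X * C Φ.Q₂.c₃₄
  c₄₄ := C Φ.Q₁.c₄₄ + X * C Φ.Q₂.c₄₄

/-- The generalised binary quartic `y² + pf(x Q₁ + z Q₂) y = rd(x Q₁ + z Q₂)`. The coefficients of
`x² , x z, z²` in `pf(x Q₁ + z Q₂)` are those of `1, t, t²` in `pf(Q₁ + t Q₂)`, and likewise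
for `rd`. -/
def toBinaryQuartic (Φ : QuadricIntersection R) : BinaryQuartic R where
  l := Φ.pencil.pf.coeff 0
  m := Φ.pencil.pf.coeff 1
  n := Φ.pencil.pf.coeff 2
  a := Φ.pencil.rd.coeff 0
  b := Φ.pencil.rd.coeff 1
  c := Φ.pencil.rd.coeff 2
  d := Φ.pencil.rd.coeff 3
  e := Φ.pencil.rd.coeff 4

/-- The `a`-invariants of a quadric intersection. -/
def aInvariants (Φ : QuadricIntersection R) : WeierstrassCurve R := Φ.toBinaryQuartic.aInvariants

/-- The invariant `c₄`. -/
def c₄ (Φ : QuadricIntersection R) : R := Φ.aInvariants.c₄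

/-- The invariant `c₆`. -/
def c₆ (Φ : QuadricIntersection R) : R := Φ.aInvariants.c₆

/-- The discriminant, which satisfies `1728 Δ = c₄ ^ 3 - c₆ ^ 2`. -/
def Δ (Φ : QuadricIntersection R) : R := Φ.aInvariants.Δ

/-- `Φ` represents the curve with function field `F` together with the class of the divisor `D` of
degree 4: for some basis `x₁, x₂, x₃, x₄` of `ℒ(D)`, the map `(x₁ : x₂ : x₃ : x₄)` to `ℙ³` has as
its image the curve defined by `Φ`. -/
def Represents {K : Type u} {F : Type v} [Field K] [Field F] [Algebra K F]
    (Φ : QuadricIntersection K) (D : Divisor K F) : Prop :=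
  ∃ b : Module.Basis (Fin 4) K (riemannRoch D),
    ImageDefinedBy 1 (fun i => (b i : F)) (Ideal.span {Φ.Q₁.form, Φ.Q₂.form})

end QuadricIntersection

end GenusOne

end

/-! ### The coordinate ring of an elliptic curve is a Dedekind domain. -/

noncomputable section

open Polynomial

open scoped nonZeroDivisors Polynomial.Bivariate WithZero

namespace GenusOne

/-! Reduction. On a curve of genus one every divisor D of degree n is linearly equivalent to n·∞ or
to (n - 1)·∞ + Q with Q an affine rational point (`exists_reduction`). Multiplication by a function
carries the Riemann-Roch space of the reduced divisor onto ℒ(D), and rescaling homogeneous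
coordinates does not move the image (`ImageDefinedBy.scale`), so these two divisors suffice. Write Q
= -P with P = (ξ, η). The slope l = (y - η)/(x - ξ) has simple poles at Q and ∞ and no others, and
ℒ(Q + m·∞), for m ≥ 1, is spanned by l and the polynomials in x and y with pole order at most m at ∞
(`forall_valuation_le_iff`).

Integrality. Over a principal ideal domain ξ = r/t² and η = s/t³ with r and t coprime, and s = u r -
w t³ for some u, w. Replace l and x by μ = (t l - u)/t² and z = (x - u μ)/t. The Weierstrass
equation at P, read modulo successive powers of t, produces integral h, g, q
(`exists_isParam_of_isCoprime`) for which z² - (t μ² + a₁ μ + h) z = u μ³ + (a₂ + t h) μ² - g μ - q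
(`IsParam.modelRel`). In the coordinates (μ : 1 : z) this is a generalised binary quartic, in (μ : z
: 1) a ternary cubic, and with v = μ x = μ (t z + u μ) it becomes a quadric in 1, μ, z, v, paired
with the quadric defining v. The divisor n·∞ is the degenerate choice t = 0, u = 1, w = 0, where μ =
x and z = y + a₁ x. The a-invariants of each model differ from those of the given equation by a
substitution preserving the discriminant (`IsParam.Δ_modelTwo`, `IsParam.Δ_modelThree`,
`IsParam.Δ_modelFour`).

Equations of the image. It remains to see that the displayed equations generate all the relations.
Modulo them and modulo the coordinate that equals 1, forms of degree d are spanned by a short list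
of normal forms. Pole orders at ∞ and at Q show that no nonzero combination of these takes the same
value as a form of degree d - 1. Induction on d finishes (`imageDefinedBy_of_normalForm`).

Foundations. Places are identified with ∞ and the maximal ideals of the coordinate ring, for which
that ring must be shown to be integrally closed. Degrees are colengths of ideals, and the reduction
of D is a dimension count over polynomials in x and y (`exists_mem_poleOrder_le`). -/

lemma dvd_of_isIntegral_of_injective {R L : Type*} [CommRing R] [IsDomain R] [IsIntegrallyClosed R]
    [Field L] [Algebra R L] (inj : Function.Injective (algebraMap R L)) {s d : R} (hd : d ≠ 0) {g : L}
    (hg : IsIntegral R g) (h : g * algebraMap R L d = algebraMap R L s) : d ∣ s := by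
  obtain ⟨P, hP, hPe⟩ := hg
  have hint : IsIntegral R (algebraMap R (FractionRing R) s / algebraMap _ _ d) := by
    let φ : FractionRing R →+* L := IsFractionRing.lift inj
    have h1 : ∀ r, φ (algebraMap R (FractionRing R) r) = algebraMap _ _ r :=
      fun r => IsFractionRing.lift_algebraMap inj r
    refine ⟨P, hP, φ.injective ?_⟩
    rw [hom_eval₂, (RingHom.ext h1 : φ.comp (algebraMap R _) = algebraMap R L), map_zero, map_div₀,
      h1, h1, ← h, mul_div_cancel_right₀, hPe]
    rwa [Ne, map_eq_zero_iff _ inj]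
  obtain ⟨e, he⟩ := IsIntegrallyClosed.isIntegral_iff.mp hint
  refine ⟨e, IsFractionRing.injective R (FractionRing R) ?_⟩
  rw [map_mul, he, mul_div_cancel₀]
  rwa [Ne, map_eq_zero_iff _ (IsFractionRing.injective R (FractionRing R))]

section CoordinateRing

open WeierstrassCurve.Affine

variable {K : Type*} [Field K] (E : WeierstrassCurve.Affine K)

instance : Module.Finite K[X] E.CoordinateRing := .of_basis (CoordinateRing.basis E)

/-- The coordinate function `x`. -/
def xA : E.CoordinateRing := CoordinateRing.mk E (C X)

/-- The coordinate function `y`. -/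
def yA : E.CoordinateRing := CoordinateRing.mk E Y

variable {E}

lemma algebraMap_X : algebraMap K[X] E.CoordinateRing X = xA E := rfl

lemma algebraMap_eq_mk (p : K[X]) :
    algebraMap K[X] E.CoordinateRing p = CoordinateRing.mk E (C p) := rfl

lemma algebraMap_CC (c : K) :
    algebraMap K[X] E.CoordinateRing (C c) = algebraMap K E.CoordinateRing c := by
  rw [IsScalarTower.algebraMap_apply K K[X] E.CoordinateRing]; rfl

lemma exists_add_mul_yA (a : E.CoordinateRing) :
    ∃ p q : K[X], a = algebraMap _ _ p + algebraMap _ _ q * yA E := by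
  obtain ⟨p, q, rfl⟩ := CoordinateRing.exists_smul_basis_eq a
  exact ⟨p, q, by simp [Algebra.smul_def, yA]⟩

lemma add_mul_yA_eq_zero {p q : K[X]}
    (h : algebraMap _ E.CoordinateRing p + algebraMap _ _ q * yA E = 0) : p = 0 ∧ q = 0 :=
  CoordinateRing.smul_basis_eq_zero (W' := E) (by simpa [Algebra.smul_def, yA] using h)

lemma algebraMap_poly_injective : Function.Injective (algebraMap K[X] E.CoordinateRing) :=
  FaithfulSMul.algebraMap_injective _ _

lemma weierstrass_poly :
    yA E ^ 2 + algebraMap K[X] _ (C E.a₁ * X + C E.a₃) * yA E =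
      algebraMap K[X] _ (X ^ 3 + C E.a₂ * X ^ 2 + C E.a₄ * X + C E.a₆) := by
  simp only [yA, algebraMap_eq_mk, ← map_mul, ← map_pow, ← map_add]
  refine AdjoinRoot.mk_eq_mk.mpr ⟨1, ?_⟩
  rw [WeierstrassCurve.Affine.polynomial]
  ring1

variable (E) in
/-- The conjugation of the coordinate ring over `K[X]`. -/
def conj : E.CoordinateRing →ₐ[K[X]] E.CoordinateRing :=
  AdjoinRoot.liftAlgHom E.polynomial (Algebra.ofId K[X] E.CoordinateRing)
    (-yA E - algebraMap K[X] _ (C E.a₁ * X + C E.a₃)) (by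
      have : E.polynomial = Y ^ 2 + C (C E.a₁ * X + C E.a₃) * Y -
        C (X ^ 3 + C E.a₂ * X ^ 2 + C E.a₄ * X + C E.a₆) := by rw [WeierstrassCurve.Affine.polynomial]
      refine (congrArg (eval₂ _ _) this).trans ?_
      simp only [eval₂_sub, eval₂_add, eval₂_mul, eval₂_pow, eval₂_X, eval₂_C]
      simp only [AlgHom.coe_toRingHom, Algebra.ofId_apply]
      linear_combination weierstrass_poly (E := E))

lemma conj_yA : conj E (yA E) = -yA E - algebraMap K[X] _ (C E.a₁ * X + C E.a₃) := by
  simp [conj, yA]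

lemma conj_conj (a : E.CoordinateRing) : conj E (conj E a) = a := by
  obtain ⟨p, q, rfl⟩ := exists_add_mul_yA a
  simp only [map_add, map_mul, AlgHom.commutes, conj_yA, map_sub, map_neg]
  ring

lemma mul_conj (p q : K[X]) :
    (algebraMap _ _ p + algebraMap _ _ q * yA E) * conj E (algebraMap _ _ p + algebraMap _ _ q * yA E)
      = algebraMap K[X] _ (p ^ 2 - p * q * (C E.a₁ * X + C E.a₃) -
      q ^ 2 * (X ^ 3 + C E.a₂ * X ^ 2 + C E.a₄ * X + C E.a₆)) := by
  rw [map_sub, map_mul _ (q ^ 2), ← weierstrass_poly]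
  simp only [map_add, map_mul, AlgHom.commutes, conj_yA, map_sub, map_pow]
  ring

lemma exists_ne_zero_mul_eq_algebraMap {b : E.CoordinateRing} (hb : b ≠ 0) :
    ∃ (c : E.CoordinateRing) (d : K[X]), d ≠ 0 ∧ b * c = algebraMap _ _ d := by
  obtain ⟨p, q, rfl⟩ := exists_add_mul_yA b
  refine ⟨_, _, ?_, mul_conj p q⟩
  intro h
  have h2 := mul_conj (E := E) p q
  rw [h, map_zero, mul_eq_zero] at h2
  rcases h2 with h2 | h2
  · exact hb h2
  · exact hb (by rw [← conj_conj (E := E) (_ + _), h2, map_zero])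

lemma dvd_of_isIntegral {s d : K[X]} (hd : d ≠ 0) {g : E.FunctionField} (hg : IsIntegral K[X] g)
    (h : g * algebraMap K[X] _ d = algebraMap _ _ s) : d ∣ s := by
  refine dvd_of_isIntegral_of_injective ?_ hd hg h
  rw [IsScalarTower.algebraMap_eq K[X] E.CoordinateRing]
  exact (IsFractionRing.injective E.CoordinateRing E.FunctionField).comp algebraMap_poly_injective

/-- The two polynomials are the trace and the norm of p + q y. Smoothness enters here: if π did not
divide q, then (X, -p/q) over the field K[X]/(π) would be a singular point of the curve. No
characteristic has to be excluded. -/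
lemma dvd_of_trace_norm [E.IsElliptic] {π p q : K[X]} (hπ : Irreducible π)
    (ht : π ∣ 2 * p - q * (C E.a₁ * X + C E.a₃))
    (hn : π ^ 2 ∣ p ^ 2 - p * q * (C E.a₁ * X + C E.a₃) -
      q ^ 2 * (X ^ 3 + C E.a₂ * X ^ 2 + C E.a₄ * X + C E.a₆)) : π ∣ p ∧ π ∣ q := by
  have hn1 := (dvd_pow_self π two_ne_zero).trans hn
  by_cases hq : π ∣ q
  · refine ⟨?_, hq⟩
    have : π ∣ p ^ 2 := by
      have h2 := dvd_add hn1 (hq.mul_left (p * (C E.a₁ * X + C E.a₃) +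
        q * (X ^ 3 + C E.a₂ * X ^ 2 + C E.a₄ * X + C E.a₆)))
      convert h2 using 1
      ring
    exact hπ.prime.dvd_of_dvd_pow this
  exfalso
  -- A square factor of the norm forces π to divide its derivative as well; this yields the
  -- vanishing of the partial derivative in x.
  have hder : π ∣ derivative (p ^ 2 - p * q * (C E.a₁ * X + C E.a₃) -
      q ^ 2 * (X ^ 3 + C E.a₂ * X ^ 2 + C E.a₄ * X + C E.a₆)) := by
    obtain ⟨r, hr⟩ := hn
    rw [hr, derivative_mul, derivative_pow]
    exact dvd_add ((dvd_mul_of_dvd_left (dvd_mul_of_dvd_left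
      (by simp) _) _)) ((dvd_pow_self π two_ne_zero).mul_right _)
  have := Fact.mk hπ
  let f := algebraMap K (AdjoinRoot π)
  have ev : ∀ r : K[X], π ∣ r → aeval (AdjoinRoot.root π) r = 0 := fun r hr => by
    rw [AdjoinRoot.aeval_eq]; exact AdjoinRoot.mk_eq_zero.mpr hr
  have hq0 : aeval (AdjoinRoot.root π) q ≠ 0 := by
    rw [AdjoinRoot.aeval_eq]; exact fun h => hq (AdjoinRoot.mk_eq_zero.mp h)
  have e1 := ev _ ht
  have e2 := ev _ hn1
  have e3 := ev _ hder
  simp only [map_sub, map_add, derivative_mul, derivative_pow, derivative_X,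
    derivative_C, map_mul, map_pow, aeval_X, aeval_C, map_natCast, map_ofNat,
    map_one, map_zero] at e1 e2 e3
  set x := AdjoinRoot.root π
  set a := aeval x p
  set b := aeval x q
  have key := (equation_iff_nonsingular (W := E.map f) (x := x) (y := -(a / b))).mp (by
    rw [equation_iff]
    simp only [WeierstrassCurve.map, f]
    field_simp
    linear_combination e2)
  rw [nonsingular_iff] at key
  simp only [WeierstrassCurve.map] at key
  have hy : (2 : AdjoinRoot π) * a = b * (f E.a₁ * x + f E.a₃) := by linear_combination e1
  -- The first alternative concerns the partial derivative in x, contradicted by the norm and its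
  -- derivative; the second the one in y, contradicted by the trace.
  rcases key.2 with h | h
  · apply h
    apply mul_left_cancel₀ (pow_ne_zero 3 hq0)
    have : b * (a / b) = a := mul_div_cancel₀ _ hq0
    push_cast at e3
    linear_combination (-f E.a₁ * b ^ 2) * this + b * e3 - (b * aeval x (derivative p) - 2 * aeval x (derivative q) * a + aeval x (derivative q) * a) * e1 - 2 * aeval x (derivative q) * e2
  · apply h
    apply mul_left_cancel₀ hq0
    have : b * (a / b) = a := mul_div_cancel₀ _ hq0
    linear_combination -2 * this - hy

/-- For g = a/π integral over K[X], the trace and norm of g are integral and lie in K(X), hence are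
polynomials. This is the divisibility of trace and norm of a that `dvd_of_trace_norm` needs. -/
lemma dvd_of_isIntegral_irreducible [E.IsElliptic] {π : K[X]} (hπ : Irreducible π)
    {a : E.CoordinateRing} {g : E.FunctionField} (hg : IsIntegral K[X] g)
    (h : g * algebraMap K[X] _ π = algebraMap _ _ a) : algebraMap _ _ π ∣ a := by
  have hcinj : Function.Injective ((algebraMap E.CoordinateRing E.FunctionField).comp
      (conj E : E.CoordinateRing →+* E.CoordinateRing)) :=
    (IsFractionRing.injective _ _).comp (Function.LeftInverse.injective conj_conj)
  let σ : E.FunctionField →+* E.FunctionField := IsFractionRing.lift hcinj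
  have hσ : ∀ b, σ (algebraMap E.CoordinateRing _ b) = algebraMap _ _ (conj E b) :=
    fun b => IsFractionRing.lift_algebraMap hcinj b
  have hσK : ∀ b, σ (algebraMap K[X] _ b) = algebraMap _ _ b := fun b => by
    rw [IsScalarTower.algebraMap_apply K[X] E.CoordinateRing, hσ, AlgHom.commutes]
  have hg' : IsIntegral K[X] (σ g) := hg.map (⟨σ, hσK⟩ : E.FunctionField →ₐ[K[X]] E.FunctionField)
  have h' : σ g * algebraMap K[X] _ π = algebraMap _ _ (conj E a) := by
    rw [← hσ, ← h, map_mul, hσK]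
  obtain ⟨p, q, rfl⟩ := exists_add_mul_yA a
  obtain ⟨⟨p', rfl⟩, ⟨q', rfl⟩⟩ := dvd_of_trace_norm (E := E) (p := p) (q := q) hπ
    (dvd_of_isIntegral hπ.ne_zero (hg.add hg') (by
      rw [add_mul, h, h', ← map_add, IsScalarTower.algebraMap_apply K[X] E.CoordinateRing _ (_ - _)]
      congr 1
      simp only [map_add, map_mul, AlgHom.commutes, conj_yA, map_sub, map_ofNat]
      ring))
    (dvd_of_isIntegral (pow_ne_zero 2 hπ.ne_zero) (hg.mul hg') (by
      rw [IsScalarTower.algebraMap_apply K[X] E.CoordinateRing _ (_ - _), ← mul_conj, map_mul,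
        ← h, ← h', map_pow]
      ring))
  exact ⟨algebraMap _ _ p' + algebraMap _ _ q' * yA E, by simp only [map_mul]; ring⟩

lemma dvd_of_isIntegral_div [E.IsElliptic] {d : K[X]} (hd : d ≠ 0) :
    ∀ {a : E.CoordinateRing} {g : E.FunctionField}, IsIntegral K[X] g →
    g * algebraMap K[X] _ d = algebraMap _ _ a → algebraMap _ _ d ∣ a := by
  induction d using WfDvdMonoid.induction_on_irreducible with
  | zero => exact absurd rfl hd
  | unit u hu => exact fun _ _ => (hu.map _).dvd
  | mul d π hd' hπ ih =>
    intro a g hg h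
    obtain ⟨a', rfl⟩ := ih hd' (g := g * algebraMap _ _ π) (hg.mul isIntegral_algebraMap)
      (by rw [← h, map_mul, mul_assoc])
    have hne : algebraMap K[X] E.FunctionField d ≠ 0 := by
      rw [IsScalarTower.algebraMap_apply K[X] E.CoordinateRing]
      rwa [Ne, map_eq_zero_iff _ (IsFractionRing.injective _ _),
        map_eq_zero_iff _ algebraMap_poly_injective]
    obtain ⟨a'', rfl⟩ := dvd_of_isIntegral_irreducible (E := E) hπ (a := a') hg (by
      apply mul_right_cancel₀ hne
      rw [mul_assoc, ← map_mul, h, map_mul, mul_comm,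
        ← IsScalarTower.algebraMap_apply K[X] E.CoordinateRing])
    exact ⟨a'', by rw [map_mul]; ring⟩

instance [E.IsElliptic] : IsIntegrallyClosed E.CoordinateRing := by
  refine (isIntegrallyClosed_iff E.FunctionField).mpr fun {g} hg => ?_
  have hg' : IsIntegral K[X] g := isIntegral_trans g hg
  obtain ⟨a, b, hb, rfl⟩ := IsFractionRing.div_surjective (A := E.CoordinateRing) g
  have hb' := nonZeroDivisors.ne_zero hb
  -- Multiplying numerator and denominator by the conjugate of b makes the denominator a polynomial
  -- in x.
  obtain ⟨c, d, hd, hbc⟩ := exists_ne_zero_mul_eq_algebraMap hb'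
  have hbF : algebraMap E.CoordinateRing E.FunctionField b ≠ 0 := by simpa using hb'
  have hdF : algebraMap E.CoordinateRing E.FunctionField (algebraMap K[X] _ d) ≠ 0 := by
    rwa [Ne, map_eq_zero_iff _ (IsFractionRing.injective _ _),
      map_eq_zero_iff _ algebraMap_poly_injective]
  obtain ⟨e, he⟩ := dvd_of_isIntegral_div (E := E) hd (a := a * c) hg' (by
    rw [IsScalarTower.algebraMap_apply K[X] E.CoordinateRing, ← hbc, map_mul, map_mul]
    field_simp)
  refine ⟨e, ?_⟩
  rw [eq_div_iff hbF]
  apply mul_right_cancel₀ hdF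
  have := congrArg (algebraMap _ E.FunctionField) he
  have h2 := congrArg (algebraMap _ E.FunctionField) hbc
  simp only [map_mul] at this h2 ⊢
  rw [← h2] at this ⊢
  have hc : algebraMap E.CoordinateRing E.FunctionField c ≠ 0 := by
    rintro h
    rw [← map_mul, hbc] at h2
    rw [← hbc, map_mul, h, mul_zero] at hdF
    exact hdF rfl
  apply mul_right_cancel₀ hc
  linear_combination (-algebraMap _ E.FunctionField b * algebraMap _ E.FunctionField c) * this

instance [E.IsElliptic] : IsDedekindDomain E.CoordinateRing :=
  { (inferInstance : IsNoetherianRing E.CoordinateRing),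
    (inferInstance : IsIntegrallyClosed E.CoordinateRing),
    Ring.DimensionLEOne.of_isIntegral K[X] E.CoordinateRing with }

end CoordinateRing

end GenusOne

end

/-! ### The valuation at infinity and its uniqueness. -/

noncomputable section

open Polynomial

open scoped nonZeroDivisors Polynomial.Bivariate WithZero

namespace GenusOne

section Infinity

open WeierstrassCurve.Affine

variable {K : Type*} [Field K] {E : WeierstrassCurve.Affine K}

/-- The pole order at infinity of an element of the coordinate ring. -/
def poleOrder (a : E.CoordinateRing) : ℕ := (Algebra.norm K[X] a).natDegree

lemma norm_add_mul_yA (p q : K[X]) :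
    (Algebra.norm K[X] (algebraMap _ E.CoordinateRing p + algebraMap _ _ q * yA E)).degree =
      max (2 • p.degree) (2 • q.degree + 3) := by
  rw [← CoordinateRing.degree_norm_smul_basis (W' := E) p q]
  simp [Algebra.smul_def, yA]

lemma norm_ne_zero {a : E.CoordinateRing} (ha : a ≠ 0) : Algebra.norm K[X] a ≠ 0 :=
  Algebra.norm_ne_zero_iff.mpr ha

lemma degree_norm {a : E.CoordinateRing} (ha : a ≠ 0) :
    (Algebra.norm K[X] a).degree = poleOrder a :=
  degree_eq_natDegree (norm_ne_zero ha)

/-- The norm of p + q y has degree max (2 deg p) (2 deg q + 3), so the ultrametric inequality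
reduces to that for degrees of p and q. -/
lemma degree_norm_add_le (a b : E.CoordinateRing) :
    (Algebra.norm K[X] (a + b)).degree ≤
      max (Algebra.norm K[X] a).degree (Algebra.norm K[X] b).degree := by
  obtain ⟨p, q, rfl⟩ := exists_add_mul_yA a
  obtain ⟨r, s, rfl⟩ := exists_add_mul_yA b
  rw [show algebraMap _ E.CoordinateRing p + algebraMap _ _ q * yA E +
    (algebraMap _ _ r + algebraMap _ _ s * yA E) =
    algebraMap _ E.CoordinateRing (p + r) + algebraMap _ _ (q + s) * yA E by
      simp only [map_add]; ring]
  simp only [norm_add_mul_yA]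
  have h1 := degree_add_le p r
  have h2 := degree_add_le q s
  rcases le_total p.degree r.degree with h3 | h3 <;> rcases le_total q.degree s.degree with h4 | h4 <;>
    simp only [max_eq_left, max_eq_right, h3, h4] at h1 h2 <;>
    refine max_le ?_ ?_
  all_goals first
    | grw [h1]; exact le_max_of_le_left (le_max_left _ _)
    | grw [h2]; exact le_max_of_le_left (le_max_right _ _)
    | grw [h1]; exact le_max_of_le_right (le_max_left _ _)
    | grw [h2]; exact le_max_of_le_right (le_max_right _ _)

lemma poleOrder_mul {a b : E.CoordinateRing} (ha : a ≠ 0) (hb : b ≠ 0) :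
    poleOrder (a * b) = poleOrder a + poleOrder b := by
  rw [poleOrder, map_mul, natDegree_mul (norm_ne_zero ha) (norm_ne_zero hb)]; rfl

open Classical in
variable (E) in
/-- The valuation at infinity on the coordinate ring. -/
def inftyValuationA : Valuation E.CoordinateRing ℤᵐ⁰ where
  toFun a := if a = 0 then 0 else WithZero.exp (poleOrder a : ℤ)
  map_zero' := if_pos rfl
  map_one' := by simp [poleOrder]
  map_mul' a b := by
    by_cases ha : a = 0
    · simp [ha]
    by_cases hb : b = 0
    · simp [hb]
    simp [ha, hb, poleOrder_mul ha hb, WithZero.exp_add]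
  map_add_le_max' a b := by
    by_cases ha : a = 0
    · simp [ha]
    by_cases hb : b = 0
    · simp [hb]
    by_cases hab : a + b = 0
    · simp [hab]
    simp only [ha, hb, hab, if_false]
    have := degree_norm_add_le a b
    rw [degree_norm ha, degree_norm hb, degree_norm hab] at this
    rcases le_max_iff.mp this with h | h
    · exact le_max_of_le_left (WithZero.exp_le_exp.mpr (by exact_mod_cast h))
    · exact le_max_of_le_right (WithZero.exp_le_exp.mpr (by exact_mod_cast h))

lemma inftyValuationA_apply {a : E.CoordinateRing} (ha : a ≠ 0) :
    inftyValuationA E a = WithZero.exp (poleOrder a : ℤ) := if_neg ha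

lemma supp_inftyValuationA : (inftyValuationA E).supp = ⊥ := by
  ext a
  rw [Valuation.mem_supp_iff, Ideal.mem_bot]
  refine ⟨fun h => ?_, fun h => by rw [h, map_zero]⟩
  by_contra ha
  rw [inftyValuationA_apply ha] at h
  exact WithZero.exp_ne_zero h

variable (E) in
/-- The valuation of the function field at the point at infinity. -/
def inftyValuation : Valuation E.FunctionField ℤᵐ⁰ :=
  (inftyValuationA E).extendToLocalization (S := E.CoordinateRing⁰)
    (fun _ ha h => nonZeroDivisors.ne_zero ha
      ((Ideal.mem_bot).mp (supp_inftyValuationA (E := E) ▸ h))) E.FunctionField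

lemma inftyValuation_algebraMap {a : E.CoordinateRing} (ha : a ≠ 0) :
    inftyValuation E (algebraMap _ _ a) = WithZero.exp (poleOrder a : ℤ) := by
  exact (Valuation.extendToLocalization_apply_map_apply _ _ _ _).trans (inftyValuationA_apply ha)

lemma xA_ne_zero : xA E ≠ 0 := by
  have := CoordinateRing.XClass_ne_zero (W' := E) 0
  simpa [CoordinateRing.XClass, xA] using this

lemma yA_ne_zero : yA E ≠ 0 := by
  have := CoordinateRing.YClass_ne_zero (W' := E) 0
  simpa [CoordinateRing.YClass, yA] using this

lemma poleOrder_poly (p : K[X]) :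
    poleOrder (algebraMap _ E.CoordinateRing p) = 2 * p.natDegree := by
  have := Algebra.norm_algebraMap_of_basis (CoordinateRing.basis E) p
  rw [Fintype.card_fin] at this
  rw [poleOrder, this, natDegree_pow]

lemma poleOrder_xA : poleOrder (xA E) = 2 := by
  rw [← algebraMap_X, poleOrder_poly, natDegree_X]

lemma poleOrder_yA : poleOrder (yA E) = 3 := by
  have h := norm_add_mul_yA (E := E) 0 1
  rw [map_zero, zero_add, map_one, one_mul, degree_norm yA_ne_zero] at h
  simp at h
  exact_mod_cast h

lemma poleOrder_const (c : K) : poleOrder (algebraMap K E.CoordinateRing c) = 0 := by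
  rw [← algebraMap_CC, poleOrder_poly, natDegree_C]

lemma poleOrder_add_mul_yA {p q : K[X]} (hp : p ≠ 0) (hq : q ≠ 0) :
    poleOrder (algebraMap _ E.CoordinateRing p + algebraMap _ _ q * yA E) =
      max (2 * p.natDegree) (2 * q.natDegree + 3) := by
  have h := norm_add_mul_yA (E := E) p q
  rw [degree_norm (fun h => hp (add_mul_yA_eq_zero h).1), degree_eq_natDegree hp,
    degree_eq_natDegree hq] at h
  simp only [nsmul_eq_mul] at h
  have h' : ((poleOrder (algebraMap _ E.CoordinateRing p + algebraMap _ _ q * yA E) : ℕ) : WithBot ℕ)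
      = max ((2 * p.natDegree : ℕ) : WithBot ℕ) ((2 * q.natDegree + 3 : ℕ) : WithBot ℕ) := by
    exact_mod_cast h
  exact WithBot.coe_injective (h'.trans (WithBot.coe_max _ _).symm)

lemma poleOrder_poly_mul_yA {q : K[X]} (hq : q ≠ 0) :
    poleOrder (algebraMap _ E.CoordinateRing q * yA E) = 2 * q.natDegree + 3 := by
  rw [poleOrder_mul ((map_ne_zero_iff _ algebraMap_poly_injective).mpr hq) yA_ne_zero,
    poleOrder_poly, poleOrder_yA]

section OneLt

variable {Γ : Type*} [LinearOrderedCommGroupWithZero Γ] (V : Valuation E.FunctionField Γ)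
  [V.IsTrivialOn K]

lemma valuation_poly (hx : 1 < V (algebraMap _ _ (xA E))) {p : K[X]} (hp : p ≠ 0) :
    V (algebraMap _ _ (algebraMap K[X] E.CoordinateRing p)) =
      V (algebraMap _ _ (xA E)) ^ p.natDegree := by
  rw [← valuation_aeval_eq_valuation_X_pow_natDegree_of_one_lt_valuation_X _ hx hp,
    aeval_algebraMap_apply, ← algebraMap_X, aeval_algebraMap_apply, aeval_X_left_apply]

/-- The cubic in x has value V(x)³. If V(y) ≤ V(x), the other side of the Weierstrass equation would
be at most V(x)²; hence V(y) > V(x) and the term y² dominates. -/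
lemma valuation_yA_sq (hx : 1 < V (algebraMap _ _ (xA E))) :
    V (algebraMap _ _ (yA E)) ^ 2 = V (algebraMap _ _ (xA E)) ^ 3 := by
  have h := congrArg (fun a => V (algebraMap _ _ a)) (weierstrass_poly (E := E))
  have hne : (X ^ 3 + C E.a₂ * X ^ 2 + C E.a₄ * X + C E.a₆ : K[X]) ≠ 0 := fun h0 => by
    have := congrArg (coeff · 3) h0
    simp at this
  rw [valuation_poly V hx hne, show (X ^ 3 + C E.a₂ * X ^ 2 + C E.a₄ * X + C E.a₆ : K[X]).natDegree = 3
    by compute_degree!, map_add, map_mul, map_pow] at h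
  have hlin : V (algebraMap _ _ (algebraMap K[X] E.CoordinateRing (C E.a₁ * X + C E.a₃))) ≤
      V (algebraMap _ _ (xA E)) := by
    by_cases h0 : C E.a₁ * X + C E.a₃ = 0
    · rw [h0, map_zero, map_zero, map_zero]; exact zero_le
    · rw [valuation_poly V hx h0]
      exact (pow_le_pow_right₀ hx.le natDegree_linear_le).trans_eq (pow_one _)
  set x := V (algebraMap _ _ (xA E))
  set y := V (algebraMap _ _ (yA E)) with hy
  have hxy : x < y := by
    by_contra! hle
    have : x ^ 3 ≤ x ^ 2 := by
      rw [← h]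
      refine (V.map_add _ _).trans (max_le ?_ ?_)
      · rw [map_pow]; exact pow_le_pow_left₀ zero_le hle 2
      · rw [map_mul, sq]; exact mul_le_mul' hlin hle
    exact absurd this (not_le.mpr (pow_lt_pow_right₀ hx (by norm_num)))
  rw [← h, Valuation.map_add_eq_of_lt_left, map_pow]
  rw [map_mul, map_pow, sq]
  exact mul_lt_mul_of_pos_right (hlin.trans_lt hxy) (zero_lt_one.trans (hx.trans hxy))

/-- In p + q y the two summands have squared values V(x) to the powers 2 deg p and 2 deg q + 3.
These exponents have different parity, so the terms never cancel and V is determined by V(x). -/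
lemma valuation_sq (hx : 1 < V (algebraMap _ _ (xA E)))
    {a : E.CoordinateRing} (ha : a ≠ 0) :
    V (algebraMap _ _ a) ^ 2 = V (algebraMap _ _ (xA E)) ^ poleOrder a := by
  obtain ⟨p, q, rfl⟩ := exists_add_mul_yA a
  have hP : ∀ {p : K[X]}, p ≠ 0 → V (algebraMap _ _ (algebraMap K[X] E.CoordinateRing p)) ^ 2 =
      V (algebraMap _ _ (xA E)) ^ (2 * p.natDegree) := fun hp => by
    rw [valuation_poly V hx hp, ← pow_mul, mul_comm]
  have hQ : ∀ {q : K[X]}, q ≠ 0 → V (algebraMap _ _ (algebraMap K[X] E.CoordinateRing q * yA E)) ^ 2 =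
      V (algebraMap _ _ (xA E)) ^ (2 * q.natDegree + 3) := fun hq => by
    rw [map_mul, map_mul, mul_pow, hP hq, valuation_yA_sq V hx, pow_add]
  by_cases hp : p = 0
  · subst hp
    have hq : q ≠ 0 := by rintro rfl; simp at ha
    rw [map_zero, zero_add, hQ hq, poleOrder_poly_mul_yA hq]
  by_cases hq : q = 0
  · subst hq
    rw [map_zero, zero_mul, add_zero, hP hp, poleOrder_poly]
  rw [poleOrder_add_mul_yA hp hq, map_add]
  rcases lt_or_gt_of_ne (show 2 * p.natDegree ≠ 2 * q.natDegree + 3 by omega) with h | h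
  · rw [Valuation.map_add_eq_of_lt_right, max_eq_right h.le, hQ hq]
    refine lt_of_pow_lt_pow_left₀ 2 zero_le ?_
    rw [hP hp, hQ hq]
    exact pow_lt_pow_right₀ hx h
  · rw [Valuation.map_add_eq_of_lt_left, max_eq_left h.le, hP hp]
    refine lt_of_pow_lt_pow_left₀ 2 zero_le ?_
    rw [hP hp, hQ hq]
    exact pow_lt_pow_right₀ hx h

/-- Infinity is thus the only place at which x has a pole. -/
lemma valuation_le_one_iff_inftyValuation (hx : 1 < V (algebraMap _ _ (xA E)))
    (f : E.FunctionField) :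
    V f ≤ 1 ↔ inftyValuation E f ≤ 1 := by
  obtain ⟨a, b, hb, rfl⟩ := IsFractionRing.div_surjective (A := E.CoordinateRing) f
  have hb := nonZeroDivisors.ne_zero hb
  by_cases ha : a = 0
  · simp [ha]
  have hb' : 0 < V (algebraMap _ _ b) := by
    rw [zero_lt_iff, Valuation.ne_zero_iff]
    rwa [Ne, map_eq_zero_iff _ (IsFractionRing.injective _ _)]
  rw [map_div₀, map_div₀, inftyValuation_algebraMap ha, inftyValuation_algebraMap hb,
    ← WithZero.exp_sub, ← WithZero.exp_zero, WithZero.exp_le_exp, div_le_one₀ hb',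
    ← pow_le_pow_iff_left₀ zero_le zero_le two_ne_zero, valuation_sq V hx ha,
    valuation_sq V hx hb, pow_le_pow_iff_right₀ hx]
  omega

end OneLt

end Infinity

end GenusOne

end

/-! ### Places of the function field and Riemann-Roch conditions as valuation bounds. -/

noncomputable section

open Polynomial

open scoped nonZeroDivisors Polynomial.Bivariate WithZero

namespace GenusOne

open IsDedekindDomain

section DiscretePlace

variable {K F : Type*} [Field K] [Field F] [Algebra K F] {p : Place K F} {v : Valuation F ℤᵐ⁰}

lemma mem_maximalIdeal_iff (hv : p.ring = v.valuationSubring) (a : p.ring) :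
    a ∈ IsLocalRing.maximalIdeal p.ring ↔ v a < 1 := by
  have mem : ∀ f, f ∈ p.ring ↔ v f ≤ 1 := fun f => by rw [hv, Valuation.mem_valuationSubring_iff]
  rw [← ValuationSubring.coe_mem_nonunits_iff, ValuationSubring.mem_nonunits_iff_or, mem, not_le]
  by_cases ha : (a : F) = 0
  · simp [ha]
  · rw [Valuation.one_lt_val_iff _ (inv_ne_zero ha), inv_inv]
    simp [ha]

lemma lt_one_iff_le_exp_neg_one {x : ℤᵐ⁰} : x < 1 ↔ x ≤ WithZero.exp (-1 : ℤ) := by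
  by_cases hx : x = 0
  · simp [hx]
  · rw [← WithZero.exp_log hx, ← WithZero.exp_zero, WithZero.exp_lt_exp, WithZero.exp_le_exp]
    omega

lemma isUniformizer_iff (hv : p.ring = v.valuationSubring) {ϖ : F}
    (hϖ : v ϖ = WithZero.exp (-1 : ℤ)) (π : F) :
    p.IsUniformizer π ↔ v π = WithZero.exp (-1 : ℤ) := by
  have mem : ∀ f, f ∈ p.ring ↔ v f ≤ 1 := fun f => by rw [hv, Valuation.mem_valuationSubring_iff]
  constructor
  · rintro ⟨h, hm⟩
    have h1 : v π < 1 := (mem_maximalIdeal_iff hv ⟨π, h⟩).mp (by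
      rw [hm]; exact Ideal.mem_span_singleton_self _)
    have h2 : v ϖ < 1 := by rw [hϖ]; exact lt_one_iff_le_exp_neg_one.mpr le_rfl
    have h3 := (mem_maximalIdeal_iff hv ⟨ϖ, (mem _).mpr h2.le⟩).mpr h2
    rw [hm, Ideal.mem_span_singleton] at h3
    obtain ⟨c, hc⟩ := h3
    have h4 : ϖ = π * c := congrArg Subtype.val hc
    refine le_antisymm (lt_one_iff_le_exp_neg_one.mp h1) ?_
    rw [← hϖ, h4, map_mul]
    exact mul_le_of_le_one_right' ((mem _).mp c.2)
  · intro h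
    have h1 : v π < 1 := by rw [h]; exact lt_one_iff_le_exp_neg_one.mpr le_rfl
    have h0 : π ≠ 0 := by rintro rfl; rw [map_zero] at h; exact WithZero.exp_ne_zero h.symm
    refine ⟨(mem _).mpr h1.le, le_antisymm (fun a ha => ?_) ?_⟩
    · rw [mem_maximalIdeal_iff hv, lt_one_iff_le_exp_neg_one, ← h] at ha
      refine Ideal.mem_span_singleton.mpr ⟨⟨a / π, (mem _).mpr ?_⟩, Subtype.ext ?_⟩
      · rw [map_div₀]
        exact div_le_one_of_le₀ ha zero_le
      · exact (mul_div_cancel₀ (a : F) h0).symm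
    · rw [Ideal.span_singleton_le_iff_mem, mem_maximalIdeal_iff hv]
      exact h1

/-- The element ϖ guarantees that a uniformiser exists, without which the condition over all
uniformisers would be vacuous; any two have the same value, so one test suffices. -/
lemma forall_isUniformizer_iff (hv : p.ring = v.valuationSubring) {ϖ : F}
    (hϖ : v ϖ = WithZero.exp (-1 : ℤ)) (f : F) (n : ℤ) :
    (∀ π, p.IsUniformizer π → f * π ^ n ∈ p.ring) ↔ v f ≤ WithZero.exp n := by
  have key : ∀ π, v π = WithZero.exp (-1 : ℤ) → (f * π ^ n ∈ p.ring ↔ v f ≤ WithZero.exp n) := by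
    intro π hπ
    rw [hv, Valuation.mem_valuationSubring_iff, map_mul, map_zpow₀, hπ, ← WithZero.exp_zsmul,
      smul_eq_mul, mul_neg, mul_one, WithZero.exp_neg, mul_inv_le_iff₀ (WithZero.exp_pos), one_mul]
  constructor
  · exact fun h => (key ϖ hϖ).mp (h ϖ ((isUniformizer_iff hv hϖ ϖ).mpr hϖ))
  · exact fun h π hπ => (key π ((isUniformizer_iff hv hϖ π).mp hπ)).mpr h

end DiscretePlace

section Places

open WeierstrassCurve.Affine

variable {K : Type*} [Field K] {E : WeierstrassCurve.Affine K}

lemma algebraMap_K_eq (c : K) : algebraMap K E.FunctionField c =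
    algebraMap E.CoordinateRing E.FunctionField (algebraMap K _ c) :=
  IsScalarTower.algebraMap_apply K E.CoordinateRing E.FunctionField c

lemma algebraMap_F_ne_zero {a : E.CoordinateRing} (ha : a ≠ 0) :
    algebraMap E.CoordinateRing E.FunctionField a ≠ 0 := by
  rwa [Ne, map_eq_zero_iff _ (IsFractionRing.injective _ _)]

instance : (inftyValuation E).IsTrivialOn K where
  eq_one c hc := by
    rw [algebraMap_K_eq, inftyValuation_algebraMap (by rwa [Ne, map_eq_zero_iff _
      (FaithfulSMul.algebraMap_injective _ _)]), poleOrder_const]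
    rfl

lemma inftyValuation_xA :
    inftyValuation E (algebraMap _ _ (xA E)) = WithZero.exp (2 : ℤ) := by
  rw [inftyValuation_algebraMap xA_ne_zero, poleOrder_xA]; rfl

lemma inftyValuation_yA :
    inftyValuation E (algebraMap _ _ (yA E)) = WithZero.exp (3 : ℤ) := by
  rw [inftyValuation_algebraMap yA_ne_zero, poleOrder_yA]; rfl

lemma exists_inftyValuation_eq : ∃ ϖ, inftyValuation E ϖ = WithZero.exp (-1 : ℤ) :=
  ⟨algebraMap _ _ (xA E) / algebraMap _ _ (yA E), by
    rw [map_div₀, inftyValuation_xA, inftyValuation_yA, ← WithZero.exp_sub]; rfl⟩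

lemma valuationSubring_ne_top {F : Type*} [Field F] {v : Valuation F ℤᵐ⁰} {ϖ : F}
    (hϖ : v ϖ = WithZero.exp (-1 : ℤ)) : v.valuationSubring ≠ ⊤ := by
  intro h
  have h1 : ϖ⁻¹ ∈ v.valuationSubring := h ▸ ValuationSubring.mem_top _
  rw [Valuation.mem_valuationSubring_iff, map_inv₀, hϖ, ← WithZero.exp_neg, ← WithZero.exp_zero,
    WithZero.exp_le_exp] at h1
  omega

variable (E) in
/-- The place at infinity. -/
def inftyPlace : Place K E.FunctionField where
  ring := (inftyValuation E).valuationSubring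
  algebraMap_mem c := by
    rw [Valuation.mem_valuationSubring_iff]
    by_cases hc : c = 0
    · simp [hc]
    · rw [Valuation.IsTrivialOn.eq_one (v := inftyValuation E) c hc]
  ne_top := valuationSubring_ne_top exists_inftyValuation_eq.choose_spec

variable [E.IsElliptic]

/-- The place attached to a maximal ideal of the coordinate ring. -/
def finitePlace (v : HeightOneSpectrum E.CoordinateRing) : Place K E.FunctionField where
  ring := (v.valuation E.FunctionField).valuationSubring
  algebraMap_mem c := by
    rw [Valuation.mem_valuationSubring_iff, algebraMap_K_eq]
    exact v.valuation_le_one _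
  ne_top := valuationSubring_ne_top (v.valuation_exists_uniformizer E.FunctionField).choose_spec

lemma Place.ext {F : Type*} [Field F] [Algebra K F] {p q : Place K F} (h : p.ring = q.ring) :
    p = q := by
  cases p; cases q; congr

lemma finitePlace_injective :
    Function.Injective (finitePlace : HeightOneSpectrum E.CoordinateRing → _) := fun v w h => by
  apply HeightOneSpectrum.eq_of_valuation_isEquiv_valuation (K := E.FunctionField)
  rw [Valuation.isEquiv_iff_valuationSubring]
  exact congrArg Place.ring h

lemma finitePlace_ne_inftyPlace (v : HeightOneSpectrum E.CoordinateRing) :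
    finitePlace v ≠ inftyPlace E := fun h => by
  have h1 : algebraMap _ _ (xA E) ∈ (finitePlace v).ring := v.valuation_le_one _
  rw [h] at h1
  have h2 : inftyValuation E (algebraMap _ _ (xA E)) ≤ 1 := h1
  rw [inftyValuation_xA, ← WithZero.exp_zero, WithZero.exp_le_exp] at h2
  omega

/-- The centre of p, the contraction of its maximal ideal, is nonzero, since otherwise every
fraction would lie in the valuation ring. The localisation at the centre is then contained in that
ring, and an element outside the localisation has an inverse in its maximal ideal, so it cannot lie
in p either. -/
lemma exists_eq_finitePlace (p : Place K E.FunctionField)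
    (hp : ∀ a, algebraMap E.CoordinateRing E.FunctionField a ∈ p.ring) :
    ∃ v, p = finitePlace v := by
  let φ : E.CoordinateRing →+* p.ring := (algebraMap E.CoordinateRing E.FunctionField).codRestrict _ hp
  have hmem : ∀ a, a ∈ (IsLocalRing.maximalIdeal p.ring).comap φ ↔
      (a = 0 ∨ (algebraMap E.CoordinateRing E.FunctionField a)⁻¹ ∉ p.ring) := fun a => by
    rw [Ideal.mem_comap, ← ValuationSubring.coe_mem_nonunits_iff,
      ValuationSubring.mem_nonunits_iff_or]
    change algebraMap E.CoordinateRing E.FunctionField a = 0 ∨ _ ↔ _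
    rw [map_eq_zero_iff _ (IsFractionRing.injective _ _)]
    rfl
  let v : HeightOneSpectrum E.CoordinateRing :=
    { asIdeal := (IsLocalRing.maximalIdeal p.ring).comap φ
      isPrime := inferInstance
      ne_bot := fun hbot => p.ne_top (by
        rw [eq_top_iff]
        intro f _
        obtain ⟨a, b, hb, rfl⟩ := IsFractionRing.div_surjective (A := E.CoordinateRing) f
        rw [div_eq_mul_inv]
        refine p.ring.mul_mem _ _ (hp a) ?_
        by_contra hcon
        have : b ∈ (IsLocalRing.maximalIdeal p.ring).comap φ := (hmem b).mpr (Or.inr hcon)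
        rw [hbot, Ideal.mem_bot] at this
        exact nonZeroDivisors.ne_zero hb this) }
  refine ⟨v, Place.ext ?_⟩
  symm
  have hle : (finitePlace v).ring ≤ p.ring := by
    intro f hf
    obtain ⟨n, d, hnd⟩ := v.exists_primeCompl_mul_eq_of_integer f hf
    have hd : (d : E.CoordinateRing) ∉ (IsLocalRing.maximalIdeal p.ring).comap φ := d.2
    rw [hmem, not_or, not_not] at hd
    have hd0 := algebraMap_F_ne_zero hd.1
    rw [eq_div_of_mul_eq hd0 hnd, div_eq_mul_inv]
    exact p.ring.mul_mem _ _ (hp n) hd.2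
  refine le_antisymm hle fun f hf => ?_
  by_contra hcon
  have hcon' : 1 < v.valuation E.FunctionField f := not_le.mp hcon
  have hf0 : f ≠ 0 := by rintro rfl; simp at hcon'
  have hinv : v.valuation E.FunctionField f⁻¹ ≤ 1 := by
    rw [map_inv₀]; exact inv_le_one_of_one_le₀ hcon'.le
  obtain ⟨n, d, hnd⟩ := v.exists_primeCompl_mul_eq_of_integer f⁻¹ hinv
  have hd : (d : E.CoordinateRing) ∉ (IsLocalRing.maximalIdeal p.ring).comap φ := d.2
  have hd0 : (d : E.CoordinateRing) ≠ 0 := fun h => hd (h ▸ Ideal.zero_mem _)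
  have hn : n ∈ (IsLocalRing.maximalIdeal p.ring).comap φ := by
    refine (v.valuation_lt_one_iff_mem (K := E.FunctionField) n).mp ?_
    change v.valuation E.FunctionField (algebraMap _ _ n) < 1
    have hd1 : v.valuation E.FunctionField (algebraMap _ _ (d : E.CoordinateRing)) = 1 :=
      v.valuation_eq_one_iff_notMem.mpr d.2
    rw [← hnd, map_mul, map_inv₀, hd1, mul_one]
    exact inv_lt_one_of_one_lt₀ hcon'
  rw [hmem] at hn hd
  push Not at hd
  rcases hn with hn | hn
  · rw [hn, map_zero, mul_eq_zero] at hnd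
    rcases hnd with h | h
    · exact inv_ne_zero hf0 h
    · exact algebraMap_F_ne_zero hd0 h
  · refine hn ?_
    rw [← hnd, mul_inv, inv_inv]
    exact p.ring.mul_mem _ _ hf hd.2

/-- If x is regular at p then so is y, being integral over K[x], and p is centred on the affine
curve. If x has a pole at p, `valuation_le_one_iff_inftyValuation` identifies p with infinity. -/
lemma eq_inftyPlace_or_eq_finitePlace (p : Place K E.FunctionField) :
    p = inftyPlace E ∨ ∃ v, p = finitePlace v := by
  by_cases hx : algebraMap _ _ (xA E) ∈ p.ring
  · refine Or.inr (exists_eq_finitePlace p fun a => ?_)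
    have hpoly : ∀ r : K[X], algebraMap E.CoordinateRing E.FunctionField (algebraMap _ _ r) ∈ p.ring := by
      intro r
      induction r using Polynomial.induction_on' with
      | add r s hr hs => rw [map_add, map_add]; exact p.ring.add_mem _ _ hr hs
      | monomial n c =>
        rw [← C_mul_X_pow_eq_monomial, map_mul, map_pow, map_mul, map_pow, algebraMap_X, algebraMap_CC,
          ← algebraMap_K_eq]
        exact p.ring.mul_mem _ _ (p.algebraMap_mem c) (pow_mem hx n)
    have hy : algebraMap _ _ (yA E) ∈ p.ring := by
      by_contra hy
      have hinv := (p.ring.mem_or_inv_mem _).resolve_left hy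
      apply hy
      have h := congrArg (algebraMap _ E.FunctionField) (weierstrass_poly (E := E))
      have hy0 := algebraMap_F_ne_zero (yA_ne_zero (E := E))
      rw [map_add, map_mul, map_pow] at h
      set l := algebraMap E.CoordinateRing E.FunctionField (algebraMap K[X] _ (C E.a₁ * X + C E.a₃))
      set y := algebraMap E.CoordinateRing E.FunctionField (yA E)
      have : y = algebraMap E.CoordinateRing E.FunctionField (algebraMap K[X] _
          (X ^ 3 + C E.a₂ * X ^ 2 + C E.a₄ * X + C E.a₆)) * y⁻¹ - l := by
        rw [← h]; field_simp; ring
      rw [this]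
      exact sub_mem (p.ring.mul_mem _ _ (hpoly _) hinv) (hpoly _)
    obtain ⟨r, s, rfl⟩ := exists_add_mul_yA a
    rw [map_add, map_mul]
    exact p.ring.add_mem _ _ (hpoly r) (p.ring.mul_mem _ _ (hpoly s) hy)
  · refine Or.inl (Place.ext (ValuationSubring.ext _ _ fun f => ?_))
    have : p.ring.valuation.IsTrivialOn K := ⟨fun c hc => by
      have h1 := (p.ring.valuation_le_one_iff _).mpr (p.algebraMap_mem c)
      have h2 := (p.ring.valuation_le_one_iff _).mpr (p.algebraMap_mem c⁻¹)
      rw [map_inv₀, map_inv₀] at h2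
      refine le_antisymm h1 ?_
      rwa [inv_le_one₀] at h2
      rw [zero_lt_iff, Valuation.ne_zero_iff]
      simpa using hc⟩
    have hx' : 1 < p.ring.valuation (algebraMap _ _ (xA E)) := by
      rwa [← not_le, ValuationSubring.valuation_le_one_iff]
    rw [← ValuationSubring.valuation_le_one_iff, valuation_le_one_iff_inftyValuation _ hx']
    rfl

lemma mem_riemannRoch_iff (D : Divisor K E.FunctionField) (f : E.FunctionField) :
    f ∈ riemannRoch D ↔
      (∀ v : HeightOneSpectrum E.CoordinateRing,
        v.valuation E.FunctionField f ≤ WithZero.exp (D (finitePlace v))) ∧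
      inftyValuation E f ≤ WithZero.exp (D (inftyPlace E)) := by
  have h1 : ∀ v : HeightOneSpectrum E.CoordinateRing,
    (∀ π, (finitePlace v).IsUniformizer π → f * π ^ D (finitePlace v) ∈ (finitePlace v).ring) ↔
      v.valuation E.FunctionField f ≤ WithZero.exp (D (finitePlace v)) := fun v =>
    forall_isUniformizer_iff rfl (v.valuation_exists_uniformizer E.FunctionField).choose_spec f _
  have h2 : (∀ π, (inftyPlace E).IsUniformizer π → f * π ^ D (inftyPlace E) ∈ (inftyPlace E).ring) ↔
      inftyValuation E f ≤ WithZero.exp (D (inftyPlace E)) :=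
    forall_isUniformizer_iff rfl exists_inftyValuation_eq.choose_spec f _
  constructor
  · exact fun h => ⟨fun v => (h1 v).mp (h _), h2.mp (h _)⟩
  · rintro ⟨h, h'⟩ p
    rcases eq_inftyPlace_or_eq_finitePlace p with rfl | ⟨v, rfl⟩
    · exact h2.mpr h'
    · exact (h1 v).mpr (h v)

end Places

end GenusOne

end

/-! ### Degrees of places and colengths of ideals. -/

noncomputable section

open Polynomial

open scoped nonZeroDivisors Polynomial.Bivariate WithZero

namespace GenusOne

open IsDedekindDomain WeierstrassCurve.Affine

section Degrees

variable {K : Type*} [Field K] {E : WeierstrassCurve.Affine K}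

lemma two_nsmul_lt_iff {d : WithBot ℕ} {n : ℕ} : 2 • d < (n : WithBot ℕ) ↔ d < ((n + 1) / 2 : ℕ) := by
  induction d using WithBot.recBotCoe with
  | bot => simp
  | coe d =>
    have : 2 • (WithBot.some d : WithBot ℕ) = ((2 * d : ℕ) : WithBot ℕ) := by
      rw [nsmul_eq_mul]; rfl
    rw [this]
    change ((2 * d : ℕ) : WithBot ℕ) < n ↔ ((d : ℕ) : WithBot ℕ) < _
    rw [Nat.cast_lt, Nat.cast_lt]
    omega

lemma two_nsmul_add_three_lt_iff {d : WithBot ℕ} {n : ℕ} :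
    2 • d + 3 < (n : WithBot ℕ) ↔ d < ((n - 2) / 2 : ℕ) := by
  induction d using WithBot.recBotCoe with
  | bot => simp
  | coe d =>
    have : 2 • (WithBot.some d : WithBot ℕ) + 3 = ((2 * d + 3 : ℕ) : WithBot ℕ) := by
      rw [nsmul_eq_mul]; rfl
    rw [this]
    change ((2 * d + 3 : ℕ) : WithBot ℕ) < n ↔ ((d : ℕ) : WithBot ℕ) < _
    rw [Nat.cast_lt, Nat.cast_lt]
    omega

/-- The strict bounds 2 deg p < n and 2 deg q + 3 < n, rounded to bounds in ℕ. Truncated subtraction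
is harmless: for n ≤ 3 the second bound is 0 and forces q = 0. -/
lemma inftyValuation_lt_exp_iff (p q : K[X]) (n : ℕ) :
    inftyValuation E (algebraMap _ _ (algebraMap _ E.CoordinateRing p + algebraMap _ _ q * yA E)) <
      WithZero.exp (n : ℤ) ↔ p.degree < ((n + 1) / 2 : ℕ) ∧ q.degree < ((n - 2) / 2 : ℕ) := by
  rw [← two_nsmul_lt_iff, ← two_nsmul_add_three_lt_iff, ← max_lt_iff, ← norm_add_mul_yA]
  by_cases h : algebraMap _ E.CoordinateRing p + algebraMap _ _ q * yA E = 0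
  · rw [h]; simp
  · rw [inftyValuation_algebraMap h, degree_norm h, WithZero.exp_lt_exp]
    norm_cast

lemma exists_degree_sub_lt {p r : K[X]} {k : ℕ} (hp : p.degree < (k + 1 : ℕ))
    (hr : r.degree < (k + 1 : ℕ)) (hr' : ¬ r.degree < (k : ℕ)) :
    ∃ c : K, (p - C c * r).degree < (k : ℕ) := by
  rw [degree_lt_iff_coeff_zero] at *
  push Not at hr'
  obtain ⟨m, hm, hm'⟩ := hr'
  obtain rfl : m = k := by
    by_contra h
    exact hm' (hr m (by omega))
  refine ⟨p.coeff m / r.coeff m, (degree_lt_iff_coeff_zero _ _).mpr fun j hj => ?_⟩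
  rw [coeff_sub, coeff_C_mul]
  rcases hj.eq_or_lt with rfl | hj
  · field_simp; ring
  · rw [hp j hj, hr j hj]; simp

/-- Cancel the leading term: the parity of the pole order of b decides whether it sits in the part
free of y or in the coefficient of y. This makes the residue field at infinity equal to K. -/
lemma exists_inftyValuation_sub_lt {a b : E.CoordinateRing} (hb : b ≠ 0)
    (hab : inftyValuation E (algebraMap _ _ a) ≤ inftyValuation E (algebraMap _ _ b)) :
    ∃ c : K, inftyValuation E (algebraMap _ _ (a - algebraMap K _ c * b)) <
      inftyValuation E (algebraMap _ _ b) := by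
  obtain ⟨p, q, rfl⟩ := exists_add_mul_yA a
  obtain ⟨r, s, rfl⟩ := exists_add_mul_yA b
  set N := poleOrder (algebraMap _ E.CoordinateRing r + algebraMap _ _ s * yA E) with hN
  have hlt : ∀ {x : ℤᵐ⁰}, x ≤ WithZero.exp (N : ℤ) → x < WithZero.exp ((N + 1 : ℕ) : ℤ) := fun h =>
    h.trans_lt (WithZero.exp_lt_exp.mpr (by omega))
  have hbN := inftyValuation_algebraMap hb
  rw [← hN] at hbN
  rw [hbN] at hab ⊢
  have h1 := (inftyValuation_lt_exp_iff p q (N + 1)).mp (hlt hab)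
  have h2 := (inftyValuation_lt_exp_iff r s (N + 1)).mp (hlt hbN.le)
  have h3 : ¬ (_ ∧ _) := (inftyValuation_lt_exp_iff r s N).not.mp hbN.ge.not_gt
  have key : ∀ c : K, algebraMap _ E.CoordinateRing p + algebraMap _ _ q * yA E -
      algebraMap K _ c * (algebraMap _ E.CoordinateRing r + algebraMap _ _ s * yA E) =
      algebraMap _ E.CoordinateRing (p - C c * r) + algebraMap _ _ (q - C c * s) * yA E := fun c => by
    simp only [map_sub, map_mul, algebraMap_CC]; ring
  have hdeg : ∀ (c : K) {p r : K[X]} {k : ℕ}, p.degree < k → r.degree < k → (p - C c * r).degree < k :=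
    fun c p r k hp hr => (degree_sub_le _ _).trans_lt
      (max_lt hp ((smul_eq_C_mul c (p := r)) ▸ (degree_smul_le c r).trans_lt hr))
  rcases N.even_or_odd' with ⟨k, hk | hk⟩
  · rw [show (N + 1 + 1) / 2 = k + 1 by omega, show (N + 1 - 2) / 2 = (N - 2) / 2 by omega] at h1 h2
    rw [show (N + 1) / 2 = k by omega] at h3
    obtain ⟨c, hc⟩ := exists_degree_sub_lt h1.1 h2.1 (fun h => h3 ⟨h, h2.2⟩)
    refine ⟨c, ?_⟩
    rw [key, inftyValuation_lt_exp_iff, show (N + 1) / 2 = k by omega]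
    exact ⟨hc, hdeg c h1.2 h2.2⟩
  -- Here N = 1, which no element attains: the degree conditions for pole order below 1 and below 2
  -- coincide.
  · by_cases hk0 : k = 0
    · exfalso
      rw [show (N + 1 + 1) / 2 = (N + 1) / 2 by omega, show (N + 1 - 2) / 2 = (N - 2) / 2 by omega] at h2
      exact h3 h2
    obtain ⟨j, rfl⟩ := Nat.exists_eq_succ_of_ne_zero hk0
    rw [show (N + 1 + 1) / 2 = (N + 1) / 2 by omega, show (N + 1 - 2) / 2 = j + 1 by omega] at h1 h2
    rw [show (N - 2) / 2 = j by omega] at h3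
    obtain ⟨c, hc⟩ := exists_degree_sub_lt h1.2 h2.2 (fun h => h3 ⟨h2.1, h⟩)
    refine ⟨c, ?_⟩
    rw [key, inftyValuation_lt_exp_iff, show (N - 2) / 2 = j by omega]
    exact ⟨hdeg c h1.1 h2.1, hc⟩

lemma degree_inftyPlace : (inftyPlace E).degree = 1 := by
  rw [Place.degree, finrank_eq_one_iff']
  refine ⟨1, one_ne_zero, fun w => ?_⟩
  obtain ⟨⟨f, hf⟩, rfl⟩ := IsLocalRing.residue_surjective w
  obtain ⟨a, b, hb, rfl⟩ := IsFractionRing.div_surjective (A := E.CoordinateRing) f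
  have hb0 := nonZeroDivisors.ne_zero hb
  have hpos : 0 < inftyValuation E (algebraMap _ _ b) := by
    rw [zero_lt_iff, Valuation.ne_zero_iff]; exact algebraMap_F_ne_zero hb0
  have hf' : inftyValuation E (algebraMap _ _ a / algebraMap _ _ b) ≤ 1 := hf
  rw [map_div₀, div_le_one₀ hpos] at hf'
  obtain ⟨c, hc⟩ := exists_inftyValuation_sub_lt hb0 hf'
  refine ⟨c, ?_⟩
  rw [Algebra.smul_def, mul_one]
  change IsLocalRing.residue _ (algebraMap K (inftyPlace E).ring c) = _
  rw [eq_comm, ← sub_eq_zero, ← map_sub, IsLocalRing.residue_eq_zero_iff,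
    mem_maximalIdeal_iff (v := inftyValuation E) rfl]
  change inftyValuation E (algebraMap _ _ a / algebraMap _ _ b - algebraMap K _ c) < 1
  rw [algebraMap_K_eq, div_sub' (algebraMap_F_ne_zero hb0), map_div₀, div_lt_one₀ hpos]
  convert hc using 2
  rw [map_sub, map_mul, mul_comm]

lemma finite_quotient {I : Ideal E.CoordinateRing} (hI : I ≠ ⊥) :
    Module.Finite K (E.CoordinateRing ⧸ I) :=
  Module.Finite.equiv (Ideal.quotientEquivDirectSum K (CoordinateRing.basis E) hI).symm

lemma finrank_quotient_span {a : E.CoordinateRing} (ha : a ≠ 0) :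
    Module.finrank K (E.CoordinateRing ⧸ Ideal.span {a}) = poleOrder a :=
  finrank_quotient_span_eq_natDegree_norm (CoordinateRing.basis E) ha

/-- Riemann-Roch as a dimension count. With d the colength of I, the elements of pole order at most
d + 1 form a space of dimension (d + 3)/2 + d/2 = d + 1 > d (integer division), so one of them is
nonzero and dies in the quotient by I. -/
lemma exists_mem_poleOrder_le {I : Ideal E.CoordinateRing} (hI : I ≠ ⊥) :
    ∃ a ∈ I, a ≠ 0 ∧ poleOrder a ≤ Module.finrank K (E.CoordinateRing ⧸ I) + 1 := by
  set d := Module.finrank K (E.CoordinateRing ⧸ I) with hd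
  have := finite_quotient hI
  let ψ : degreeLT K ((d + 3) / 2) × degreeLT K (d / 2) →ₗ[K] E.CoordinateRing :=
    ((Algebra.linearMap K[X] E.CoordinateRing).restrictScalars K ∘ₗ Submodule.subtype _).coprod
      ((LinearMap.mulRight K (yA E)) ∘ₗ (Algebra.linearMap K[X] E.CoordinateRing).restrictScalars K ∘ₗ
        Submodule.subtype _)
  have hψ : ∀ p q, ψ (p, q) = algebraMap K[X] _ (p : K[X]) + algebraMap K[X] _ (q : K[X]) * yA E :=
    fun _ _ => rfl
  have hfin : ∀ n, Module.Finite K (degreeLT K n) := fun n => Module.Finite.equiv (degreeLTEquiv K n).symm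
  have hlt : Module.finrank K (E.CoordinateRing ⧸ I) <
      Module.finrank K (degreeLT K ((d + 3) / 2) × degreeLT K (d / 2)) := by
    rw [Module.finrank_prod, (degreeLTEquiv K _).finrank_eq, (degreeLTEquiv K _).finrank_eq,
      Module.finrank_fin_fun, Module.finrank_fin_fun]
    omega
  have hbot := LinearMap.ker_ne_bot_of_finrank_lt
    (f := (Ideal.Quotient.mkₐ K I).toLinearMap ∘ₗ ψ) hlt
  obtain ⟨⟨p, q⟩, hmem, hne⟩ := Submodule.exists_mem_ne_zero_of_ne_bot hbot
  have hne' : ψ (p, q) ≠ 0 := fun h => hne (by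
    obtain ⟨h1, h2⟩ := add_mul_yA_eq_zero ((hψ p q).symm.trans h)
    exact Prod.ext (Subtype.ext h1) (Subtype.ext h2))
  refine ⟨ψ (p, q), Ideal.Quotient.eq_zero_iff_mem.mp hmem, hne', ?_⟩
  have := (inftyValuation_lt_exp_iff (E := E) (p : K[X]) q (d + 2)).mpr
    ⟨mem_degreeLT.mp p.2, mem_degreeLT.mp q.2⟩
  rw [← hψ, inftyValuation_algebraMap hne', WithZero.exp_lt_exp] at this
  omega

variable [E.IsElliptic]

lemma degree_finitePlace (v : HeightOneSpectrum E.CoordinateRing) :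
    (finitePlace v).degree = Module.finrank K (E.CoordinateRing ⧸ v.asIdeal) := by
  let ρ : E.CoordinateRing →ₐ[K] IsLocalRing.ResidueField (finitePlace v).ring :=
    { (IsLocalRing.residue (finitePlace v).ring).comp
        ((algebraMap E.CoordinateRing E.FunctionField).codRestrict (finitePlace v).ring
          (fun a => v.valuation_le_one a)) with
      commutes' := fun c => by
        change IsLocalRing.residue _ _ = IsLocalRing.residue _ (algebraMap K (finitePlace v).ring c)
        congr 1 }
  have hρ : ∀ a, ρ a = IsLocalRing.residue (finitePlace v).ring ⟨algebraMap _ _ a, v.valuation_le_one a⟩ :=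
    fun _ => rfl
  have hmax := v.isMaximal
  have hsurj : Function.Surjective ρ := by
    intro w
    obtain ⟨⟨f, hf⟩, rfl⟩ := IsLocalRing.residue_surjective w
    obtain ⟨n, d, hnd⟩ := v.exists_primeCompl_mul_eq_of_integer f hf
    obtain ⟨e, i, hi, hei⟩ := hmax.exists_inv (x := d) d.2
    refine ⟨n * e, ?_⟩
    rw [hρ, eq_comm, ← sub_eq_zero, ← map_sub, IsLocalRing.residue_eq_zero_iff,
      mem_maximalIdeal_iff (v := v.valuation E.FunctionField) rfl]
    change v.valuation E.FunctionField (f - algebraMap _ _ (n * e)) < 1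
    rw [map_mul, ← hnd, show f - f * algebraMap _ _ (d : E.CoordinateRing) * algebraMap _ _ e =
      f * algebraMap E.CoordinateRing _ i by rw [eq_sub_of_add_eq' hei, map_sub, map_one, map_mul]; ring, map_mul]
    exact (mul_le_of_le_one_left' hf).trans_lt ((v.valuation_lt_one_iff_mem (K := E.FunctionField) i).mpr hi)
  have hker : RingHom.ker ρ = v.asIdeal := by
    ext a
    rw [RingHom.mem_ker, hρ, IsLocalRing.residue_eq_zero_iff,
      mem_maximalIdeal_iff (v := v.valuation E.FunctionField) rfl]
    exact v.valuation_lt_one_iff_mem (K := E.FunctionField) a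
  rw [Place.degree, ← (Ideal.quotientKerAlgEquivOfSurjective hsurj).toLinearEquiv.finrank_eq]
  exact (Ideal.quotientEquivAlgOfEq K hker).toLinearEquiv.finrank_eq

/-- In a Dedekind domain I = I J + (x) for some x. Multiplication by x then gives an exact sequence
0 → A/J → A/IJ → A/I → 0, injective on the left because ideals can be cancelled. -/
lemma finrank_quotient_mul {I J : Ideal E.CoordinateRing} (hI : I ≠ ⊥) (hJ : J ≠ ⊥) :
    Module.finrank K (E.CoordinateRing ⧸ I * J) =
      Module.finrank K (E.CoordinateRing ⧸ I) + Module.finrank K (E.CoordinateRing ⧸ J) := by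
  have hIJ : I * J ≠ ⊥ := mul_ne_zero hI hJ
  have := finite_quotient hIJ
  obtain ⟨x, hx⟩ := IsDedekindDomain.exists_sup_span_eq (Ideal.mul_le_left : I * J ≤ I) hIJ
  have hxI : x ∈ I := hx ▸ Ideal.mem_sup_right (Ideal.mem_span_singleton_self x)
  have hker : ∀ r, x * r ∈ I * J → r ∈ J := fun r hr => by
    have : Ideal.span {r} * I ≤ J * I := by
      rw [← hx, Ideal.mul_sup, sup_le_iff]
      refine ⟨by rw [hx]; exact Ideal.mul_le_right.trans (mul_comm I J).le, ?_⟩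
      rw [Ideal.span_singleton_mul_span_singleton, Ideal.span_singleton_le_iff_mem, hx, mul_comm r, mul_comm J]
      exact hr
    rw [← Ideal.span_singleton_le_iff_mem]
    exact Ideal.dvd_iff_le.mp ((mul_dvd_mul_iff_right hI).mp (Ideal.dvd_iff_le.mpr this))
  let g : (E.CoordinateRing ⧸ J) →ₗ[K] (E.CoordinateRing ⧸ I * J) :=
    (Submodule.mapQ J (I * J) (LinearMap.mulLeft E.CoordinateRing x)
      (fun r hr => Ideal.mul_mem_mul hxI hr)).restrictScalars K
  let π : (E.CoordinateRing ⧸ I * J) →ₗ[K] (E.CoordinateRing ⧸ I) :=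
    (Ideal.Quotient.factorₐ K (Ideal.mul_le_left : I * J ≤ I)).toLinearMap
  have hg : ∀ r, g (Ideal.Quotient.mk J r) = Ideal.Quotient.mk (I * J) (x * r) := fun _ => rfl
  have hπ : ∀ r, π (Ideal.Quotient.mk (I * J) r) = Ideal.Quotient.mk I r := fun _ => rfl
  have hginj : Function.Injective g := by
    rw [injective_iff_map_eq_zero]
    intro r hr
    obtain ⟨r, rfl⟩ := Ideal.Quotient.mk_surjective r
    rw [hg, Ideal.Quotient.eq_zero_iff_mem] at hr
    exact Ideal.Quotient.eq_zero_iff_mem.mpr (hker r hr)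
  have hπs : LinearMap.range π = ⊤ := LinearMap.range_eq_top.mpr fun r => by
    obtain ⟨r, rfl⟩ := Ideal.Quotient.mk_surjective r
    exact ⟨_, hπ r⟩
  have hrange : LinearMap.ker π = LinearMap.range g := by
    ext r
    obtain ⟨r, rfl⟩ := Ideal.Quotient.mk_surjective r
    rw [LinearMap.mem_ker, hπ, Ideal.Quotient.eq_zero_iff_mem]
    constructor
    · intro hr
      rw [← hx, Submodule.mem_sup] at hr
      obtain ⟨s, hs, t, ht, rfl⟩ := hr
      obtain ⟨t, rfl⟩ := Ideal.mem_span_singleton.mp ht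
      refine ⟨Ideal.Quotient.mk J t, ?_⟩
      rw [hg, map_add, Ideal.Quotient.eq_zero_iff_mem.mpr hs, zero_add]
    · rintro ⟨s, hs⟩
      obtain ⟨s, rfl⟩ := Ideal.Quotient.mk_surjective s
      rw [hg, eq_comm, Ideal.Quotient.eq] at hs
      have := I.add_mem (Ideal.mul_le_left hs) (I.mul_mem_right s hxI)
      rwa [sub_add_cancel] at this
  rw [← LinearMap.finrank_range_add_finrank_ker π, hrange, LinearMap.finrank_range_of_inj hginj, hπs,
    finrank_top]

end Degrees

end GenusOne

end

/-! ### Reduction of a divisor to n·∞ or (n - 1)·∞ + Q. -/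

noncomputable section

open Polynomial

open scoped nonZeroDivisors Polynomial.Bivariate WithZero

namespace GenusOne

open IsDedekindDomain WeierstrassCurve.Affine

section Reduction

/-- The effective ideal `∏ v ^ e v`. -/
def idealOf {R : Type*} [CommRing R] (e : HeightOneSpectrum R →₀ ℕ) : Ideal R :=
  e.prod fun v n => v.asIdeal ^ n

section Dedekind

variable {R : Type*} [CommRing R]

lemma idealOf_add (e f : HeightOneSpectrum R →₀ ℕ) : idealOf (e + f) = idealOf e * idealOf f :=
  Finsupp.prod_add_index' (fun _ => pow_zero _) (fun _ _ _ => pow_add _ _ _)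

lemma idealOf_single (v : HeightOneSpectrum R) (n : ℕ) :
    idealOf (Finsupp.single v n) = v.asIdeal ^ n :=
  Finsupp.prod_single_index (pow_zero _)

variable [IsDedekindDomain R]

lemma idealOf_ne_bot (e : HeightOneSpectrum R →₀ ℕ) : idealOf e ≠ ⊥ :=
  Finset.prod_ne_zero_iff.mpr fun v _ => pow_ne_zero _ v.ne_bot

lemma multiplicity_ideal_mul (v : HeightOneSpectrum R) {I J : Ideal R} (hI : I ≠ ⊥) (hJ : J ≠ ⊥) :
    multiplicity v.asIdeal (I * J) = multiplicity v.asIdeal I + multiplicity v.asIdeal J :=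
  multiplicity_mul v.prime (FiniteMultiplicity.of_prime_left v.prime (mul_ne_zero hI hJ))

lemma multiplicity_idealOf (v : HeightOneSpectrum R) (e : HeightOneSpectrum R →₀ ℕ) :
    multiplicity v.asIdeal (idealOf e) = e v := by
  classical
  induction e using Finsupp.induction_linear with
  | zero => exact multiplicity_eq_zero.mpr (fun h => v.prime.not_isUnit (isUnit_of_dvd_one h))
  | add e f he hf =>
    rw [idealOf_add, multiplicity_ideal_mul v (idealOf_ne_bot e) (idealOf_ne_bot f), he, hf,
      Finsupp.add_apply]
  | single w n =>
    rw [idealOf_single, Finsupp.single_apply]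
    split_ifs with h
    · rw [h, multiplicity_pow_self v.ne_bot v.prime.not_isUnit]
    · refine multiplicity_eq_zero.mpr fun hd => h ?_
      have := v.prime.dvd_of_dvd_pow hd
      rw [Ideal.dvd_iff_le] at this
      exact HeightOneSpectrum.ext (w.isMaximal.eq_of_le v.isPrime.ne_top this)

lemma valuation_algebraMap_eq {F : Type*} [Field F] [Algebra R F] [IsFractionRing R F]
    (v : HeightOneSpectrum R) {a : R} (ha : a ≠ 0) :
    v.valuation F (algebraMap R F a) =
      WithZero.exp (-(multiplicity v.asIdeal (Ideal.span {a}) : ℤ)) := by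
  rw [HeightOneSpectrum.valuation_of_algebraMap, HeightOneSpectrum.intValuation_eq_exp_neg_multiplicity _ ha]

end Dedekind

variable {K : Type*} [Field K] {E : WeierstrassCurve.Affine K} [E.IsElliptic]

lemma finrank_quotient_idealOf (e : HeightOneSpectrum E.CoordinateRing →₀ ℕ) :
    (Module.finrank K (E.CoordinateRing ⧸ idealOf e) : ℤ) =
      e.sum fun v n => n * ((finitePlace v).degree : ℤ) := by
  classical
  induction e using Finsupp.induction_linear with
  | zero =>
    rw [Finsupp.sum_zero_index, Nat.cast_eq_zero]
    have : Subsingleton (E.CoordinateRing ⧸ idealOf (0 : HeightOneSpectrum E.CoordinateRing →₀ ℕ)) :=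
      Ideal.Quotient.subsingleton_iff.mpr Ideal.one_eq_top
    exact Module.finrank_zero_of_subsingleton
  | add e f he hf =>
    rw [idealOf_add, finrank_quotient_mul (idealOf_ne_bot e) (idealOf_ne_bot f), Nat.cast_add, he, hf,
      Finsupp.sum_add_index' (by simp) (by intros; push_cast; ring)]
  | single v n =>
    rw [idealOf_single, Finsupp.sum_single_index (by simp), degree_finitePlace]
    induction n with
    | zero =>
      rw [pow_zero, Nat.cast_zero, zero_mul, Nat.cast_eq_zero]
      have : Subsingleton (E.CoordinateRing ⧸ (1 : Ideal E.CoordinateRing)) :=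
        Ideal.Quotient.subsingleton_iff.mpr Ideal.one_eq_top
      exact Module.finrank_zero_of_subsingleton
    | succ n ih =>
      rw [pow_succ, finrank_quotient_mul (pow_ne_zero _ v.ne_bot) v.ne_bot]
      push_cast
      rw [ih]; ring

/-- The part of a divisor away from infinity. -/
def Divisor.finitePart (D : Divisor K E.FunctionField) : HeightOneSpectrum E.CoordinateRing →₀ ℤ :=
  D.comapDomain finitePlace finitePlace_injective.injOn

lemma Divisor.degree_eq (D : Divisor K E.FunctionField) :
    D.degree = D (inftyPlace E) + D.finitePart.sum fun v n => n * ((finitePlace v).degree : ℤ) := by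
  classical
  have h : D = Finsupp.single (inftyPlace E) (D (inftyPlace E)) +
      D.finitePart.mapDomain finitePlace := by
    ext p
    rw [Finsupp.add_apply]
    rcases eq_inftyPlace_or_eq_finitePlace p with rfl | ⟨v, rfl⟩
    · rw [Finsupp.single_eq_same, Finsupp.mapDomain_of_notMem_range, add_zero]
      rintro ⟨v, hv⟩
      exact finitePlace_ne_inftyPlace v hv
    · rw [Finsupp.mapDomain_apply finitePlace_injective, Finsupp.single_eq_of_ne
        (finitePlace_ne_inftyPlace v), zero_add]
      rfl
  conv_lhs => rw [h]
  rw [Divisor.degree, Finsupp.sum_add_index' (by simp) (by intros; ring),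
    Finsupp.sum_single_index (by simp), Finsupp.sum_mapDomain_index (by simp) (by intros; ring),
    degree_inftyPlace]
  simp

/-- Every divisor is linearly equivalent to an effective divisor of degree at most one away from
infinity, plus a multiple of the point at infinity. -/
theorem exists_reduction (D : Divisor K E.FunctionField) :
    ∃ (g : E.FunctionField) (J : Ideal E.CoordinateRing), g ≠ 0 ∧ J ≠ ⊥ ∧
      Module.finrank K (E.CoordinateRing ⧸ J) ≤ 1 ∧
      (∀ v : HeightOneSpectrum E.CoordinateRing, v.valuation E.FunctionField g =
        WithZero.exp (D (finitePlace v) - multiplicity v.asIdeal J)) ∧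
      inftyValuation E g = WithZero.exp
        (D (inftyPlace E) - (D.degree - Module.finrank K (E.CoordinateRing ⧸ J))) := by
  -- The finite part of D is split into its positive part P and its negative part N.
  let P : HeightOneSpectrum E.CoordinateRing →₀ ℕ := D.finitePart.mapRange Int.toNat rfl
  let N : HeightOneSpectrum E.CoordinateRing →₀ ℕ := (-D.finitePart).mapRange Int.toNat rfl
  have hPN : ∀ v, D (finitePlace v) = P v - N v := fun v =>
    (Int.toNat_sub_toNat_neg (D (finitePlace v))).symm
  clear_value P N
  have hP0 := idealOf_ne_bot P
  have hN0 := idealOf_ne_bot N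
  -- Division by c allows the poles P but also introduces those of the cofactor I', which the
  -- numerator f has to cancel.
  obtain ⟨c, hcP, hc0⟩ := Submodule.exists_mem_ne_zero_of_ne_bot hP0
  obtain ⟨I', hI'⟩ : idealOf P ∣ Ideal.span {c} :=
    Ideal.dvd_iff_le.mpr ((Ideal.span_singleton_le_iff_mem _).mpr hcP)
  have hspan : ∀ {a : E.CoordinateRing}, a ≠ 0 → Ideal.span {a} ≠ ⊥ := fun ha =>
    mt Ideal.span_singleton_eq_bot.mp ha
  have hI'0 : I' ≠ ⊥ := by
    rintro rfl
    rw [Ideal.mul_bot] at hI'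
    exact hspan hc0 hI'
  -- The pole order of f is the colength of (f) = I' N J and exceeds that of I' N by at most one; so
  -- J has colength at most one. The function sought is f/c.
  obtain ⟨f, hf, hf0, hfle⟩ := exists_mem_poleOrder_le (mul_ne_zero hI'0 hN0)
  obtain ⟨J, hJ⟩ : I' * idealOf N ∣ Ideal.span {f} :=
    Ideal.dvd_iff_le.mpr ((Ideal.span_singleton_le_iff_mem _).mpr hf)
  have hJ0 : J ≠ ⊥ := by
    rintro rfl
    rw [Ideal.mul_bot] at hJ
    exact hspan hf0 hJ
  have hdegc := finrank_quotient_span hc0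
  have hdegf := finrank_quotient_span hf0
  rw [hI', finrank_quotient_mul hP0 hI'0] at hdegc
  rw [hJ, finrank_quotient_mul (mul_ne_zero hI'0 hN0) hJ0] at hdegf
  refine ⟨algebraMap _ _ f / algebraMap _ _ c, J,
    div_ne_zero (algebraMap_F_ne_zero hf0) (algebraMap_F_ne_zero hc0), hJ0, ?_, fun v => ?_, ?_⟩
  · omega
  · rw [map_div₀, valuation_algebraMap_eq v hf0, valuation_algebraMap_eq v hc0, ← WithZero.exp_sub,
      hJ, hI', multiplicity_ideal_mul v (mul_ne_zero hI'0 hN0) hJ0, multiplicity_ideal_mul v hI'0 hN0,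
      multiplicity_ideal_mul v hP0 hI'0, multiplicity_idealOf, multiplicity_idealOf, hPN]
    congr 1
    push_cast
    ring
  · rw [map_div₀, inftyValuation_algebraMap hf0, inftyValuation_algebraMap hc0, ← WithZero.exp_sub,
      ← hdegc, ← hdegf, finrank_quotient_mul hI'0 hN0, D.degree_eq]
    have hsum : (D.finitePart.sum fun v n => n * ((finitePlace v).degree : ℤ)) =
        Module.finrank K (E.CoordinateRing ⧸ idealOf P) - Module.finrank K (E.CoordinateRing ⧸ idealOf N) := by
      have h : D.finitePart = P.mapRange (Nat.cast : ℕ → ℤ) rfl - N.mapRange (Nat.cast : ℕ → ℤ) rfl := by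
        ext v; exact hPN v
      rw [h, Finsupp.sum_sub_index (by intros; ring), Finsupp.sum_mapRange_index (by simp),
        Finsupp.sum_mapRange_index (by simp), finrank_quotient_idealOf, finrank_quotient_idealOf]
    rw [hsum]
    congr 1
    push_cast
    ring

/-- The Riemann-Roch spaces in terms of the equivalent divisor of `exists_reduction`. -/
lemma pow_mul_mem_riemannRoch_iff {D : Divisor K E.FunctionField} {g : E.FunctionField}
    {J : Ideal E.CoordinateRing} {r : ℤ}
    (hv : ∀ v : HeightOneSpectrum E.CoordinateRing, v.valuation E.FunctionField g =
      WithZero.exp (D (finitePlace v) - multiplicity v.asIdeal J))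
    (hi : inftyValuation E g = WithZero.exp (D (inftyPlace E) - r)) (m : ℕ) (k : E.FunctionField) :
    g ^ m * k ∈ riemannRoch (m • D) ↔
      (∀ v : HeightOneSpectrum E.CoordinateRing, v.valuation E.FunctionField k ≤
        WithZero.exp (m * multiplicity v.asIdeal J : ℤ)) ∧
      inftyValuation E k ≤ WithZero.exp (m * r) := by
  have key : ∀ (x : ℤᵐ⁰) (a b : ℤ), WithZero.exp (a - b) ^ m * x ≤ WithZero.exp (m * a) ↔
      x ≤ WithZero.exp (m * b) := fun x a b => by
    rw [← WithZero.exp_nsmul, nsmul_eq_mul, ← le_div_iff₀' WithZero.exp_pos, ← WithZero.exp_sub]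
    ring_nf
  rw [mem_riemannRoch_iff]
  simp only [map_mul, map_pow, hv, hi, Finsupp.smul_apply, nsmul_eq_mul, key]

end Reduction

end GenusOne

end

/-! ### Homogeneous ideals determined by normal forms. -/

noncomputable section

open MvPolynomial

open scoped WithZero

namespace GenusOne

section NormalForm

variable {K F σ : Type*} [Field K] [Field F] [Algebra K F] (w : σ → ℕ) (f : σ → F) (z : σ)
  (I : Ideal (MvPolynomial σ K))

variable (K) in
/-- The forms of degree `d - 1`. -/
def predForms : ℕ → Submodule K (MvPolynomial σ K)
  | 0 => ⊥
  | d + 1 => weightedHomogeneousSubmodule K w d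

lemma mul_mem_predForms {d e : ℕ} {r p : MvPolynomial σ K} (hr : IsWeightedHomogeneous w r e)
    (hp : p ∈ predForms K w d) : r * p ∈ predForms K w (d + e) := by
  cases d with
  | zero =>
    rw [(Submodule.mem_bot K).mp hp, mul_zero]
    exact Submodule.zero_mem _
  | succ d =>
    rw [show d + 1 + e = (d + e) + 1 by ring]
    change IsWeightedHomogeneous w (r * p) (d + e)
    rw [add_comm d e]
    exact hr.mul hp

/-- The forms of degree `d` that are congruent to a multiple of the variable `z` modulo `I`. -/
def zForms (d : ℕ) : Submodule K (MvPolynomial σ K) :=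
  (predForms K w d).map (LinearMap.mulLeft K (X z)) ⊔ I.restrictScalars K

variable {w f z I}

lemma mem_zForms_of_mem {d : ℕ} {p : MvPolynomial σ K} (hp : p ∈ I) : p ∈ zForms w z I d :=
  Submodule.mem_sup_right hp

lemma X_mul_mem_zForms {d : ℕ} {p : MvPolynomial σ K} (hp : IsWeightedHomogeneous w p d) :
    X z * p ∈ zForms w z I (d + 1) :=
  Submodule.mem_sup_left ⟨p, hp, rfl⟩

lemma mul_mem_zForms {d e : ℕ} {r p : MvPolynomial σ K} (hr : IsWeightedHomogeneous w r e)
    (hp : p ∈ zForms w z I d) : r * p ∈ zForms w z I (d + e) := by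
  obtain ⟨_, ⟨q, hq, rfl⟩, s, hs, rfl⟩ := Submodule.mem_sup.mp hp
  rw [mul_add]
  refine Submodule.add_mem_sup ⟨r * q, mul_mem_predForms w hr hq, ?_⟩ (I.mul_mem_left r hs)
  simp only [LinearMap.mulLeft_apply]
  ring

/-- A monomial is built one variable at a time. Multiplication by z lands in the multiples of z, and
`hstep` rewrites multiplication of a normal form by any other variable. -/
theorem mem_sup_zForms (hz : w z = 1) {N : ℕ → Submodule K (MvPolynomial σ K)} (h1 : 1 ∈ N 0)
    (hstep : ∀ i, i ≠ z → ∀ d, ∀ n ∈ N d, X i * n ∈ N (d + w i) ⊔ zForms w z I (d + w i))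
    {d : ℕ} {G : MvPolynomial σ K} (hG : IsWeightedHomogeneous w G d) :
    G ∈ N d ⊔ zForms w z I d := by
  classical
  have hX : ∀ i d, ∀ p, IsWeightedHomogeneous w p d → p ∈ N d ⊔ zForms w z I d →
      X i * p ∈ N (d + w i) ⊔ zForms w z I (d + w i) := by
    intro i d p hph hp
    by_cases hi : i = z
    · subst hi
      rw [hz]
      exact Submodule.mem_sup_right (X_mul_mem_zForms hph)
    obtain ⟨n, hn, q, hq, rfl⟩ := Submodule.mem_sup.mp hp
    rw [mul_add]
    exact Submodule.add_mem _ (hstep i hi d n hn)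
      (Submodule.mem_sup_right (mul_mem_zForms (isWeightedHomogeneous_X K w i) hq))
  have hmon : ∀ s : σ →₀ ℕ, monomial s (1 : K) ∈
      N (Finsupp.weight w s) ⊔ zForms w z I (Finsupp.weight w s) := by
    intro s
    induction s using Finsupp.induction with
    | zero => rw [map_zero]; exact Submodule.mem_sup_left h1
    | single_add i k s _ _ ih =>
      clear * - ih hX
      induction k with
      | zero => simpa using ih
      | succ k ihk =>
        have h := hX i _ _ (isWeightedHomogeneous_monomial w _ 1 rfl) ihk
        rw [X, monomial_mul, one_mul] at h
        have e1 : Finsupp.single i 1 + (Finsupp.single i k + s) = Finsupp.single i (k + 1) + s := by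
          rw [← add_assoc, ← Finsupp.single_add, add_comm 1 k]
        have e2 : Finsupp.weight w (Finsupp.single i (k + 1) + s) =
            Finsupp.weight w (Finsupp.single i k + s) + w i := by
          rw [← e1, map_add, Finsupp.weight_single, one_smul, add_comm]
        rwa [e1, ← e2] at h
  rw [G.as_sum]
  refine Submodule.sum_mem _ fun s hs => ?_
  have hs' : Finsupp.weight w s = d := hG (mem_support_iff.mp hs)
  rw [← mul_one (coeff s G), ← smul_eq_mul, ← smul_monomial, ← hs']
  exact Submodule.smul_mem _ _ (hmon s)

/-- If the forms of degree `d` are spanned, modulo `I` and the multiples of `z`, by elements `N d`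
that are linearly independent modulo the values of forms of degree `d - 1`, then `I` contains all
the forms that vanish at `f`. -/
theorem imageDefinedBy_of_normalForm (hz : w z = 1) (hfz : f z = 1)
    (hI : ∀ G ∈ I, aeval f G = 0) {N : ℕ → Submodule K (MvPolynomial σ K)} (h1 : 1 ∈ N 0)
    (hstep : ∀ i, i ≠ z → ∀ d, ∀ n ∈ N d, X i * n ∈ N (d + w i) ⊔ zForms w z I (d + w i))
    (hind : ∀ d, ∀ n ∈ N d, ∀ H ∈ predForms K w d, aeval f n + aeval f H = 0 → n = 0) :
    ImageDefinedBy w f I := by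
  intro d
  induction d with
  | zero =>
    refine fun G hG => ⟨fun h => ?_, hI G⟩
    obtain ⟨n, hn, q, hq, rfl⟩ := Submodule.mem_sup.mp (mem_sup_zForms hz h1 hstep hG)
    obtain ⟨_, ⟨H, hH, rfl⟩, s, hs, rfl⟩ := Submodule.mem_sup.mp hq
    have hH0 : H = 0 := (Submodule.mem_bot K).mp hH
    subst hH0
    have hs' : s ∈ I := hs
    have := hind 0 n hn 0 (Submodule.zero_mem _) (by
      simpa [hI s hs'] using h)
    rw [this]
    simpa using hs'
  | succ d ih =>
    refine fun G hG => ⟨fun h => ?_, hI G⟩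
    obtain ⟨n, hn, q, hq, rfl⟩ := Submodule.mem_sup.mp (mem_sup_zForms hz h1 hstep hG)
    obtain ⟨_, ⟨H, hH, rfl⟩, s, hs, rfl⟩ := Submodule.mem_sup.mp hq
    have hs' : s ∈ I := hs
    have h' : aeval f n + aeval f H = 0 := by
      simpa [hI s hs', hfz] using h
    -- Since z takes the value 1, G = n + z H + s takes the value n + H. Independence kills n, so H,
    -- of degree one less, vanishes at f and lies in I by induction.
    have hn0 := hind (d + 1) n hn H hH h'
    rw [hn0, map_zero, zero_add] at h'
    rw [hn0, zero_add]
    exact I.add_mem (I.mul_mem_left _ ((ih H hH).mp h')) hs'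

lemma valuation_aeval_le (v : Valuation F ℤᵐ⁰) [v.IsTrivialOn K] (m : ℤ)
    (hf : ∀ i, v (f i) ≤ WithZero.exp (m * w i)) {d : ℕ} {H : MvPolynomial σ K}
    (hH : IsWeightedHomogeneous w H d) : v (aeval f H) ≤ WithZero.exp (m * d) := by
  rw [H.as_sum, map_sum]
  refine Valuation.map_sum_le _ fun s hs => ?_
  rw [aeval_monomial, map_mul, Valuation.IsTrivialOn.eq_one (v := v) _ (mem_support_iff.mp hs),
    one_mul, ← hH (mem_support_iff.mp hs)]
  clear hs
  induction s using Finsupp.induction with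
  | zero => simp
  | single_add i k s hi hk ih =>
    rw [Finsupp.prod_add_index' (by simp) (by intros; rw [pow_add]), 
      Finsupp.prod_single_index (h := fun i k => f i ^ k) (pow_zero _),
      map_mul, map_pow, map_add, Finsupp.weight_single, smul_eq_mul]
    push_cast
    rw [mul_add, WithZero.exp_add]
    refine mul_le_mul' ?_ ih
    calc v (f i) ^ k ≤ WithZero.exp (m * w i) ^ k := pow_le_pow_left₀ zero_le (hf i) k
      _ = WithZero.exp (m * (k * w i)) := by
        rw [← WithZero.exp_nsmul, nsmul_eq_mul]; congr 1; ring

lemma valuation_predForms_le (v : Valuation F ℤᵐ⁰) [v.IsTrivialOn K] (m : ℤ)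
    (hf : ∀ i, v (f i) ≤ WithZero.exp (m * w i)) {d : ℕ} {H : MvPolynomial σ K}
    (hH : H ∈ predForms K w d) : v (aeval f H) ≤ WithZero.exp (m * (d - 1)) := by
  cases d with
  | zero =>
    rw [(Submodule.mem_bot K).mp hH, map_zero, map_zero]; exact zero_le
  | succ d =>
    push_cast
    rw [add_sub_cancel_right]
    exact valuation_aeval_le v m hf hH

lemma eq_zero_of_smul_add_eq_zero {v : Valuation F ℤᵐ⁰} [v.IsTrivialOn K] {a : K} {x r : F}
    (h : a • x + r = 0) (hr : v r < v x) : a = 0 := by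
  by_contra ha
  have : v (a • x) = v x := by
    rw [Algebra.smul_def, map_mul, Valuation.IsTrivialOn.eq_one (v := v) a ha, one_mul]
  rw [eq_neg_of_add_eq_zero_left h, Valuation.map_neg] at this
  exact hr.ne this

lemma valuation_smul_le (v : Valuation F ℤᵐ⁰) [v.IsTrivialOn K] (a : K) (x : F) :
    v (a • x) ≤ v x := by
  by_cases ha : a = 0
  · rw [ha, zero_smul, map_zero]; exact zero_le
  · rw [Algebra.smul_def, map_mul, Valuation.IsTrivialOn.eq_one (v := v) a ha, one_mul]

end NormalForm

end GenusOne

end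

/-! ### Families with one normal form in each degree. -/

noncomputable section

open MvPolynomial

open scoped WithZero

namespace GenusOne

section NormalForm

variable {K F σ : Type*} [Field K] [Field F] [Algebra K F] {w : σ → ℕ} {f : σ → F} {z : σ}
  {I : Ideal (MvPolynomial σ K)}

/-- The span of `g (d - k)` if `k ≤ d`, and the zero subspace otherwise. -/
def shiftSpan (k : ℕ) (g : ℕ → MvPolynomial σ K) (d : ℕ) : Submodule K (MvPolynomial σ K) :=
  Submodule.span K {p | ∃ e, e + k = d ∧ p = g e}

lemma mem_shiftSpan (k : ℕ) (g : ℕ → MvPolynomial σ K) (e : ℕ) {d : ℕ} (h : e + k = d) :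
    g e ∈ shiftSpan k g d :=
  Submodule.subset_span ⟨e, h, rfl⟩

lemma mul_mem_of_mem_shiftSpan {k : ℕ} {g : ℕ → MvPolynomial σ K} {d a : ℕ}
    {T : ℕ → Submodule K (MvPolynomial σ K)} {r n : MvPolynomial σ K} (hn : n ∈ shiftSpan k g d)
    (h : ∀ e, r * g e ∈ T (e + k + a)) : r * n ∈ T (d + a) := by
  induction hn using Submodule.span_induction with
  | mem p hp => obtain ⟨e, rfl, rfl⟩ := hp; exact h e
  | zero => rw [mul_zero]; exact Submodule.zero_mem _
  | add p q _ _ hp hq => rw [mul_add]; exact Submodule.add_mem _ hp hq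
  | smul c p _ hp => rw [mul_smul_comm]; exact Submodule.smul_mem _ c hp

lemma exists_of_mem_shiftSpan {k : ℕ} {g : ℕ → MvPolynomial σ K} {d : ℕ} {n : MvPolynomial σ K}
    (hn : n ∈ shiftSpan k g d) : n = 0 ∨ ∃ e, e + k = d ∧ ∃ a : K, n = a • g e := by
  by_cases hk : k ≤ d
  · right
    refine ⟨d - k, by omega, ?_⟩
    have : {p | ∃ e, e + k = d ∧ p = g e} = {g (d - k)} := by
      ext p
      constructor
      · rintro ⟨e, rfl, rfl⟩
        simp
      · rintro rfl
        exact ⟨d - k, by omega, rfl⟩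
    rw [shiftSpan, this] at hn
    obtain ⟨a, rfl⟩ := Submodule.mem_span_singleton.mp hn
    exact ⟨a, rfl⟩
  · left
    have : {p | ∃ e, e + k = d ∧ p = g e} = ∅ := by
      ext p
      simp only [Set.mem_ofPred_eq, Set.mem_empty_iff_false, iff_false]
      rintro ⟨e, h, -⟩
      omega
    rw [shiftSpan, this] at hn
    simpa using hn

/-- Such a family has at most one member in degree d. If its pole order A exceeds that of everything
else in a vanishing sum, its coefficient is zero. The bounds are required only for k ≤ d, as
otherwise the family is empty. -/
lemma eq_zero_of_mem_shiftSpan (v : Valuation F ℤᵐ⁰) [v.IsTrivialOn K] {k : ℕ}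
    {g : ℕ → MvPolynomial σ K} {d : ℕ} {n : MvPolynomial σ K} (hn : n ∈ shiftSpan k g d) {r : F}
    {A B : ℤ} (h : aeval f n + r = 0) (hg : ∀ e, e + k = d → v (aeval f (g e)) = WithZero.exp A)
    (hr : k ≤ d → v r ≤ WithZero.exp B) (hAB : k ≤ d → B < A) : n = 0 := by
  obtain rfl | ⟨e, he, a, rfl⟩ := exists_of_mem_shiftSpan hn
  · rfl
  · rw [map_smul] at h
    rw [eq_zero_of_smul_add_eq_zero (v := v) h, zero_smul]
    rw [hg e he]
    exact (hr (by omega)).trans_lt (WithZero.exp_lt_exp.mpr (hAB (by omega)))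

lemma valuation_le_of_mem_shiftSpan (v : Valuation F ℤᵐ⁰) [v.IsTrivialOn K] {k : ℕ}
    {g : ℕ → MvPolynomial σ K} {d : ℕ} {n : MvPolynomial σ K} (hn : n ∈ shiftSpan k g d)
    {A : ℤ} (hg : ∀ e, e + k = d → v (aeval f (g e)) ≤ WithZero.exp A) :
    v (aeval f n) ≤ WithZero.exp A := by
  obtain rfl | ⟨e, he, a, rfl⟩ := exists_of_mem_shiftSpan hn
  · rw [map_zero, map_zero]; exact zero_le
  · rw [map_smul]
    exact (valuation_smul_le v a _).trans (hg e he)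

lemma pow_mul_sub_mem_zForms {r s m : MvPolynomial σ K} {a d : ℕ}
    (hr : IsWeightedHomogeneous w r a) (hs : IsWeightedHomogeneous w s a)
    (h : r * m - s * m ∈ zForms w z I (d + a)) (e : ℕ) :
    r ^ e * m - s ^ e * m ∈ zForms w z I (d + e * a) := by
  induction e with
  | zero => simp
  | succ e ih =>
    have h1 := mul_mem_zForms (hr.pow e) h
    have h2 := mul_mem_zForms hs ih
    rw [smul_eq_mul] at h1
    rw [show d + (e + 1) * a = d + a + e * a by ring, show r ^ (e + 1) * m - s ^ (e + 1) * m =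
      r ^ e * (r * m - s * m) + s * (r ^ e * m - s ^ e * m) by ring]
    refine Submodule.add_mem _ h1 ?_
    rw [show d + a + e * a = d + e * a + a by ring]
    exact h2

lemma mem_sup_zForms_of_sub_mem {N : Submodule K (MvPolynomial σ K)} {d : ℕ}
    {p q : MvPolynomial σ K} (h : p - q ∈ zForms w z I d) (hq : q ∈ N ⊔ zForms w z I d) :
    p ∈ N ⊔ zForms w z I d := by
  rw [← sub_add_cancel p q]
  exact Submodule.add_mem _ (Submodule.mem_sup_right h) hq

lemma C_mul_mem {N : Submodule K (MvPolynomial σ K)} (c : K) {p : MvPolynomial σ K} (hp : p ∈ N) :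
    C c * p ∈ N := by
  rw [← smul_eq_C_mul]
  exact Submodule.smul_mem _ c hp

lemma sub_mem_zForms {d : ℕ} {p q r s : MvPolynomial σ K} (h : p - q = s + X z * r) (hs : s ∈ I)
    (hr : IsWeightedHomogeneous w r d) : p - q ∈ zForms w z I (d + 1) := by
  rw [h]
  exact Submodule.add_mem _ (mem_zForms_of_mem hs) (X_mul_mem_zForms hr)

lemma isWeightedHomogeneous_C_mul_X (c : K) (i : σ) :
    IsWeightedHomogeneous w (C c * X i) (w i) := by
  have := (isWeightedHomogeneous_C w c).mul (isWeightedHomogeneous_X K w i)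
  rwa [zero_add] at this

lemma isWeightedHomogeneous_C_mul_X_mul_X (c : K) (i j : σ) :
    IsWeightedHomogeneous w (C c * X i * X j) (w i + w j) :=
  (isWeightedHomogeneous_C_mul_X c i).mul (isWeightedHomogeneous_X K w j)

lemma isWeightedHomogeneous_C_mul_X_mul_X_mul_X (c : K) (i j k : σ) :
    IsWeightedHomogeneous w (C c * X i * X j * X k) (w i + w j + w k) :=
  (isWeightedHomogeneous_C_mul_X_mul_X c i j).mul (isWeightedHomogeneous_X K w k)

lemma valuation_pow_eq (v : Valuation F ℤᵐ⁰) {x : F} {m : ℤ} (h : v x = WithZero.exp m) (e : ℕ) :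
    v (x ^ e) = WithZero.exp (e * m) := by
  rw [map_pow, h, ← WithZero.exp_nsmul, nsmul_eq_mul]

lemma one_le_exp {m : ℤ} (h : 0 ≤ m) : (1 : ℤᵐ⁰) ≤ WithZero.exp m := by
  rw [← WithZero.exp_zero]
  exact WithZero.exp_le_exp.mpr h

lemma valuation_mul_eq (v : Valuation F ℤᵐ⁰) {x y : F} {m n : ℤ} (h : v x = WithZero.exp m)
    (h' : v y = WithZero.exp n) : v (x * y) = WithZero.exp (m + n) := by
  rw [map_mul, h, h', WithZero.exp_add]

lemma valuation_mul_le (v : Valuation F ℤᵐ⁰) {x y : F} {m n : ℤ} (h : v x ≤ WithZero.exp m)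
    (h' : v y ≤ WithZero.exp n) : v (x * y) ≤ WithZero.exp (m + n) := by
  rw [map_mul, WithZero.exp_add]
  exact mul_le_mul' h h'

lemma valuation_add_le (v : Valuation F ℤᵐ⁰) {x y : F} {m : ℤ} (h : v x ≤ WithZero.exp m)
    (h' : v y ≤ WithZero.exp m) : v (x + y) ≤ WithZero.exp m :=
  (v.map_add x y).trans (max_le h h')

end NormalForm

end GenusOne

end

/-! ### Degree two: the generalised binary quartic. -/

noncomputable section

open MvPolynomial

open scoped WithZero

namespace GenusOne

/-- The generalised binary quartic
`y² - (t x² + a₁ x z + h z²) y = u x³ z + (a₂ + t h) x² z² - g x z³ - q z⁴`. -/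
def modelTwo {R : Type*} [CommRing R] (t u h g q a₁ a₂ : R) : BinaryQuartic R :=
  ⟨-t, -a₁, -h, 0, u, a₂ + t * h, -g, -q⟩

section Models

variable {K F : Type*} [Field K] [Field F] [Algebra K F] {t u h g q a₁ a₂ : K} {μ y x : F}

/-- The equation satisfied by the functions `μ` and `y`. -/
def ModelRel (t u h g q a₁ a₂ : K) (μ y : F) : Prop :=
  y ^ 2 - (algebraMap K F t * μ ^ 2 + algebraMap K F a₁ * μ + algebraMap K F h) * y =
    algebraMap K F u * μ ^ 3 + algebraMap K F (a₂ + t * h) * μ ^ 2 - algebraMap K F g * μ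
      - algebraMap K F q

lemma modelTwo_aeval (hrel : ModelRel t u h g q a₁ a₂ μ y) :
    ∀ G ∈ Ideal.span {(modelTwo t u h g q a₁ a₂).equation}, aeval ![μ, 1, y] G = 0 := by
  intro G hG
  obtain ⟨r, rfl⟩ := Ideal.mem_span_singleton'.mp hG
  rw [map_mul]
  convert mul_zero _
  rw [ModelRel] at hrel
  simp only [BinaryQuartic.equation, modelTwo, map_sub, map_add, map_mul, map_pow, aeval_X,
    Matrix.cons_val, aeval_C, map_neg, map_zero] at hrel ⊢
  linear_combination hrel

/-- The normal forms for a generalised binary quartic. -/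
def normalTwo (K : Type*) [Field K] (d : ℕ) : Submodule K (MvPolynomial (Fin 3) K) :=
  shiftSpan 0 (fun e => X 0 ^ e) d ⊔ shiftSpan 2 (fun e => X 0 ^ e * X 2) d

/-- Modulo the equation and the variable z, only y² ≡ t x² y remains, so a second factor y can
always be traded for x². -/
lemma modelTwo_step : ∀ i : Fin 3, i ≠ 1 → ∀ d, ∀ n ∈ normalTwo K d, X i * n ∈
    normalTwo K (d + ![1, 1, 2] i) ⊔ zForms ![1, 1, 2] 1
      (Ideal.span {(modelTwo t u h g q a₁ a₂).equation}) (d + ![1, 1, 2] i) := by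
  set I := Ideal.span {(modelTwo t u h g q a₁ a₂).equation} with hIdef
  set w : Fin 3 → ℕ := ![1, 1, 2] with hw
  have hA : ∀ e d, e + 0 = d → (X 0 ^ e : MvPolynomial (Fin 3) K) ∈
      normalTwo K d ⊔ zForms w 1 I d := fun e d he =>
    Submodule.mem_sup_left (Submodule.mem_sup_left (mem_shiftSpan 0 (fun e => X 0 ^ e) e he))
  have hB : ∀ e d, e + 2 = d → (X 0 ^ e * X 2 : MvPolynomial (Fin 3) K) ∈
      normalTwo K d ⊔ zForms w 1 I d := fun e d he =>
    Submodule.mem_sup_left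
      (Submodule.mem_sup_right (mem_shiftSpan 2 (fun e => X 0 ^ e * X 2) e he))
  have hR : (X 2 ^ 2 : MvPolynomial (Fin 3) K) - C t * X 0 ^ 2 * X 2 ∈ zForms w 1 I (3 + 1) := by
    refine sub_mem_zForms (s := (modelTwo t u h g q a₁ a₂).equation)
      (r := C a₁ * X 0 * X 2 + C h * X 1 * X 2 + C u * X 0 * X 0 * X 0
        + C (a₂ + t * h) * X 0 * X 0 * X 1 + C (-g) * X 0 * X 1 * X 1
        + C (-q) * X 1 * X 1 * X 1) ?_ (Ideal.subset_span rfl) ?_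
    · simp only [BinaryQuartic.equation, modelTwo, map_neg, map_zero]
      ring
    · have h2 := fun c i j => isWeightedHomogeneous_C_mul_X_mul_X (w := w) (K := K) c i j
      have h3 := fun c i j k => isWeightedHomogeneous_C_mul_X_mul_X_mul_X (w := w) (K := K) c i j k
      exact (((((h2 _ 0 2).add (h2 _ 1 2)).add (h3 _ 0 0 0)).add (h3 _ 0 0 1)).add
        (h3 _ 0 1 1)).add (h3 _ 1 1 1)
  intro i hi d n hn
  obtain ⟨n₁, hn₁, n₂, hn₂, rfl⟩ := Submodule.mem_sup.mp hn
  rw [mul_add]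
  have key : ∀ {r : MvPolynomial (Fin 3) K} {a k : ℕ} {g} {n}, n ∈ shiftSpan k g d →
      (∀ e, r * g e ∈ normalTwo K (e + k + a) ⊔ zForms w 1 I (e + k + a)) →
      r * n ∈ normalTwo K (d + a) ⊔ zForms w 1 I (d + a) := fun hn h =>
    mul_mem_of_mem_shiftSpan (T := fun d => normalTwo K d ⊔ zForms w 1 I d) hn h
  have h02 : i = 0 ∨ i = 2 := by omega
  obtain rfl | rfl := h02
  · refine Submodule.add_mem _ (key hn₁ fun e => ?_) (key hn₂ fun e => ?_)
    · rw [← pow_succ']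
      exact hA _ _ rfl
    · rw [← mul_assoc, ← pow_succ']
      exact hB _ _ (by simp [hw]; try ring)
  · refine Submodule.add_mem _ (key hn₁ fun e => ?_) (key hn₂ fun e => ?_)
    · rw [mul_comm]
      exact hB _ _ rfl
    · have h1 := mul_mem_zForms ((isWeightedHomogeneous_X K w 0).pow e) hR
      rw [show e + 2 + w 2 = 3 + 1 + e • w 0 by simp [hw]; ring]
      refine mem_sup_zForms_of_sub_mem (q := C t * (X 0 ^ (e + 2) * X 2)) ?_
        (C_mul_mem t (hB _ _ (by simp [hw]; ring)))
      convert h1 using 1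
      ring

theorem modelTwo_imageDefinedBy (hrel : ModelRel t u h g q a₁ a₂ μ y)
    (hind : ∀ d, ∀ n ∈ normalTwo K d, ∀ H ∈ predForms K ![1, 1, 2] d,
      aeval ![μ, 1, y] n + aeval ![μ, 1, y] H = 0 → n = 0) :
    ImageDefinedBy ![1, 1, 2] ![μ, 1, y]
      (Ideal.span {(modelTwo t u h g q a₁ a₂).equation}) :=
  imageDefinedBy_of_normalForm (z := 1) (N := normalTwo K) rfl rfl (modelTwo_aeval hrel)
    (Submodule.mem_sup_left (mem_shiftSpan 0 (fun e => X 0 ^ e) 0 rfl)) modelTwo_step hind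

/-- At v the values of x^d and x^(d-2) y both have pole order d. They are separated at v', where x^d
has order d and everything else at most d - 1; once x^d is gone, v eliminates the other. -/
theorem normalTwo_independent (v v' : Valuation F ℤᵐ⁰) [v.IsTrivialOn K] [v'.IsTrivialOn K]
    (hvμ : v μ = WithZero.exp 1) (hvy : v y = WithZero.exp 2) (hμ : v' μ = WithZero.exp 1)
    (hy : v' y ≤ WithZero.exp 1) (d : ℕ) (n) (hn : n ∈ normalTwo K d) (H)
    (hH : H ∈ predForms K ![1, 1, 2] d)
    (h : aeval ![μ, 1, y] n + aeval ![μ, 1, y] H = 0) : n = 0 := by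
  have hHv := valuation_predForms_le v 1 (f := ![μ, 1, y]) (fun i => by
    fin_cases i <;> simp [hvμ, hvy, one_le_exp]) hH
  have hHv' := valuation_predForms_le v' 1 (f := ![μ, 1, y]) (fun i => by
    fin_cases i
    · simp [hμ]
    · simp [one_le_exp]
    · simpa using hy.trans (by simp)) hH
  obtain ⟨n₁, hn₁, n₂, hn₂, rfl⟩ := Submodule.mem_sup.mp hn
  rw [map_add, add_assoc] at h
  obtain rfl := eq_zero_of_mem_shiftSpan v' hn₁ (A := d) (B := d - 1) h (fun e he => by
      simp [hμ, ← WithZero.exp_nsmul, ← he])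
    (fun _ => valuation_add_le _ (valuation_le_of_mem_shiftSpan v' hn₂ fun e he => by
      have := valuation_mul_le v' (valuation_pow_eq v' hμ e).le hy
      simp only [map_mul, map_pow, aeval_X, Matrix.cons_val] at this ⊢
      refine this.trans (WithZero.exp_le_exp.mpr ?_)
      omega) (by simpa using hHv')) (fun _ => by omega)
  rw [map_zero, zero_add] at h
  obtain rfl := eq_zero_of_mem_shiftSpan v hn₂ (A := d) (B := d - 1) h (fun e he => by
      have := valuation_mul_eq v (valuation_pow_eq v hvμ e) hvy
      simp only [map_mul, map_pow, aeval_X, Matrix.cons_val] at this ⊢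
      rw [this]
      congr 1
      omega) (fun _ => by simpa using hHv) (fun _ => by omega)
  simp

/-- With the single pole ∞, the orders 2 d and 2 d - 1 are distinct and exceed the bound 2 (d - 1)
for forms of degree d - 1. -/
theorem normalTwo_independent' (v : Valuation F ℤᵐ⁰) [v.IsTrivialOn K]
    (hvμ : v μ = WithZero.exp 2) (hvy : v y = WithZero.exp 3) (d : ℕ) (n) (hn : n ∈ normalTwo K d)
    (H) (hH : H ∈ predForms K ![1, 1, 2] d)
    (h : aeval ![μ, 1, y] n + aeval ![μ, 1, y] H = 0) : n = 0 := by
  have hHv := valuation_predForms_le v 2 (f := ![μ, 1, y]) (fun i => by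
    fin_cases i <;> simp [hvμ, hvy, one_le_exp]) hH
  obtain ⟨n₁, hn₁, n₂, hn₂, rfl⟩ := Submodule.mem_sup.mp hn
  rw [map_add, add_assoc] at h
  have hg₂ : ∀ e, e + 2 = d → v (aeval ![μ, 1, y] (X 0 ^ e * X 2 : MvPolynomial (Fin 3) K)) =
      WithZero.exp (2 * d - 1 : ℤ) := fun e he => by
    have := valuation_mul_eq v (valuation_pow_eq v hvμ e) hvy
    simp only [map_mul, map_pow, aeval_X, Matrix.cons_val] at this ⊢
    rw [this]
    congr 1
    omega
  obtain rfl := eq_zero_of_mem_shiftSpan v hn₁ (A := 2 * d) (B := 2 * d - 1) h (fun e he => by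
      simp [hvμ, ← WithZero.exp_nsmul, ← he, mul_comm])
    (fun _ => valuation_add_le _
      (valuation_le_of_mem_shiftSpan v hn₂ fun e he => (hg₂ e he).le) (hHv.trans
        (WithZero.exp_le_exp.mpr (by omega)))) (fun _ => by omega)
  rw [map_zero, zero_add] at h
  obtain rfl := eq_zero_of_mem_shiftSpan v hn₂ (A := 2 * d - 1) (B := 2 * (d - 1)) h hg₂
    (fun _ => hHv) (fun _ => by omega)
  simp

end Models

end GenusOne

end

/-! ### Degree three: the ternary cubic. -/

noncomputable section

open MvPolynomial

open scoped WithZero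

namespace GenusOne

/-- The ternary cubic
`y² z - t x² y - a₁ x y z - h y z² - u x³ - (a₂ + t h) x² z + g x z² + q z³`. -/
def modelThree {R : Type*} [CommRing R] (t u h g q a₁ a₂ : R) : TernaryCubic R :=
  ⟨-u, 0, q, -t, -(a₂ + t * h), 0, 1, g, -h, -a₁⟩

section Models

variable {K F : Type*} [Field K] [Field F] [Algebra K F] {t u h g q a₁ a₂ : K} {μ y x : F}

lemma modelThree_aeval (hrel : ModelRel t u h g q a₁ a₂ μ y) :
    ∀ G ∈ Ideal.span {(modelThree t u h g q a₁ a₂).equation}, aeval ![μ, y, 1] G = 0 := by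
  intro G hG
  obtain ⟨r, rfl⟩ := Ideal.mem_span_singleton'.mp hG
  rw [map_mul]
  convert mul_zero _
  rw [ModelRel] at hrel
  simp only [TernaryCubic.equation, modelThree, map_add, map_mul, map_pow, aeval_X,
    Matrix.cons_val, aeval_C, map_neg, map_zero, map_one] at hrel ⊢
  linear_combination hrel

/-- The normal forms for a ternary cubic, depending on the choice of the last family. -/
def normalThree (g : ℕ → MvPolynomial (Fin 3) K) (d : ℕ) : Submodule K (MvPolynomial (Fin 3) K) :=
  shiftSpan 0 (fun e => X 1 ^ e) d ⊔
    (shiftSpan 1 (fun e => X 1 ^ e * X 0) d ⊔ shiftSpan 2 g d)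

/-- The last family is left open because the cubic meets the line z = 0 differently in the two
cases: there it is t x² y + u x³ = 0, which rewrites x² y when t ≠ 0 and kills x³ when t = 0, u = 1.
-/
lemma modelThree_step (G : ℕ → MvPolynomial (Fin 3) K)
    (hsq : ∀ e, (X 1 ^ e * X 0 ^ 2 : MvPolynomial (Fin 3) K) ∈ normalThree G (e + 2) ⊔
      zForms 1 2 (Ideal.span {(modelThree t u h g q a₁ a₂).equation}) (e + 2))
    (h0 : ∀ e, X 0 * G e ∈ normalThree G (e + 3) ⊔
      zForms 1 2 (Ideal.span {(modelThree t u h g q a₁ a₂).equation}) (e + 3))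
    (h1 : ∀ e, X 1 * G e ∈ normalThree G (e + 3) ⊔
      zForms 1 2 (Ideal.span {(modelThree t u h g q a₁ a₂).equation}) (e + 3)) :
    ∀ i : Fin 3, i ≠ 2 → ∀ d, ∀ n ∈ normalThree G d, X i * n ∈
    normalThree G (d + (1 : Fin 3 → ℕ) i) ⊔ zForms 1 2
      (Ideal.span {(modelThree t u h g q a₁ a₂).equation}) (d + (1 : Fin 3 → ℕ) i) := by
  set I := Ideal.span {(modelThree t u h g q a₁ a₂).equation} with hIdef
  have hA : ∀ e d, e + 0 = d → (X 1 ^ e : MvPolynomial (Fin 3) K) ∈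
      normalThree G d ⊔ zForms 1 2 I d := fun e d he =>
    Submodule.mem_sup_left (Submodule.mem_sup_left (mem_shiftSpan 0 (fun e => X 1 ^ e) e he))
  have hB : ∀ e d, e + 1 = d → (X 1 ^ e * X 0 : MvPolynomial (Fin 3) K) ∈
      normalThree G d ⊔ zForms 1 2 I d := fun e d he =>
    Submodule.mem_sup_left (Submodule.mem_sup_right (Submodule.mem_sup_left
      (mem_shiftSpan 1 (fun e => X 1 ^ e * X 0) e he)))
  intro i hi d n hn
  obtain ⟨n₁, hn₁, m, hm, rfl⟩ := Submodule.mem_sup.mp hn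
  obtain ⟨n₂, hn₂, n₃, hn₃, rfl⟩ := Submodule.mem_sup.mp hm
  rw [mul_add, mul_add]
  have key : ∀ {r : MvPolynomial (Fin 3) K} {a k : ℕ} {g} {n}, n ∈ shiftSpan k g d →
      (∀ e, r * g e ∈ normalThree G (e + k + a) ⊔ zForms 1 2 I (e + k + a)) →
      r * n ∈ normalThree G (d + a) ⊔ zForms 1 2 I (d + a) := fun hn h =>
    mul_mem_of_mem_shiftSpan (T := fun d => normalThree G d ⊔ zForms 1 2 I d) hn h
  have h02 : i = 0 ∨ i = 1 := by omega
  obtain rfl | rfl := h02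
  · refine Submodule.add_mem _ (key hn₁ fun e => ?_)
      (Submodule.add_mem _ (key hn₂ fun e => ?_) (key hn₃ fun e => h0 e))
    · rw [mul_comm]
      exact hB _ _ rfl
    · rw [show X 0 * (X 1 ^ e * X 0) = (X 1 ^ e * X 0 ^ 2 : MvPolynomial (Fin 3) K) by ring]
      exact hsq e
  · refine Submodule.add_mem _ (key hn₁ fun e => ?_)
      (Submodule.add_mem _ (key hn₂ fun e => ?_) (key hn₃ fun e => h1 e))
    · rw [← pow_succ']
      exact hA _ _ rfl
    · rw [← mul_assoc, ← pow_succ']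
      exact hB _ _ rfl

lemma modelThree_reduction (t u h g q a₁ a₂ : K) :
    (C t * (X 1 * X 0 ^ 2) : MvPolynomial (Fin 3) K) - C (-u) * X 0 ^ 3 ∈
      zForms 1 2 (Ideal.span {(modelThree t u h g q a₁ a₂).equation}) (2 + 1) := by
  refine sub_mem_zForms (s := -(modelThree t u h g q a₁ a₂).equation)
    (r := C 1 * X 1 * X 1 + C (-a₁) * X 0 * X 1 + C (-h) * X 1 * X 2
      + C (-(a₂ + t * h)) * X 0 * X 0 + C g * X 0 * X 2 + C q * X 2 * X 2) ?_
      (neg_mem (Ideal.subset_span rfl)) ?_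
  · simp only [TernaryCubic.equation, modelThree, map_neg, map_zero, map_one]
    ring
  · have h2 := fun c i j => isWeightedHomogeneous_C_mul_X_mul_X (w := (1 : Fin 3 → ℕ)) (K := K) c i j
    exact (((((h2 _ 1 1).add (h2 _ 0 1)).add (h2 _ 1 2)).add (h2 _ 0 0)).add
      (h2 _ 0 2)).add (h2 _ 2 2)

/-- As t is invertible in K, x² y ≡ -(u/t) x³, and every form divisible by x² collapses to a
multiple of a power of x. -/
theorem modelThree_imageDefinedBy (ht : t ≠ 0) (hrel : ModelRel t u h g q a₁ a₂ μ y)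
    (hind : ∀ d, ∀ n ∈ normalThree (K := K) (fun e => X 0 ^ (e + 2)) d, ∀ H ∈ predForms K 1 d,
      aeval ![μ, y, 1] n + aeval ![μ, y, 1] H = 0 → n = 0) :
    ImageDefinedBy 1 ![μ, y, 1] (Ideal.span {(modelThree t u h g q a₁ a₂).equation}) := by
  refine imageDefinedBy_of_normalForm (z := 2) (N := normalThree (K := K) fun e => X 0 ^ (e + 2))
    rfl rfl (modelThree_aeval hrel)
    (Submodule.mem_sup_left (mem_shiftSpan 0 (fun e => X 1 ^ e) 0 rfl)) ?_ hind
  have hmem : ∀ e d, e + 2 = d → (X 0 ^ (e + 2) : MvPolynomial (Fin 3) K) ∈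
      normalThree (fun e => X 0 ^ (e + 2)) d := fun e d he =>
    Submodule.mem_sup_right (Submodule.mem_sup_right (mem_shiftSpan 2 (fun e => X 0 ^ (e + 2)) e he))
  have hred := C_mul_mem t⁻¹ (modelThree_reduction t u h g q a₁ a₂)
  have hC : (C t⁻¹ * C t : MvPolynomial (Fin 3) K) = 1 := by
    rw [← C_mul, inv_mul_cancel₀ ht, C_1]
  have hred' : (X 1 : MvPolynomial (Fin 3) K) * X 0 ^ 2 - C (t⁻¹ * -u) * X 0 * X 0 ^ 2 ∈
      zForms 1 2 (Ideal.span {(modelThree t u h g q a₁ a₂).equation}) (2 + 1) := by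
    convert hred using 1
    rw [C_mul]
    linear_combination (-X 1 * X 0 ^ 2) * hC
  refine modelThree_step _ (fun e => ?_) (fun e => ?_) (fun e => ?_)
  · have := pow_mul_sub_mem_zForms (r := X 1) (s := C (t⁻¹ * -u) * X 0) (m := X 0 ^ 2)
      (w := (1 : Fin 3 → ℕ)) (a := 1) (d := 2) (isWeightedHomogeneous_X K _ 1)
      (isWeightedHomogeneous_C_mul_X _ 0) hred' e
    rw [mul_one, add_comm 2 e] at this
    refine mem_sup_zForms_of_sub_mem this (Submodule.mem_sup_left ?_)
    rw [mul_pow, mul_assoc, ← pow_add, ← C_pow]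
    exact C_mul_mem _ (hmem _ _ rfl)
  · rw [← pow_succ']
    exact Submodule.mem_sup_left (hmem _ _ rfl)
  · have := mul_mem_zForms ((isWeightedHomogeneous_X K (1 : Fin 3 → ℕ) 0).pow e) hred'
    rw [smul_eq_mul, Pi.one_apply, mul_one, add_comm (2 + 1) e] at this
    refine mem_sup_zForms_of_sub_mem (q := C (t⁻¹ * -u) * X 0 ^ (e + 1 + 2)) ?_
      (Submodule.mem_sup_left (C_mul_mem _ (hmem _ _ rfl)))
    convert this using 1
    ring

/-- Here x³ ≡ 0, so the surviving monomials are y^d, y^(d-1) x and y^(d-2) x². -/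
theorem modelThree_imageDefinedBy' (hrel : ModelRel 0 1 h g q a₁ a₂ μ y)
    (hind : ∀ d, ∀ n ∈ normalThree (K := K) (fun e => X 1 ^ e * X 0 ^ 2) d, ∀ H ∈ predForms K 1 d,
      aeval ![μ, y, 1] n + aeval ![μ, y, 1] H = 0 → n = 0) :
    ImageDefinedBy 1 ![μ, y, 1] (Ideal.span {(modelThree 0 1 h g q a₁ a₂).equation}) := by
  refine imageDefinedBy_of_normalForm (z := 2)
    (N := normalThree (K := K) fun e => X 1 ^ e * X 0 ^ 2) rfl rfl (modelThree_aeval hrel)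
    (Submodule.mem_sup_left (mem_shiftSpan 0 (fun e => X 1 ^ e) 0 rfl)) ?_ hind
  have hmem : ∀ e d, e + 2 = d → (X 1 ^ e * X 0 ^ 2 : MvPolynomial (Fin 3) K) ∈
      normalThree (fun e => X 1 ^ e * X 0 ^ 2) d := fun e d he =>
    Submodule.mem_sup_right
      (Submodule.mem_sup_right (mem_shiftSpan 2 (fun e => X 1 ^ e * X 0 ^ 2) e he))
  have hred := modelThree_reduction 0 1 h g q a₁ a₂
  refine modelThree_step _ (fun e => Submodule.mem_sup_left (hmem _ _ rfl)) (fun e => ?_)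
    (fun e => ?_)
  · have := mul_mem_zForms ((isWeightedHomogeneous_X K (1 : Fin 3 → ℕ) 1).pow e) hred
    rw [smul_eq_mul, Pi.one_apply, mul_one, add_comm (2 + 1) e] at this
    refine Submodule.mem_sup_right ?_
    convert this using 1
    simp only [map_neg, map_zero, map_one]
    ring
  · rw [← mul_assoc, ← pow_succ']
    exact Submodule.mem_sup_left (hmem _ _ (by ring))

/-- At v the first two families have orders 2 d and 2 d - 1, above all the rest. The power x^d is
only visible at v', where it has order d against d - 1. -/
theorem normalThree_independent (v v' : Valuation F ℤᵐ⁰) [v.IsTrivialOn K] [v'.IsTrivialOn K]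
    (hvμ : v μ = WithZero.exp 1) (hvy : v y = WithZero.exp 2) (hμ : v' μ = WithZero.exp 1)
    (hy : v' y ≤ WithZero.exp 1) (d : ℕ) (n)
    (hn : n ∈ normalThree (K := K) (fun e => X 0 ^ (e + 2)) d) (H)
    (hH : H ∈ predForms K 1 d)
    (h : aeval ![μ, y, 1] n + aeval ![μ, y, 1] H = 0) : n = 0 := by
  have hHv := valuation_predForms_le v 2 (f := ![μ, y, 1]) (fun i => by
    fin_cases i <;> simp [hvμ, hvy, one_le_exp]) hH
  have hHv' := valuation_predForms_le v' 1 (f := ![μ, y, 1]) (fun i => by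
    fin_cases i
    · simp [hμ]
    · simpa using hy
    · simp [one_le_exp]) hH
  obtain ⟨n₁, hn₁, m, hm, rfl⟩ := Submodule.mem_sup.mp hn
  obtain ⟨n₂, hn₂, n₃, hn₃, rfl⟩ := Submodule.mem_sup.mp hm
  rw [map_add, map_add, add_assoc, add_assoc] at h
  have hg₁ : ∀ e, e + 0 = d → v (aeval ![μ, y, 1] (X 1 ^ e : MvPolynomial (Fin 3) K)) =
      WithZero.exp (2 * d : ℤ) := fun e he => by
    simp only [map_pow, aeval_X, Matrix.cons_val, valuation_pow_eq v hvy e]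
    congr 1
    omega
  have hg₂ : ∀ e, e + 1 = d → v (aeval ![μ, y, 1] (X 1 ^ e * X 0 : MvPolynomial (Fin 3) K)) =
      WithZero.exp (2 * d - 1 : ℤ) := fun e he => by
    simp only [map_mul (aeval _), map_pow (aeval _), aeval_X, Matrix.cons_val,
      valuation_mul_eq v (valuation_pow_eq v hvy e) hvμ]
    congr 1
    omega
  have hg₃ : ∀ e, e + 2 = d → v (aeval ![μ, y, 1] (X 0 ^ (e + 2) : MvPolynomial (Fin 3) K)) ≤
      WithZero.exp (2 * d - 2 : ℤ) := fun e he => by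
    simp only [map_pow (aeval _), aeval_X, Matrix.cons_val, valuation_pow_eq v hvμ (e + 2)]
    exact WithZero.exp_le_exp.mpr (by omega)
  have hr₃ : v (aeval ![μ, y, 1] n₃ + aeval ![μ, y, 1] H) ≤ WithZero.exp (2 * d - 2 : ℤ) :=
    valuation_add_le v (valuation_le_of_mem_shiftSpan v hn₃ hg₃)
      (hHv.trans (WithZero.exp_le_exp.mpr (by omega)))
  have hr₂ : v (aeval ![μ, y, 1] n₂ + (aeval ![μ, y, 1] n₃ + aeval ![μ, y, 1] H)) ≤
      WithZero.exp (2 * d - 1 : ℤ) :=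
    valuation_add_le v (valuation_le_of_mem_shiftSpan v hn₂ fun e he => (hg₂ e he).le)
      (hr₃.trans (WithZero.exp_le_exp.mpr (by omega)))
  obtain rfl := eq_zero_of_mem_shiftSpan v hn₁ h hg₁ (fun _ => hr₂) (fun _ => by omega)
  rw [map_zero, zero_add] at h
  obtain rfl := eq_zero_of_mem_shiftSpan v hn₂ h hg₂ (fun _ => hr₃) (fun _ => by omega)
  rw [map_zero, zero_add] at h
  obtain rfl := eq_zero_of_mem_shiftSpan v' hn₃ (A := d) (B := d - 1) h (fun e he => by
      simp only [map_pow (aeval _), aeval_X, Matrix.cons_val, valuation_pow_eq v' hμ (e + 2)]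
      congr 1
      omega) (fun _ => by simpa using hHv') (fun _ => by omega)
  simp

theorem normalThree_independent' (v : Valuation F ℤᵐ⁰) [v.IsTrivialOn K]
    (hvμ : v μ = WithZero.exp 2) (hvy : v y = WithZero.exp 3) (d : ℕ) (n)
    (hn : n ∈ normalThree (K := K) (fun e => X 1 ^ e * X 0 ^ 2) d) (H)
    (hH : H ∈ predForms K 1 d)
    (h : aeval ![μ, y, 1] n + aeval ![μ, y, 1] H = 0) : n = 0 := by
  have hHv := valuation_predForms_le v 3 (f := ![μ, y, 1]) (fun i => by
    fin_cases i <;> simp [hvμ, hvy, one_le_exp]) hH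
  obtain ⟨n₁, hn₁, m, hm, rfl⟩ := Submodule.mem_sup.mp hn
  obtain ⟨n₂, hn₂, n₃, hn₃, rfl⟩ := Submodule.mem_sup.mp hm
  rw [map_add, map_add, add_assoc, add_assoc] at h
  have hg₁ : ∀ e, e + 0 = d → v (aeval ![μ, y, 1] (X 1 ^ e : MvPolynomial (Fin 3) K)) =
      WithZero.exp (3 * d : ℤ) := fun e he => by
    simp only [map_pow (aeval _), aeval_X, Matrix.cons_val, valuation_pow_eq v hvy e]
    congr 1
    omega
  have hg₂ : ∀ e, e + 1 = d → v (aeval ![μ, y, 1] (X 1 ^ e * X 0 : MvPolynomial (Fin 3) K)) =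
      WithZero.exp (3 * d - 1 : ℤ) := fun e he => by
    simp only [map_mul (aeval _), map_pow (aeval _), aeval_X, Matrix.cons_val,
      valuation_mul_eq v (valuation_pow_eq v hvy e) hvμ]
    congr 1
    omega
  have hg₃ : ∀ e, e + 2 = d → v (aeval ![μ, y, 1] (X 1 ^ e * X 0 ^ 2 : MvPolynomial (Fin 3) K)) =
      WithZero.exp (3 * d - 2 : ℤ) := fun e he => by
    simp only [map_mul (aeval _), map_pow (aeval _), aeval_X, Matrix.cons_val,
      valuation_mul_eq v (valuation_pow_eq v hvy e) (valuation_pow_eq v hvμ 2)]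
    congr 1
    omega
  have hr₄ : v (aeval ![μ, y, 1] H) ≤ WithZero.exp (3 * d - 3 : ℤ) :=
    hHv.trans (WithZero.exp_le_exp.mpr (by omega))
  have hr₃ : v (aeval ![μ, y, 1] n₃ + aeval ![μ, y, 1] H) ≤ WithZero.exp (3 * d - 2 : ℤ) :=
    valuation_add_le v (valuation_le_of_mem_shiftSpan v hn₃ fun e he => (hg₃ e he).le)
      (hr₄.trans (WithZero.exp_le_exp.mpr (by omega)))
  have hr₂ : v (aeval ![μ, y, 1] n₂ + (aeval ![μ, y, 1] n₃ + aeval ![μ, y, 1] H)) ≤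
      WithZero.exp (3 * d - 1 : ℤ) :=
    valuation_add_le v (valuation_le_of_mem_shiftSpan v hn₂ fun e he => (hg₂ e he).le)
      (hr₃.trans (WithZero.exp_le_exp.mpr (by omega)))
  obtain rfl := eq_zero_of_mem_shiftSpan v hn₁ h hg₁ (fun _ => hr₂) (fun _ => by omega)
  rw [map_zero, zero_add] at h
  obtain rfl := eq_zero_of_mem_shiftSpan v hn₂ h hg₂ (fun _ => hr₃) (fun _ => by omega)
  rw [map_zero, zero_add] at h
  obtain rfl := eq_zero_of_mem_shiftSpan v hn₃ h hg₃ (fun _ => hr₄) (fun _ => by omega)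
  simp

end Models

end GenusOne

end

/-! ### Degree four: the quadric intersection. -/

noncomputable section

open MvPolynomial

open scoped WithZero

namespace GenusOne

/-- The quadric intersection in the variables `z, x, y, v` given by `t x y + u x² = v z` and
`y² - x v - a₁ x y - h y z - (a₂ + t h) x² + g x z + q z² = 0`. -/
def modelFour {R : Type*} [CommRing R] (t u h g q a₁ a₂ : R) : QuadricIntersection R :=
  ⟨⟨0, 0, 0, -1, u, t, 0, 0, 0, 0⟩, ⟨q, g, -h, 0, -(a₂ + t * h), -a₁, -1, 1, 0, 0⟩⟩

section Models

variable {K F : Type*} [Field K] [Field F] [Algebra K F] {t u h g q a₁ a₂ : K} {μ y v : F}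

/-- The ideal of a quadric intersection. -/
def idealFour (t u h g q a₁ a₂ : K) : Ideal (MvPolynomial (Fin 4) K) :=
  Ideal.span {(modelFour t u h g q a₁ a₂).Q₁.form, (modelFour t u h g q a₁ a₂).Q₂.form}

lemma modelFour_aeval (hrel : ModelRel t u h g q a₁ a₂ μ y)
    (hv : v = μ * (algebraMap K F t * y + algebraMap K F u * μ)) :
    ∀ G ∈ idealFour t u h g q a₁ a₂, aeval ![1, μ, y, v] G = 0 := by
  intro G hG
  obtain ⟨r, s, rfl⟩ := Ideal.mem_span_pair.mp hG
  rw [ModelRel] at hrel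
  rw [map_add, map_mul, map_mul]
  have h1 : aeval ![1, μ, y, v] (modelFour t u h g q a₁ a₂).Q₁.form = 0 := by
    simp only [Quadric.form, modelFour, map_add, map_mul, map_pow, aeval_X,
      Matrix.cons_val, aeval_C, map_neg, map_zero, map_one, hv]
    ring
  have h2 : aeval ![1, μ, y, v] (modelFour t u h g q a₁ a₂).Q₂.form = 0 := by
    simp only [Quadric.form, modelFour, map_add, map_mul, map_pow, aeval_X,
      Matrix.cons_val, aeval_C, map_neg, map_zero, map_one, hv] at hrel ⊢
    linear_combination hrel
  rw [h1, h2]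
  simp

/-- The normal forms for a quadric intersection, depending on the choice of the last family. -/
def normalFour (g : ℕ → MvPolynomial (Fin 4) K) (d : ℕ) : Submodule K (MvPolynomial (Fin 4) K) :=
  shiftSpan 0 (fun e => X 3 ^ e) d ⊔ (shiftSpan 1 (fun e => X 3 ^ e * X 2) d ⊔
    (shiftSpan 1 (fun e => X 3 ^ e * X 1) d ⊔ shiftSpan 2 g d))

lemma modelFour_reduction₁ (t u h g q a₁ a₂ : K) :
    (C t * (X 1 * X 2) : MvPolynomial (Fin 4) K) - C (-u) * X 1 ^ 2 ∈
      zForms 1 0 (idealFour t u h g q a₁ a₂) (1 + 1) := by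
  refine sub_mem_zForms (s := (modelFour t u h g q a₁ a₂).Q₁.form) (r := X 3) ?_
    (Ideal.subset_span (Set.mem_insert _ _)) (isWeightedHomogeneous_X K _ 3)
  simp only [Quadric.form, modelFour, map_neg, map_zero, map_one]
  ring

lemma modelFour_reduction₂ (t u h g q a₁ a₂ : K) :
    (X 2 ^ 2 : MvPolynomial (Fin 4) K) - (X 3 * X 1 + C a₁ * (X 1 * X 2)
      + C (a₂ + t * h) * X 1 ^ 2) ∈ zForms 1 0 (idealFour t u h g q a₁ a₂) (1 + 1) := by
  refine sub_mem_zForms (s := (modelFour t u h g q a₁ a₂).Q₂.form)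
    (r := C h * X 2 + C (-g) * X 1 + C (-q) * X 0) ?_
    (Ideal.subset_span (Set.mem_insert_of_mem _ rfl)) ?_
  · simp only [Quadric.form, modelFour, map_neg, map_zero, map_one]
    ring
  · have h1 := fun c i => isWeightedHomogeneous_C_mul_X (w := (1 : Fin 4 → ℕ)) (K := K) c i
    exact ((h1 _ 2).add (h1 _ 1)).add (h1 _ 0)

lemma modelFour_step (G : ℕ → MvPolynomial (Fin 4) K)
    (hsq : ∀ e, (X 3 ^ e * X 1 ^ 2 : MvPolynomial (Fin 4) K) ∈ normalFour G (e + 2) ⊔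
      zForms 1 0 (idealFour t u h g q a₁ a₂) (e + 2))
    (hxy : ∀ e, (X 3 ^ e * (X 1 * X 2) : MvPolynomial (Fin 4) K) ∈ normalFour G (e + 2) ⊔
      zForms 1 0 (idealFour t u h g q a₁ a₂) (e + 2))
    (hG : ∀ i, i ≠ 0 → ∀ e, X i * G e ∈ normalFour G (e + 3) ⊔
      zForms 1 0 (idealFour t u h g q a₁ a₂) (e + 3)) :
    ∀ i : Fin 4, i ≠ 0 → ∀ d, ∀ n ∈ normalFour G d, X i * n ∈
    normalFour G (d + (1 : Fin 4 → ℕ) i) ⊔ zForms 1 0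
      (idealFour t u h g q a₁ a₂) (d + (1 : Fin 4 → ℕ) i) := by
  set I := idealFour t u h g q a₁ a₂ with hIdef
  have hA : ∀ e d, e + 0 = d → (X 3 ^ e : MvPolynomial (Fin 4) K) ∈
      normalFour G d ⊔ zForms 1 0 I d := fun e d he =>
    Submodule.mem_sup_left (Submodule.mem_sup_left (mem_shiftSpan 0 (fun e => X 3 ^ e) e he))
  have hB : ∀ e d, e + 1 = d → (X 3 ^ e * X 2 : MvPolynomial (Fin 4) K) ∈
      normalFour G d ⊔ zForms 1 0 I d := fun e d he =>
    Submodule.mem_sup_left (Submodule.mem_sup_right (Submodule.mem_sup_left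
      (mem_shiftSpan 1 (fun e => X 3 ^ e * X 2) e he)))
  have hC : ∀ e d, e + 1 = d → (X 3 ^ e * X 1 : MvPolynomial (Fin 4) K) ∈
      normalFour G d ⊔ zForms 1 0 I d := fun e d he =>
    Submodule.mem_sup_left (Submodule.mem_sup_right (Submodule.mem_sup_right
      (Submodule.mem_sup_left (mem_shiftSpan 1 (fun e => X 3 ^ e * X 1) e he))))
  intro i hi d n hn
  obtain ⟨n₁, hn₁, m, hm, rfl⟩ := Submodule.mem_sup.mp hn
  obtain ⟨n₂, hn₂, m', hm', rfl⟩ := Submodule.mem_sup.mp hm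
  obtain ⟨n₃, hn₃, n₄, hn₄, rfl⟩ := Submodule.mem_sup.mp hm'
  rw [mul_add, mul_add, mul_add]
  have key : ∀ {r : MvPolynomial (Fin 4) K} {a k : ℕ} {g} {n}, n ∈ shiftSpan k g d →
      (∀ e, r * g e ∈ normalFour G (e + k + a) ⊔ zForms 1 0 I (e + k + a)) →
      r * n ∈ normalFour G (d + a) ⊔ zForms 1 0 I (d + a) := fun hn h =>
    mul_mem_of_mem_shiftSpan (T := fun d => normalFour G d ⊔ zForms 1 0 I d) hn h
  refine Submodule.add_mem _ (key hn₁ fun e => ?_) (Submodule.add_mem _ (key hn₂ fun e => ?_)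
    (Submodule.add_mem _ (key hn₃ fun e => ?_) (key hn₄ fun e => hG i hi e)))
  all_goals
    have h02 : i = 1 ∨ i = 2 ∨ i = 3 := by omega
    obtain rfl | rfl | rfl := h02
  · rw [mul_comm]
    exact hC _ _ rfl
  · rw [mul_comm]
    exact hB _ _ rfl
  · rw [← pow_succ']
    exact hA _ _ rfl
  · rw [show X 1 * (X 3 ^ e * X 2) = (X 3 ^ e * (X 1 * X 2) : MvPolynomial (Fin 4) K) by ring]
    exact hxy e
  · have h1 := mul_mem_zForms ((isWeightedHomogeneous_X K (1 : Fin 4 → ℕ) 3).pow e)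
      (modelFour_reduction₂ t u h g q a₁ a₂)
    rw [smul_eq_mul, Pi.one_apply, mul_one, add_comm (1 + 1) e] at h1
    refine mem_sup_zForms_of_sub_mem (q := X 3 ^ (e + 1) * X 1 + (C a₁ * (X 3 ^ e * (X 1 * X 2))
      + C (a₂ + t * h) * (X 3 ^ e * X 1 ^ 2))) ?_ (Submodule.add_mem _ (hC _ _ rfl)
        (Submodule.add_mem _ (C_mul_mem _ (hxy e)) (C_mul_mem _ (hsq e))))
    rw [show ∀ p q : MvPolynomial (Fin 4) K, X 2 * (X 3 ^ e * X 2) - (X 3 ^ (e + 1) * X 1 +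
      (p * (X 3 ^ e * (X 1 * X 2)) + q * (X 3 ^ e * X 1 ^ 2))) = X 3 ^ e * (X 2 ^ 2 -
      (X 3 * X 1 + p * (X 1 * X 2) + q * X 1 ^ 2)) by intros; ring]
    exact h1
  · rw [← mul_assoc, ← pow_succ']
    exact hB _ _ rfl
  · rw [show X 1 * (X 3 ^ e * X 1) = (X 3 ^ e * X 1 ^ 2 : MvPolynomial (Fin 4) K) by ring]
    exact hsq e
  · rw [show X 2 * (X 3 ^ e * X 1) = (X 3 ^ e * (X 1 * X 2) : MvPolynomial (Fin 4) K) by ring]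
    exact hxy e
  · rw [← mul_assoc, ← pow_succ']
    exact hC _ _ rfl

/-- Modulo z, the first quadric gives x y ≡ c x². Computing x y² through either quadric then gives v
x² ≡ c' x³, so only pure powers of x are needed in the last family. -/
theorem modelFour_imageDefinedBy (ht : t ≠ 0) (hrel : ModelRel t u h g q a₁ a₂ μ y)
    (hv : v = μ * (algebraMap K F t * y + algebraMap K F u * μ))
    (hind : ∀ d, ∀ n ∈ normalFour (K := K) (fun e => X 1 ^ (e + 2)) d, ∀ H ∈ predForms K 1 d,
      aeval ![1, μ, y, v] n + aeval ![1, μ, y, v] H = 0 → n = 0) :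
    ImageDefinedBy 1 ![1, μ, y, v] (idealFour t u h g q a₁ a₂) := by
  refine imageDefinedBy_of_normalForm (z := 0) (N := normalFour (K := K) fun e => X 1 ^ (e + 2))
    rfl rfl (modelFour_aeval hrel hv)
    (Submodule.mem_sup_left (mem_shiftSpan 0 (fun e => X 3 ^ e) 0 rfl)) ?_ hind
  set I := idealFour t u h g q a₁ a₂ with hIdef
  have hmem : ∀ e d, e + 2 = d → (X 1 ^ (e + 2) : MvPolynomial (Fin 4) K) ∈
      normalFour (fun e => X 1 ^ (e + 2)) d := fun e d he =>
    Submodule.mem_sup_right (Submodule.mem_sup_right (Submodule.mem_sup_right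
      (mem_shiftSpan 2 (fun e => X 1 ^ (e + 2)) e he)))
  have hC : (C t⁻¹ * C t : MvPolynomial (Fin 4) K) = 1 := by
    rw [← C_mul, inv_mul_cancel₀ ht, C_1]
  have hX := fun i => isWeightedHomogeneous_X K (1 : Fin 4 → ℕ) i
  obtain ⟨c, hc⟩ : ∃ c, (X 1 * X 2 : MvPolynomial (Fin 4) K) - C c * X 1 ^ 2 ∈
      zForms 1 0 I (1 + 1) := by
    refine ⟨t⁻¹ * -u, ?_⟩
    have hred := C_mul_mem t⁻¹ (modelFour_reduction₁ t u h g q a₁ a₂)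
    rw [mul_sub, ← mul_assoc, hC, one_mul, ← mul_assoc, ← C_mul] at hred
    exact hred
  obtain ⟨c', hc'⟩ : ∃ c, (X 3 * X 1 ^ 2 : MvPolynomial (Fin 4) K) - C c * X 1 * X 1 ^ 2 ∈
      zForms 1 0 I (2 + 1) := by
    -- From the first quadric x y² ≡ c² x³; from the second x y² ≡ v x² + a₁ c x³ + (a₂ + t h) x³.
    -- The constant is what equality of the two requires.
    refine ⟨c ^ 2 - a₁ * c - (a₂ + t * h), ?_⟩
    have e1 := mul_mem_zForms (hX 1) (modelFour_reduction₂ t u h g q a₁ a₂)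
    have e2 := mul_mem_zForms (hX 2) hc
    have e3 := C_mul_mem (c - a₁) (mul_mem_zForms (hX 1) hc)
    rw [Pi.one_apply] at e1 e2 e3
    rw [show (X 3 * X 1 ^ 2 - C (c ^ 2 - a₁ * c - (a₂ + t * h)) * X 1 * X 1 ^ 2 :
      MvPolynomial (Fin 4) K) = X 2 * (X 1 * X 2 - C c * X 1 ^ 2) - X 1 * (X 2 ^ 2 - (X 3 * X 1 +
      C a₁ * (X 1 * X 2) + C (a₂ + t * h) * X 1 ^ 2)) + C (c - a₁) * (X 1 * (X 1 * X 2 -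
      C c * X 1 ^ 2)) by simp only [map_sub, map_mul, map_pow]; ring]
    exact Submodule.add_mem _ (Submodule.sub_mem _ e2 e1) e3
  have hsq : ∀ e, (X 3 ^ e * X 1 ^ 2 : MvPolynomial (Fin 4) K) ∈
      normalFour (fun e => X 1 ^ (e + 2)) (e + 2) ⊔ zForms 1 0 I (e + 2) := by
    intro e
    have := pow_mul_sub_mem_zForms (r := X 3) (s := C c' * X 1) (m := X 1 ^ 2)
      (w := (1 : Fin 4 → ℕ)) (a := 1) (d := 2) (hX 3)
      (isWeightedHomogeneous_C_mul_X _ 1) hc' e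
    rw [mul_one, add_comm 2 e] at this
    refine mem_sup_zForms_of_sub_mem this (Submodule.mem_sup_left ?_)
    rw [mul_pow, mul_assoc, ← pow_add, ← C_pow]
    exact C_mul_mem _ (hmem _ _ rfl)
  refine modelFour_step _ hsq (fun e => ?_) (fun i hi e => ?_)
  · have := mul_mem_zForms ((hX 3).pow e) hc
    rw [smul_eq_mul, Pi.one_apply, mul_one, add_comm (1 + 1) e, one_add_one_eq_two, mul_sub,
      mul_left_comm _ (C c)] at this
    exact mem_sup_zForms_of_sub_mem this (C_mul_mem c (hsq e))
  · have h02 : i = 1 ∨ i = 2 ∨ i = 3 := by omega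
    obtain rfl | rfl | rfl := h02
    · rw [← pow_succ']
      exact Submodule.mem_sup_left (hmem _ _ rfl)
    · have := mul_mem_zForms ((hX 1).pow (e + 1)) hc
      rw [smul_eq_mul, Pi.one_apply, mul_one, add_comm (1 + 1) (e + 1)] at this
      refine mem_sup_zForms_of_sub_mem (q := C c * X 1 ^ (e + 1 + 2)) ?_
        (Submodule.mem_sup_left (C_mul_mem _ (hmem _ _ rfl)))
      rw [show ∀ p : MvPolynomial (Fin 4) K, X 2 * X 1 ^ (e + 2) - p * X 1 ^ (e + 1 + 2) =
        X 1 ^ (e + 1) * (X 1 * X 2 - p * X 1 ^ 2) by intros; ring]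
      exact this
    · have := mul_mem_zForms ((hX 1).pow e) hc'
      rw [smul_eq_mul, Pi.one_apply, mul_one, add_comm (2 + 1) e] at this
      refine mem_sup_zForms_of_sub_mem (q := C c' * X 1 ^ (e + 1 + 2)) ?_
        (Submodule.mem_sup_left (C_mul_mem _ (hmem _ _ rfl)))
      rw [show ∀ p : MvPolynomial (Fin 4) K, X 3 * X 1 ^ (e + 2) - p * X 1 ^ (e + 1 + 2) =
        X 1 ^ e * (X 3 * X 1 ^ 2 - p * X 1 * X 1 ^ 2) by intros; ring]
      exact this

/-- Modulo z the first quadric is x² ≡ 0. Multiplying the second by x gives x y² ≡ 0, so of the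
monomials divisible by x y only v^e x y survives. -/
theorem modelFour_imageDefinedBy' (hrel : ModelRel 0 1 h g q a₁ a₂ μ y)
    (hv : v = μ * (algebraMap K F 0 * y + algebraMap K F 1 * μ))
    (hind : ∀ d, ∀ n ∈ normalFour (K := K) (fun e => X 3 ^ e * (X 1 * X 2)) d,
      ∀ H ∈ predForms K 1 d, aeval ![1, μ, y, v] n + aeval ![1, μ, y, v] H = 0 → n = 0) :
    ImageDefinedBy 1 ![1, μ, y, v] (idealFour 0 1 h g q a₁ a₂) := by
  refine imageDefinedBy_of_normalForm (z := 0)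
    (N := normalFour (K := K) fun e => X 3 ^ e * (X 1 * X 2)) rfl rfl (modelFour_aeval hrel hv)
    (Submodule.mem_sup_left (mem_shiftSpan 0 (fun e => X 3 ^ e) 0 rfl)) ?_ hind
  set I := idealFour 0 1 h g q a₁ a₂ with hIdef
  have hmem : ∀ e d, e + 2 = d → (X 3 ^ e * (X 1 * X 2) : MvPolynomial (Fin 4) K) ∈
      normalFour (fun e => X 3 ^ e * (X 1 * X 2)) d := fun e d he =>
    Submodule.mem_sup_right (Submodule.mem_sup_right (Submodule.mem_sup_right
      (mem_shiftSpan 2 (fun e => X 3 ^ e * (X 1 * X 2)) e he)))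
  have hX := fun i => isWeightedHomogeneous_X K (1 : Fin 4 → ℕ) i
  have hsq : (X 1 ^ 2 : MvPolynomial (Fin 4) K) ∈ zForms 1 0 I (1 + 1) := by
    have hred := modelFour_reduction₁ 0 1 h g q a₁ a₂
    simpa using hred
  have hsq' : ∀ {r : MvPolynomial (Fin 4) K} {e : ℕ}, IsWeightedHomogeneous 1 r e →
      r * X 1 ^ 2 ∈ zForms 1 0 I (e + 2) := fun hr => by
    rw [add_comm]
    exact mul_mem_zForms hr hsq
  have hpow := fun e => (hX 3).pow e
  simp only [smul_eq_mul, Pi.one_apply, mul_one] at hpow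
  refine modelFour_step _ (fun e => Submodule.mem_sup_right (hsq' (hpow e)))
    (fun e => Submodule.mem_sup_left (hmem _ _ rfl)) (fun i hi e => ?_)
  have h02 : i = 1 ∨ i = 2 ∨ i = 3 := by omega
  obtain rfl | rfl | rfl := h02
  · refine Submodule.mem_sup_right ?_
    rw [show X 1 * (X 3 ^ e * (X 1 * X 2)) =
      (X 3 ^ e * X 2 * X 1 ^ 2 : MvPolynomial (Fin 4) K) by ring]
    exact hsq' ((hpow e).mul (hX 2))
  · refine Submodule.mem_sup_right ?_
    have e1 := mul_mem_zForms ((hpow e).mul (hX 1)) (modelFour_reduction₂ 0 1 h g q a₁ a₂)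
    have e2 := hsq' (hpow (e + 1))
    have e3 := C_mul_mem a₁ (hsq' ((hpow e).mul (hX 2)))
    have e4 := C_mul_mem (a₂ + 0 * h) (hsq' ((hpow e).mul (hX 1)))
    rw [show 1 + 1 + (e + (1 : Fin 4 → ℕ) 1) = e + 3 by rw [Pi.one_apply]; ring] at e1
    rw [show X 2 * (X 3 ^ e * (X 1 * X 2)) = (X 3 ^ e * X 1 * (X 2 ^ 2 - (X 3 * X 1 +
      C a₁ * (X 1 * X 2) + C (a₂ + 0 * h) * X 1 ^ 2)) + (X 3 ^ (e + 1) * X 1 ^ 2 +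
      (C a₁ * (X 3 ^ e * X 2 * X 1 ^ 2) + C (a₂ + 0 * h) * (X 3 ^ e * X 1 * X 1 ^ 2))) :
      MvPolynomial (Fin 4) K) by ring]
    exact Submodule.add_mem _ e1 (Submodule.add_mem _ e2 (Submodule.add_mem _ e3 e4))
  · rw [← mul_assoc, ← pow_succ']
    exact Submodule.mem_sup_left (hmem _ _ rfl)

/-- The three leading families have orders m d, m d - 1 and m d - 2 at the pole, all above the
remainder r. Used with m = 3 when D contains an affine point and m = 4 otherwise. -/
theorem normalFour_independent_aux (w : Valuation F ℤᵐ⁰) [w.IsTrivialOn K] {m : ℤ} (d : ℕ)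
    (hvy : w y = WithZero.exp (m - 1)) (hvμ : w μ = WithZero.exp (m - 2))
    (hvv : w v = WithZero.exp m) {n₁ n₂ n₃ : MvPolynomial (Fin 4) K} {r : F}
    (hn₁ : n₁ ∈ shiftSpan 0 (fun e => X 3 ^ e) d)
    (hn₂ : n₂ ∈ shiftSpan 1 (fun e => X 3 ^ e * X 2) d)
    (hn₃ : n₃ ∈ shiftSpan 1 (fun e => X 3 ^ e * X 1) d)
    (hr : w r ≤ WithZero.exp (m * d - 3))
    (h : aeval ![1, μ, y, v] n₁ + (aeval ![1, μ, y, v] n₂ + (aeval ![1, μ, y, v] n₃ + r)) = 0) :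
    n₁ = 0 ∧ n₂ = 0 ∧ n₃ = 0 := by
  have hg₁ : ∀ e, e + 0 = d → w (aeval ![1, μ, y, v] (X 3 ^ e : MvPolynomial (Fin 4) K)) =
      WithZero.exp (m * d : ℤ) := fun e he => by
    simp only [map_pow (aeval _), aeval_X, Matrix.cons_val, valuation_pow_eq w hvv e]
    rw [← he]
    push_cast
    congr 1
    ring
  have hg₂ : ∀ e, e + 1 = d → w (aeval ![1, μ, y, v] (X 3 ^ e * X 2 : MvPolynomial (Fin 4) K)) =
      WithZero.exp (m * d - 1 : ℤ) := fun e he => by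
    simp only [map_mul (aeval _), map_pow (aeval _), aeval_X, Matrix.cons_val,
      valuation_mul_eq w (valuation_pow_eq w hvv e) hvy]
    rw [← he]
    push_cast
    congr 1
    ring
  have hg₃ : ∀ e, e + 1 = d → w (aeval ![1, μ, y, v] (X 3 ^ e * X 1 : MvPolynomial (Fin 4) K)) =
      WithZero.exp (m * d - 2 : ℤ) := fun e he => by
    simp only [map_mul (aeval _), map_pow (aeval _), aeval_X, Matrix.cons_val,
      valuation_mul_eq w (valuation_pow_eq w hvv e) hvμ]
    rw [← he]
    push_cast
    congr 1
    ring
  have hr₃ : w (aeval ![1, μ, y, v] n₃ + r) ≤ WithZero.exp (m * d - 2 : ℤ) :=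
    valuation_add_le w (valuation_le_of_mem_shiftSpan w hn₃ fun e he => (hg₃ e he).le)
      (hr.trans (WithZero.exp_le_exp.mpr (by omega)))
  have hr₂ : w (aeval ![1, μ, y, v] n₂ + (aeval ![1, μ, y, v] n₃ + r)) ≤
      WithZero.exp (m * d - 1 : ℤ) :=
    valuation_add_le w (valuation_le_of_mem_shiftSpan w hn₂ fun e he => (hg₂ e he).le)
      (hr₃.trans (WithZero.exp_le_exp.mpr (by omega)))
  obtain rfl := eq_zero_of_mem_shiftSpan w hn₁ h hg₁ (fun _ => hr₂) (fun _ => by omega)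
  rw [map_zero, zero_add] at h
  obtain rfl := eq_zero_of_mem_shiftSpan w hn₂ h hg₂ (fun _ => hr₃) (fun _ => by omega)
  rw [map_zero, zero_add] at h
  obtain rfl := eq_zero_of_mem_shiftSpan w hn₃ h hg₃ (fun _ => hr) (fun _ => by omega)
  exact ⟨rfl, rfl, rfl⟩

theorem normalFour_independent (w w' : Valuation F ℤᵐ⁰) [w.IsTrivialOn K] [w'.IsTrivialOn K]
    (hvμ : w μ = WithZero.exp 1) (hvy : w y = WithZero.exp 2) (hvv : w v = WithZero.exp 3)
    (hμ : w' μ = WithZero.exp 1) (hy : w' y ≤ WithZero.exp 1) (hv : w' v ≤ WithZero.exp 1)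
    (d : ℕ) (n) (hn : n ∈ normalFour (K := K) (fun e => X 1 ^ (e + 2)) d) (H)
    (hH : H ∈ predForms K 1 d)
    (h : aeval ![1, μ, y, v] n + aeval ![1, μ, y, v] H = 0) : n = 0 := by
  have hHv := valuation_predForms_le w 3 (f := ![1, μ, y, v]) (fun i => by
    fin_cases i <;> simp [hvμ, hvy, hvv, one_le_exp]) hH
  have hHv' := valuation_predForms_le w' 1 (f := ![1, μ, y, v]) (fun i => by
    fin_cases i
    · simp [one_le_exp]
    · simp [hμ]
    · simpa using hy
    · simpa using hv) hH
  obtain ⟨n₁, hn₁, m, hm, rfl⟩ := Submodule.mem_sup.mp hn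
  obtain ⟨n₂, hn₂, m', hm', rfl⟩ := Submodule.mem_sup.mp hm
  obtain ⟨n₃, hn₃, n₄, hn₄, rfl⟩ := Submodule.mem_sup.mp hm'
  rw [map_add, map_add, map_add, add_assoc, add_assoc, add_assoc] at h
  obtain ⟨rfl, rfl, rfl⟩ := normalFour_independent_aux w (m := 3) d hvy hvμ hvv hn₁ hn₂ hn₃
    (valuation_add_le w (valuation_le_of_mem_shiftSpan w hn₄ fun e he => by
      simp only [map_pow (aeval _), aeval_X, Matrix.cons_val, valuation_pow_eq w hvμ (e + 2)]
      exact WithZero.exp_le_exp.mpr (by omega))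
      (hHv.trans (WithZero.exp_le_exp.mpr (by omega)))) h
  simp only [map_zero, zero_add] at h
  obtain rfl := eq_zero_of_mem_shiftSpan w' hn₄ (A := d) (B := d - 1) h (fun e he => by
      simp only [map_pow (aeval _), aeval_X, Matrix.cons_val, valuation_pow_eq w' hμ (e + 2)]
      congr 1
      omega) (fun _ => by simpa using hHv') (fun _ => by omega)
  simp

theorem normalFour_independent' (w : Valuation F ℤᵐ⁰) [w.IsTrivialOn K]
    (hvμ : w μ = WithZero.exp 2) (hvy : w y = WithZero.exp 3) (hvv : w v = WithZero.exp 4)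
    (d : ℕ) (n) (hn : n ∈ normalFour (K := K) (fun e => X 3 ^ e * (X 1 * X 2)) d) (H)
    (hH : H ∈ predForms K 1 d)
    (h : aeval ![1, μ, y, v] n + aeval ![1, μ, y, v] H = 0) : n = 0 := by
  have hHv := valuation_predForms_le w 4 (f := ![1, μ, y, v]) (fun i => by
    fin_cases i <;> simp [hvμ, hvy, hvv, one_le_exp]) hH
  obtain ⟨n₁, hn₁, m, hm, rfl⟩ := Submodule.mem_sup.mp hn
  obtain ⟨n₂, hn₂, m', hm', rfl⟩ := Submodule.mem_sup.mp hm
  obtain ⟨n₃, hn₃, n₄, hn₄, rfl⟩ := Submodule.mem_sup.mp hm'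
  rw [map_add, map_add, map_add, add_assoc, add_assoc, add_assoc] at h
  have hg₄ : ∀ e, e + 2 = d → w (aeval ![1, μ, y, v]
      (X 3 ^ e * (X 1 * X 2) : MvPolynomial (Fin 4) K)) =
      WithZero.exp (4 * d - 3 : ℤ) := fun e he => by
    simp only [map_mul (aeval _), map_pow (aeval _), aeval_X, Matrix.cons_val,
      valuation_mul_eq w (valuation_pow_eq w hvv e) (valuation_mul_eq w hvμ hvy)]
    congr 1
    omega
  obtain ⟨rfl, rfl, rfl⟩ := normalFour_independent_aux w (m := 4) d hvy hvμ hvv hn₁ hn₂ hn₃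
    (valuation_add_le w (valuation_le_of_mem_shiftSpan w hn₄ fun e he => (hg₄ e he).le)
      (hHv.trans (WithZero.exp_le_exp.mpr (by omega)))) h
  simp only [map_zero, zero_add] at h
  obtain rfl := eq_zero_of_mem_shiftSpan w hn₄ h hg₄ (fun _ => hHv) (fun _ => by omega)
  simp

end Models

end GenusOne

end

/-! ### Discriminants of the models and the relation between μ and z. -/

noncomputable section

namespace GenusOne

/-- The discriminant is invariant under a substitution of the form `y ↦ -y - a₁ x + s`. -/
lemma Δ_eq_of_flip {R : Type*} [CommRing R] {W V : WeierstrassCurve R} (s : R)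
    (h₁ : V.a₁ = -W.a₁) (h₂ : V.a₂ = W.a₂) (h₃ : V.a₃ = W.a₃ + 2 * s)
    (h₄ : V.a₄ = W.a₄ + W.a₁ * (W.a₃ + s)) (h₆ : V.a₆ = W.a₆ - s * W.a₃ - s ^ 2) :
    V.Δ = W.Δ := by
  have e₂ : V.b₂ = W.b₂ := by rw [WeierstrassCurve.b₂, WeierstrassCurve.b₂, h₁, h₂]; ring
  have e₄ : V.b₄ = W.b₄ := by rw [WeierstrassCurve.b₄, WeierstrassCurve.b₄, h₁, h₃, h₄]; ring
  have e₆ : V.b₆ = W.b₆ := by rw [WeierstrassCurve.b₆, WeierstrassCurve.b₆, h₃, h₆]; ring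
  have e₈ : V.b₈ = W.b₈ := by
    rw [WeierstrassCurve.b₈, WeierstrassCurve.b₈, h₁, h₂, h₃, h₄, h₆]; ring
  rw [WeierstrassCurve.Δ, WeierstrassCurve.Δ, e₂, e₄, e₆, e₈]

/-- The parameters `t, u, w, h, g, q` are adapted to the Weierstrass curve `W`. -/
structure IsParam {R : Type*} [CommRing R] (W : WeierstrassCurve R) (t u w h g q : R) : Prop where
  a₃_eq : W.a₃ = 2 * w - h * u - t * g
  a₄_eq : W.a₄ = h * (W.a₁ * u - W.a₂ * t - t ^ 2 * h) - u * g - W.a₁ * w + t ^ 2 * q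
  a₆_eq : W.a₆ = w ^ 2 - W.a₃ * w - (u ^ 2 + W.a₁ * u * t - (W.a₂ + t * h) * t ^ 2) * q

lemma IsParam.map {R S : Type*} [CommRing R] [CommRing S] {W : WeierstrassCurve R}
    {t u w h g q : R} (H : IsParam W t u w h g q) (φ : R →+* S) :
    IsParam (W.map φ) (φ t) (φ u) (φ w) (φ h) (φ g) (φ q) := by
  obtain ⟨h₃, h₄, h₆⟩ := H
  refine ⟨?_, ?_, ?_⟩
  · rw [WeierstrassCurve.map_a₃, h₃]; simp [map_ofNat]
  · rw [WeierstrassCurve.map_a₄, h₄]; simp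
  · rw [WeierstrassCurve.map_a₆, h₆]; simp

section Discriminants

variable {R : Type*} [CommRing R] {W : WeierstrassCurve R} {t u w h g q : R}

lemma IsParam.Δ_modelTwo (H : IsParam W t u w h g q) :
    (modelTwo t u h g q W.a₁ W.a₂).Δ = W.Δ := by
  obtain ⟨h₃, h₄, h₆⟩ := H
  refine Δ_eq_of_flip (t * g - w) ?_ ?_ ?_ ?_ ?_ <;>
    simp only [BinaryQuartic.aInvariants, modelTwo, h₆, h₄, h₃] <;> ring

lemma IsParam.Δ_modelThree (H : IsParam W t u w h g q) :
    (modelThree t u h g q W.a₁ W.a₂).Δ = W.Δ := by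
  obtain ⟨h₃, h₄, h₆⟩ := H
  refine Δ_eq_of_flip (t * g - w) ?_ ?_ ?_ ?_ ?_ <;>
    simp only [TernaryCubic.aInvariants, modelThree, h₆, h₄, h₃] <;> ring

open Polynomial in
lemma toBinaryQuartic_modelFour (a₁ a₂ : R) : (modelFour t u h g q a₁ a₂).toBinaryQuartic =
    ⟨-t, a₁, h, 0, -u, a₂ + 2 * t * h, g - h * a₁, -q⟩ := by
  have hpf : (modelFour t u h g q a₁ a₂).pencil.pf = C (-t) + C a₁ * X + C h * X ^ 2 := by
    simp only [Quadric.pf, QuadricIntersection.pencil, modelFour, map_neg, map_add, map_mul,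
      map_zero, map_one]
    ring
  have hrd : (modelFour t u h g q a₁ a₂).pencil.rd =
      C 0 + C (-u) * X + C (a₂ + 2 * t * h) * X ^ 2 + C (g - h * a₁) * X ^ 3 + C (-q) * X ^ 4 := by
    simp only [Quadric.rd, QuadricIntersection.pencil, modelFour, map_neg, map_add, map_mul,
      map_zero, map_one, map_sub, map_ofNat]
    ring
  generalize a₂ + 2 * t * h = b at *
  generalize g - h * a₁ = b' at *
  simp only [QuadricIntersection.toBinaryQuartic, hpf, hrd]
  congr 1 <;> simp [coeff_C, coeff_X]

lemma IsParam.Δ_modelFour (H : IsParam W t u w h g q) :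
    (modelFour t u h g q W.a₁ W.a₂).Δ = W.Δ := by
  obtain ⟨h₃, h₄, h₆⟩ := H
  rw [h₃] at h₆
  -- The a-invariants of the quadric intersection are those of W after the translation x ↦ x + t h,
  -- y ↦ y - w, which has scaling factor 1.
  have key : (modelFour t u h g q W.a₁ W.a₂).aInvariants =
      (⟨1, t * h, 0, -w⟩ : WeierstrassCurve.VariableChange R) • W := by
    rw [QuadricIntersection.aInvariants, toBinaryQuartic_modelFour]
    ext <;> simp only [BinaryQuartic.aInvariants, WeierstrassCurve.variableChange_def, h₃, h₄, h₆,
      inv_one, Units.val_one] <;> ring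
  rw [QuadricIntersection.Δ, key, WeierstrassCurve.variableChange_Δ]
  simp

end Discriminants

section Relation

variable {K F : Type*} [Field K] [Field F] [Algebra K F] {W : WeierstrassCurve K}
  {t u w h g q : K}

/-- After substituting for x and y, the difference of the two sides of the Weierstrass equation
factors, up to sign, as (t² x - r) times that of the model relation, with r = u² + a₁ u t - (a₂ + t
h) t². The hypothesis `h0` lets the first factor be cancelled. -/
lemma IsParam.modelRel (H : IsParam W t u w h g q) {x y μ z : F}
    (hW : y ^ 2 + (algebraMap K F W.a₁ * x + algebraMap K F W.a₃) * y =
      x ^ 3 + algebraMap K F W.a₂ * x ^ 2 + algebraMap K F W.a₄ * x + algebraMap K F W.a₆)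
    (hx : x = algebraMap K F t * z + algebraMap K F u * μ)
    (hy : y = algebraMap K F u * z - algebraMap K F w - algebraMap K F W.a₁ * algebraMap K F u * μ +
      algebraMap K F t * μ * (x + algebraMap K F (W.a₂ + t * h)))
    (h0 : algebraMap K F t ^ 2 * x -
      algebraMap K F (u ^ 2 + W.a₁ * u * t - (W.a₂ + t * h) * t ^ 2) ≠ 0) :
    ModelRel t u h g q W.a₁ W.a₂ μ z := by
  obtain ⟨h₃, h₄, h₆⟩ := H
  rw [h₃] at h₆
  rw [h₆, h₄, h₃] at hW
  rw [ModelRel]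
  refine mul_left_cancel₀ h0 ?_
  simp only [map_add, map_sub, map_mul, map_pow, map_ofNat] at *
  rw [hy, hx] at hW
  rw [hx]
  linear_combination (-1 : F) * hW

end Relation

end GenusOne

end

/-! ### Integral parameters attached to a rational point. -/

noncomputable section

namespace GenusOne

section Arithmetic

lemma exists_eq_mul_of_isCoprime {O : Type*} [CommRing O] {r t M N : O} (h : IsCoprime r t)
    (e : r * M + t * N = 0) : ∃ q, N = r * q ∧ M = -(t * q) := by
  obtain ⟨x, y, hxy⟩ := h
  exact ⟨x * N - y * M, by linear_combination (-N) * hxy + y * e,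
    by linear_combination (-M) * hxy + x * e⟩

/-- The parameters for the divisor n·∞, with μ = x and z = y + a₁ x. -/
lemma isParam_zero {R : Type*} [CommRing R] (W : WeierstrassCurve R) :
    IsParam W 0 1 0 (-W.a₃) (-W.a₁ * W.a₃ - W.a₄) (-W.a₆) :=
  ⟨by ring, by ring, by ring⟩

variable {O : Type*} [CommRing O] [IsDomain O]

/-- The Weierstrass equation for (r/t², s/t³) is exploited modulo t², then t³, then modulo r. Each
congruence has a factor r², r or u prime to the modulus; cancelling it makes the next parameter
integral. -/
lemma exists_isParam_of_isCoprime (W : WeierstrassCurve O) {r s t : O} (ht : t ≠ 0)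
    (hrt : IsCoprime r t) (hW : s ^ 2 + W.a₁ * r * s * t + W.a₃ * s * t ^ 3 =
      r ^ 3 + W.a₂ * r ^ 2 * t ^ 2 + W.a₄ * r * t ^ 4 + W.a₆ * t ^ 6) :
    ∃ u w h g q, IsParam W t u w h g q ∧ s = u * r - w * t ^ 3 ∧
      r = u ^ 2 + W.a₁ * u * t - (W.a₂ + t * h) * t ^ 2 := by
  have hrt3 : IsCoprime r (t ^ 3) := hrt.pow_right
  obtain ⟨u, w, hs⟩ : ∃ u w, s = u * r - w * t ^ 3 := by
    obtain ⟨x, y, hxy⟩ := hrt3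
    exact ⟨s * x, -(s * y), by linear_combination (-s) * hxy⟩
  subst hs
  -- Modulo t² the equation reads r² (u² + a₁ u t - r) ≡ 0.
  obtain ⟨H, hH⟩ : t ^ 2 ∣ u ^ 2 + W.a₁ * u * t - r := by
    have h1 : IsCoprime (t ^ 2) (r ^ 2) := hrt.symm.pow
    refine h1.dvd_of_dvd_mul_left ⟨2 * u * r * w * t - w ^ 2 * t ^ 4 + W.a₁ * r * w * t ^ 2
      - W.a₃ * t * (u * r - w * t ^ 3) + W.a₂ * r ^ 2 + W.a₄ * r * t ^ 2 + W.a₆ * t ^ 4, ?_⟩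
    linear_combination hW
  have hr : r = u ^ 2 + W.a₁ * u * t - H * t ^ 2 := by linear_combination -hH
  -- With r eliminated and t² divided out, the equation modulo t is r² (H - a₂) ≡ 0.
  obtain ⟨h, hh⟩ : t ∣ H - W.a₂ := by
    have h1 : IsCoprime t (r ^ 2) := hrt.symm.pow_right
    refine h1.dvd_of_dvd_mul_left ⟨2 * u * r * w - W.a₃ * u * r + W.a₁ * r * w * t + W.a₄ * r * t
      - t ^ 3 * (w ^ 2 - W.a₃ * w - W.a₆), ?_⟩
    refine mul_left_cancel₀ (pow_ne_zero 2 ht) ?_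
    linear_combination hW - r ^ 2 * hH
  obtain rfl : H = W.a₂ + t * h := by linear_combination hh
  -- What is left of the equation after dividing by t³ is r M + t³ N = 0; coprimality gives N = r q
  -- and M = -t³ q.
  obtain ⟨q, hq, hM⟩ := exists_eq_mul_of_isCoprime (M := r * h + u * (W.a₃ - 2 * w)
    - W.a₁ * w * t - W.a₄ * t) (N := w ^ 2 - W.a₃ * w - W.a₆) hrt3 (by
      refine mul_left_cancel₀ (pow_ne_zero 3 ht) ?_
      linear_combination hW - r ^ 2 * hH)
  -- Reduce M = -t³ q modulo t with r ≡ u². A factor u appears, and it is prime to t because r is.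
  obtain ⟨g, hg⟩ : t ∣ 2 * w - h * u - W.a₃ := by
    have h1 : IsCoprime t u := by
      obtain ⟨x, y, hxy⟩ := hrt
      exact ⟨y + x * (W.a₁ * u - (W.a₂ + t * h) * t), x * u, by linear_combination hxy - x * hr⟩
    refine h1.dvd_of_dvd_mul_left ⟨W.a₁ * u * h - (W.a₂ + t * h) * t * h - W.a₁ * w - W.a₄
      + t ^ 2 * q, ?_⟩
    linear_combination (-1 : O) * hM + h * hr
  refine ⟨u, w, h, g, q, ⟨by linear_combination -hg, ?_, by rw [← hr]; linear_combination -hq⟩,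
    rfl, hr⟩
  refine mul_left_cancel₀ ht ?_
  linear_combination (-1 : O) * hM + h * hr - u * hg

variable [IsPrincipalIdealRing O]

lemma exists_isCoprime_mul {a b : O} (hb : b ≠ 0) :
    ∃ t a' b', t ≠ 0 ∧ a = t * a' ∧ b = t * b' ∧ IsCoprime a' b' := by
  obtain ⟨t, ht⟩ := (IsPrincipalIdealRing.principal (Ideal.span {a, b})).principal
  have ha : a ∈ Submodule.span O {t} := ht ▸ Ideal.subset_span (Set.mem_insert _ _)
  have hb' : b ∈ Submodule.span O {t} := ht ▸ Ideal.subset_span (Set.mem_insert_of_mem _ rfl)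
  have htm : t ∈ Ideal.span {a, b} := ht ▸ Submodule.mem_span_singleton_self t
  obtain ⟨x, y, hxy⟩ := Ideal.mem_span_pair.mp htm
  obtain ⟨a', rfl⟩ := Submodule.mem_span_singleton.mp ha
  obtain ⟨b', rfl⟩ := Submodule.mem_span_singleton.mp hb'
  have ht0 : t ≠ 0 := by
    rintro rfl
    simp at hb
  refine ⟨t, a', b', ht0, mul_comm _ _, mul_comm _ _, x, y, mul_left_cancel₀ ht0 ?_⟩
  simp only [smul_eq_mul] at hxy
  linear_combination hxy

variable {K : Type*} [Field K] [Algebra O K] [IsFractionRing O K]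

/-- With ξ = x₁/z₁ and η = y/(t z₁), where x₁, z₁ are coprime and y, t are coprime, clearing
denominators gives z₁ (y² + …) = t² (x₁³ + …). The brackets are prime to t and z₁ respectively, so
z₁ and t² are associated. -/
lemma exists_isCoprime_coordinates (W : WeierstrassCurve O) {ξ η : K}
    (hE : (W.map (algebraMap O K)).toAffine.Equation ξ η) :
    ∃ r s t : O, t ≠ 0 ∧ IsCoprime r t ∧ algebraMap O K r = ξ * algebraMap O K t ^ 2 ∧
      algebraMap O K s = η * algebraMap O K t ^ 3 := by
  have inj := IsFractionRing.injective O K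
  rw [WeierstrassCurve.Affine.equation_iff] at hE
  simp only [WeierstrassCurve.map_a₁, WeierstrassCurve.map_a₂, WeierstrassCurve.map_a₃,
    WeierstrassCurve.map_a₄, WeierstrassCurve.map_a₆] at hE
  obtain ⟨a, b, hb, rfl⟩ := IsFractionRing.div_surjective (A := O) ξ
  obtain ⟨c, d, hd, rfl⟩ := IsFractionRing.div_surjective (A := O) η
  have hb0 := nonZeroDivisors.ne_zero hb
  have hd0 := nonZeroDivisors.ne_zero hd
  have hbK : algebraMap O K b ≠ 0 := (map_ne_zero_iff _ inj).mpr hb0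
  have hdK : algebraMap O K d ≠ 0 := (map_ne_zero_iff _ inj).mpr hd0
  obtain ⟨t₀, x₁, z₁, ht₀, hx₁, hz₁, hc₁⟩ := exists_isCoprime_mul (a := a * d) (b := b * d)
    (mul_ne_zero hb0 hd0)
  -- The common denominator of ξ and η is b d = m t z₁, and removing m, the common factor of c b and
  -- t₀, leaves η = y/(t z₁).
  obtain ⟨m, y, t, hm, hy, ht, hyt⟩ := exists_isCoprime_mul (a := c * b) ht₀
  subst ht
  have hm' : algebraMap O K m ≠ 0 := (map_ne_zero_iff _ inj).mpr hm
  have ht0 : t ≠ 0 := right_ne_zero_of_mul ht₀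
  have htK : algebraMap O K t ≠ 0 := (map_ne_zero_iff _ inj).mpr ht0
  have hz0 : z₁ ≠ 0 := by
    rintro rfl
    rw [mul_zero] at hz₁
    exact mul_ne_zero hb0 hd0 hz₁
  have hzK : algebraMap O K z₁ ≠ 0 := (map_ne_zero_iff _ inj).mpr hz0
  have hξ : algebraMap O K a / algebraMap O K b = algebraMap O K x₁ / algebraMap O K z₁ := by
    rw [div_eq_div_iff hbK hzK, ← map_mul, ← map_mul]
    congr 1
    refine mul_left_cancel₀ (mul_ne_zero ht₀ hd0) ?_
    linear_combination z₁ * (m * t) * hx₁ - x₁ * (m * t) * hz₁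
  have hη : algebraMap O K c / algebraMap O K d =
      algebraMap O K y / (algebraMap O K t * algebraMap O K z₁) := by
    rw [div_eq_div_iff hdK (mul_ne_zero htK hzK), ← map_mul, ← map_mul, ← map_mul]
    congr 1
    refine mul_left_cancel₀ (mul_ne_zero hm hb0) ?_
    linear_combination m * t * z₁ * hy - m * y * hz₁
  rw [hξ, hη] at hE ⊢
  have hO : z₁ * (y ^ 2 + W.a₁ * x₁ * y * t + W.a₃ * y * t * z₁) =
      t ^ 2 * (x₁ ^ 3 + W.a₂ * x₁ ^ 2 * z₁ + W.a₄ * x₁ * z₁ ^ 2 + W.a₆ * z₁ ^ 3) := by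
    apply inj
    simp only [map_mul, map_add, map_pow]
    field_simp at hE
    linear_combination hE
  have h1 : z₁ ∣ t ^ 2 := by
    have h2 : IsCoprime z₁ (x₁ ^ 3 + W.a₂ * x₁ ^ 2 * z₁ + W.a₄ * x₁ * z₁ ^ 2 + W.a₆ * z₁ ^ 3) := by
      have := IsCoprime.add_mul_left_right (hc₁.symm.pow_right (n := 3))
        (W.a₂ * x₁ ^ 2 + W.a₄ * x₁ * z₁ + W.a₆ * z₁ ^ 2)
      convert this using 1
      ring
    exact h2.dvd_of_dvd_mul_right ⟨_, hO.symm⟩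
  have h2 : t ^ 2 ∣ z₁ := by
    have h2 : IsCoprime (t ^ 2) (y ^ 2 + W.a₁ * x₁ * y * t + W.a₃ * y * t * z₁) := by
      have := IsCoprime.add_mul_left_right (hyt.symm.pow_right (n := 2))
        (W.a₁ * x₁ * y + W.a₃ * y * z₁)
      convert this.pow_left (m := 2) using 1
      ring
    exact h2.dvd_of_dvd_mul_right ⟨_, hO⟩
  obtain ⟨ε, hε⟩ := associated_of_dvd_dvd h1 h2
  have hεK : algebraMap O K ε ≠ 0 := (map_ne_zero_iff _ inj).mpr ε.ne_zero
  refine ⟨x₁ * ε, y * ε, t, ht0, ?_, ?_, ?_⟩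
  · have : IsCoprime x₁ (t ^ 2) := by
      rw [← hε]
      exact (isCoprime_mul_unit_right_right ε.isUnit _ _).mpr hc₁
    rw [isCoprime_mul_unit_right_left ε.isUnit]
    exact (IsCoprime.pow_right_iff two_pos).mp this
  · rw [← map_pow, ← hε, map_mul, map_mul]
    field_simp
  · rw [show algebraMap O K t ^ 3 = algebraMap O K t * algebraMap O K (z₁ * ε) by
      rw [hε, map_pow]; ring, map_mul, map_mul]
    field_simp

theorem exists_isParam (W : WeierstrassCurve O) {ξ η : K}
    (hE : (W.map (algebraMap O K)).toAffine.Equation ξ η) :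
    ∃ t u w h g q : O, IsParam W t u w h g q ∧ t ≠ 0 ∧
      algebraMap O K (u ^ 2 + W.a₁ * u * t - (W.a₂ + t * h) * t ^ 2) = ξ * algebraMap O K t ^ 2 ∧
      algebraMap O K (u * (u ^ 2 + W.a₁ * u * t - (W.a₂ + t * h) * t ^ 2) - w * t ^ 3) =
        η * algebraMap O K t ^ 3 := by
  obtain ⟨r, s, t, ht, hrt, hr, hs⟩ := exists_isCoprime_coordinates W hE
  have inj := IsFractionRing.injective O K
  have htK : algebraMap O K t ≠ 0 := (map_ne_zero_iff _ inj).mpr ht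
  rw [WeierstrassCurve.Affine.equation_iff] at hE
  simp only [WeierstrassCurve.map_a₁, WeierstrassCurve.map_a₂, WeierstrassCurve.map_a₃,
    WeierstrassCurve.map_a₄, WeierstrassCurve.map_a₆] at hE
  obtain ⟨u, w, h, g, q, H, rfl, hr'⟩ := exists_isParam_of_isCoprime W (s := s) ht hrt (by
    apply inj
    simp only [map_mul, map_add, map_pow]
    rw [hr, hs]
    linear_combination algebraMap O K t ^ 6 * hE)
  subst hr'
  exact ⟨t, u, w, h, g, q, H, ht, hr, hs⟩

end Arithmetic

end GenusOne

end

/-! ### Bases from distinct pole orders, and rescaling of coordinates. -/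

noncomputable section

open scoped WithZero

namespace GenusOne

section Basis

variable {K F : Type*} [Field K] [Field F] [Algebra K F]

lemma linearIndependent_of_valuation_injective {ι : Type*} [Fintype ι] (v : Valuation F ℤᵐ⁰)
    [v.IsTrivialOn K] {f : ι → F} (h0 : ∀ i, f i ≠ 0) (hv : Function.Injective fun i => v (f i)) :
    LinearIndependent K f := by
  classical
  rw [Fintype.linearIndependent_iff]
  intro c hc
  by_contra! hne
  obtain ⟨i₀, hi₀⟩ := hne
  obtain ⟨i, hi, hmax⟩ := Finset.exists_max_image (Finset.univ.filter fun i => c i ≠ 0)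
    (fun i => v (f i)) ⟨i₀, by simpa using hi₀⟩
  have hci : c i ≠ 0 := by simpa using hi
  rw [← Finset.add_sum_erase _ _ (Finset.mem_univ i)] at hc
  refine hci (eq_zero_of_smul_add_eq_zero (v := v) hc ?_)
  refine Valuation.map_sum_lt v ((Valuation.ne_zero_iff v).mpr (h0 i)) fun j hj => ?_
  have hji : j ≠ i := Finset.ne_of_mem_erase hj
  by_cases hcj : c j = 0
  · rw [hcj, zero_smul, map_zero]
    exact zero_lt_iff.mpr ((Valuation.ne_zero_iff v).mpr (h0 i))
  · exact (valuation_smul_le v _ _).trans_lt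
      ((hmax j (by simpa using hcj)).lt_of_ne fun h => hji (hv h))

/-- Distinct pole orders give linear independence without any dimension formula. The factor g moves
a basis found for the reduced divisor to the Riemann-Roch space of the original one. -/
lemma exists_basis_of_valuation_injective {ι : Type*} [Fintype ι] (v : Valuation F ℤᵐ⁰)
    [v.IsTrivialOn K] {f : ι → F} (h0 : ∀ i, f i ≠ 0) (hv : Function.Injective fun i => v (f i))
    {g : F} (hg : g ≠ 0) {S : Submodule K F}
    (hS : ∀ k, g * k ∈ S ↔ k ∈ Submodule.span K (Set.range f)) :
    ∃ b : Module.Basis ι K S, ∀ i, (b i : F) = g * f i := by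
  have hmem : ∀ i, g * f i ∈ S := fun i => (hS _).mpr (Submodule.subset_span ⟨i, rfl⟩)
  have hli : LinearIndependent K fun i => (⟨g * f i, hmem i⟩ : S) := by
    refine LinearIndependent.of_comp S.subtype ?_
    exact linearIndependent_of_valuation_injective v (fun i => mul_ne_zero hg (h0 i))
      fun i j hij => hv (by
        simpa [(Valuation.ne_zero_iff v).mpr hg] using hij)
  refine ⟨Module.Basis.mk hli fun s _ => ?_, fun i => by rw [Module.Basis.mk_apply]⟩
  have hs : g⁻¹ * s ∈ Submodule.span K (Set.range f) := by
    rw [← hS, mul_inv_cancel_left₀ hg]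
    exact s.2
  rw [Submodule.mem_span_range_iff_exists_fun] at hs ⊢
  obtain ⟨c, hc⟩ := hs
  refine ⟨c, Subtype.ext ?_⟩
  rw [eq_inv_mul_iff_mul_eq₀ hg] at hc
  rw [← hc, Finset.mul_sum]
  simp

end Basis

section Scaling

open MvPolynomial

variable {K F σ : Type*} [Field K] [Field F] [Algebra K F] {w : σ → ℕ} {f : σ → F}
  {I : Ideal (MvPolynomial σ K)}

lemma aeval_pow_mul (g : F) {d : ℕ} {G : MvPolynomial σ K} (hG : IsWeightedHomogeneous w G d) :
    aeval (fun i => g ^ w i * f i) G = g ^ d * aeval f G := by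
  rw [G.as_sum, map_sum, map_sum, Finset.mul_sum]
  refine Finset.sum_congr rfl fun s hs => ?_
  rw [aeval_monomial, aeval_monomial, mul_left_comm]
  congr 1
  rw [← hG (mem_support_iff.mp hs)]
  clear hs
  induction s using Finsupp.induction_linear with
  | zero => simp
  | add s t hs ht =>
    rw [Finsupp.prod_add_index' (by simp) (by intros; rw [pow_add]),
      Finsupp.prod_add_index' (by simp) (by intros; rw [pow_add]), hs, ht, map_add, pow_add]
    ring
  | single i k =>
    rw [Finsupp.prod_single_index (h := fun i k => (g ^ w i * f i) ^ k) (pow_zero _),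
      Finsupp.prod_single_index (h := fun i k => f i ^ k) (pow_zero _), Finsupp.weight_single,
      mul_pow, ← pow_mul, smul_eq_mul, mul_comm k]

/-- A form of degree d at the rescaled coordinates is g^d times its former value, so the same forms
vanish. -/
lemma ImageDefinedBy.scale (h : ImageDefinedBy w f I) {g : F} (hg : g ≠ 0) :
    ImageDefinedBy w (fun i => g ^ w i * f i) I := by
  intro d G hG
  rw [aeval_pow_mul g hG, ← h d G hG, mul_eq_zero, or_iff_right (pow_ne_zero d hg)]

end Scaling

section Represents

variable {K F : Type*} [Field K] [Field F] [Algebra K F] {D : Divisor K F} {g : F}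
  (v : Valuation F ℤᵐ⁰) [v.IsTrivialOn K] {μ y z : F} {m n k : ℤ}

lemma ne_zero_of_valuation_eq_exp {x : F} (h : v x = WithZero.exp m) : x ≠ 0 := by
  rintro rfl
  rw [map_zero] at h
  exact WithZero.exp_ne_zero h.symm

lemma BinaryQuartic.represents_of_imageDefinedBy {Φ : BinaryQuartic K} (hg : g ≠ 0)
    (hμ : v μ = WithZero.exp m) (hm : m ≠ 0)
    (hD : ∀ k, g * k ∈ riemannRoch D ↔ k ∈ Submodule.span K (Set.range ![μ, 1]))
    (hy : g ^ 2 * y ∈ riemannRoch (2 • D))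
    (hΦ : ImageDefinedBy ![1, 1, 2] ![μ, 1, y] (Ideal.span {Φ.equation})) : Φ.Represents D := by
  obtain ⟨b, hb⟩ := exists_basis_of_valuation_injective v (f := ![μ, 1]) (fun i => by
    fin_cases i
    · exact ne_zero_of_valuation_eq_exp v hμ
    · exact one_ne_zero) (fun i j hij => by
    fin_cases i <;> fin_cases j <;> simp [hμ, ← WithZero.exp_zero, hm, hm.symm] at hij ⊢) hg hD
  refine ⟨b, ⟨_, hy⟩, ?_⟩
  convert hΦ.scale hg using 1
  funext i
  fin_cases i <;> simp [hb]

lemma TernaryCubic.represents_of_imageDefinedBy {Φ : TernaryCubic K} (hg : g ≠ 0)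
    (hμ : v μ = WithZero.exp m) (hy : v y = WithZero.exp n) (hm : m ≠ 0) (hn : n ≠ 0) (hmn : m ≠ n)
    (hD : ∀ k, g * k ∈ riemannRoch D ↔ k ∈ Submodule.span K (Set.range ![μ, y, 1]))
    (hΦ : ImageDefinedBy 1 ![μ, y, 1] (Ideal.span {Φ.equation})) : Φ.Represents D := by
  obtain ⟨b, hb⟩ := exists_basis_of_valuation_injective v (f := ![μ, y, 1]) (fun i => by
    fin_cases i
    · exact ne_zero_of_valuation_eq_exp v hμ
    · exact ne_zero_of_valuation_eq_exp v hy
    · exact one_ne_zero) (fun i j hij => by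
    fin_cases i <;> fin_cases j <;>
      simp [hμ, hy, ← WithZero.exp_zero, hm, hm.symm, hn, hn.symm, hmn, hmn.symm] at hij ⊢) hg hD
  refine ⟨b, ?_⟩
  convert hΦ.scale hg using 1
  funext i
  rw [hb, Pi.one_apply, pow_one]

lemma QuadricIntersection.represents_of_imageDefinedBy {Φ : QuadricIntersection K} (hg : g ≠ 0)
    (hμ : v μ = WithZero.exp m) (hy : v y = WithZero.exp n) (hz : v z = WithZero.exp k)
    (hm : m ≠ 0) (hn : n ≠ 0) (hk : k ≠ 0) (hmn : m ≠ n) (hmk : m ≠ k) (hnk : n ≠ k)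
    (hD : ∀ k, g * k ∈ riemannRoch D ↔ k ∈ Submodule.span K (Set.range ![1, μ, y, z]))
    (hΦ : ImageDefinedBy 1 ![1, μ, y, z] (Ideal.span {Φ.Q₁.form, Φ.Q₂.form})) :
    Φ.Represents D := by
  obtain ⟨b, hb⟩ := exists_basis_of_valuation_injective v (f := ![1, μ, y, z]) (fun i => by
    fin_cases i
    · exact one_ne_zero
    · exact ne_zero_of_valuation_eq_exp v hμ
    · exact ne_zero_of_valuation_eq_exp v hy
    · exact ne_zero_of_valuation_eq_exp v hz) (fun i j hij => by
    fin_cases i <;> fin_cases j <;>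
      simp [hμ, hy, hz, ← WithZero.exp_zero, hm, hm.symm, hn, hn.symm, hmn, hmn.symm, hk, hk.symm,
        hmk, hmk.symm, hnk, hnk.symm] at hij ⊢) hg hD
  refine ⟨b, ?_⟩
  convert hΦ.scale hg using 1
  funext i
  rw [hb, Pi.one_apply, pow_one]

end Represents

end GenusOne

end

/-! ### The slope function and functions with one affine pole. -/

noncomputable section

open Polynomial

open scoped nonZeroDivisors WithZero

namespace GenusOne

open IsDedekindDomain WeierstrassCurve.Affine

section SmallPoles

variable {K : Type*} [Field K] {E : WeierstrassCurve.Affine K}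

lemma eq_sum_of_degree_lt {p : K[X]} {n : ℕ} (h : p.degree < n) :
    p = ∑ i ∈ Finset.range n, C (p.coeff i) * X ^ i := by
  ext i
  rw [finsetSum_coeff]
  simp only [coeff_C_mul_X_pow, Finset.sum_ite_eq, Finset.mem_range]
  split_ifs with hi
  · rfl
  · exact coeff_eq_zero_of_degree_lt (h.trans_le (by exact_mod_cast not_lt.mp hi))

lemma exists_of_inftyValuation_le (a : E.CoordinateRing) {n : ℕ}
    (h : inftyValuation E (algebraMap _ _ a) ≤ WithZero.exp (n : ℤ)) : ∃ p q : K[X],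
    p.degree < ((n + 2) / 2 : ℕ) ∧ q.degree < ((n - 1) / 2 : ℕ) ∧
      a = algebraMap _ _ p + algebraMap _ _ q * yA E := by
  obtain ⟨p, q, rfl⟩ := exists_add_mul_yA a
  have h1 := (inftyValuation_lt_exp_iff (E := E) p q (n + 1)).mp
    (h.trans_lt (WithZero.exp_lt_exp.mpr (by omega)))
  exact ⟨p, q, h1.1, by simpa using h1.2, rfl⟩

lemma exists_const_of_inftyValuation_le {a : E.CoordinateRing}
    (h : inftyValuation E (algebraMap _ _ a) ≤ WithZero.exp 1) :
    ∃ c : K, a = algebraMap K _ c := by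
  obtain ⟨p, q, hp, hq, rfl⟩ := exists_of_inftyValuation_le (n := 1) a h
  rw [eq_sum_of_degree_lt hp, eq_sum_of_degree_lt hq]
  refine ⟨p.coeff 0, ?_⟩
  simp [← algebraMap_CC]

lemma exists_add_mul_xA_of_inftyValuation_le {a : E.CoordinateRing}
    (h : inftyValuation E (algebraMap _ _ a) ≤ WithZero.exp 2) :
    ∃ c d : K, a = algebraMap K _ c + algebraMap K _ d * xA E := by
  obtain ⟨p, q, hp, hq, rfl⟩ := exists_of_inftyValuation_le (n := 2) a h
  rw [eq_sum_of_degree_lt hp, eq_sum_of_degree_lt hq]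
  refine ⟨p.coeff 0, p.coeff 1, ?_⟩
  simp [← algebraMap_CC, Finset.sum_range_succ, ← algebraMap_X]

lemma exists_add_mul_yA_of_inftyValuation_le {a : E.CoordinateRing}
    (h : inftyValuation E (algebraMap _ _ a) ≤ WithZero.exp 3) :
    ∃ c d e : K, a = algebraMap K _ c + algebraMap K _ d * xA E + algebraMap K _ e * yA E := by
  obtain ⟨p, q, hp, hq, rfl⟩ := exists_of_inftyValuation_le (n := 3) a h
  rw [eq_sum_of_degree_lt hp, eq_sum_of_degree_lt hq]
  refine ⟨p.coeff 0, p.coeff 1, q.coeff 0, ?_⟩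
  simp [← algebraMap_CC, Finset.sum_range_succ, ← algebraMap_X]

lemma exists_add_mul_xA_sq_of_inftyValuation_le {a : E.CoordinateRing}
    (h : inftyValuation E (algebraMap _ _ a) ≤ WithZero.exp 4) :
    ∃ c d e f : K, a = algebraMap K _ c + algebraMap K _ d * xA E + algebraMap K _ e * yA E
      + algebraMap K _ f * xA E ^ 2 := by
  obtain ⟨p, q, hp, hq, rfl⟩ := exists_of_inftyValuation_le (n := 4) a h
  rw [eq_sum_of_degree_lt hp, eq_sum_of_degree_lt hq]
  refine ⟨p.coeff 0, p.coeff 1, q.coeff 0, p.coeff 2, ?_⟩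
  simp [← algebraMap_CC, Finset.sum_range_succ, ← algebraMap_X]
  ring

end SmallPoles

section RationalPoint

variable {K : Type*} [Field K] {E : WeierstrassCurve.Affine K}

lemma weierstrass_const : yA E ^ 2 + (algebraMap K _ E.a₁ * xA E + algebraMap K _ E.a₃) * yA E =
    xA E ^ 3 + algebraMap K _ E.a₂ * xA E ^ 2 + algebraMap K _ E.a₄ * xA E + algebraMap K _ E.a₆ := by
  have h := weierstrass_poly (E := E)
  simp only [map_add, map_mul, map_pow, algebraMap_CC, algebraMap_X] at h
  exact h

lemma exists_taylor (ξ η : K) (a : E.CoordinateRing) : ∃ (α γ : K) (b : E.CoordinateRing),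
    a = algebraMap K _ α + algebraMap K _ γ * (yA E - algebraMap K _ η) +
      (xA E - algebraMap K _ ξ) * b := by
  obtain ⟨p, q, rfl⟩ := exists_add_mul_yA a
  obtain ⟨p', hp⟩ := X_sub_C_dvd_sub_C_eval (p := p) (a := ξ)
  obtain ⟨q', hq⟩ := X_sub_C_dvd_sub_C_eval (p := q) (a := ξ)
  have hp' := congrArg (algebraMap K[X] E.CoordinateRing) hp
  have hq' := congrArg (algebraMap K[X] E.CoordinateRing) hq
  simp only [map_sub, map_mul, algebraMap_CC, algebraMap_X] at hp' hq'
  refine ⟨p.eval ξ + q.eval ξ * η, q.eval ξ,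
    algebraMap _ _ p' + algebraMap _ _ q' * yA E, ?_⟩
  simp only [map_add, map_mul]
  linear_combination hp' + yA E * hq'

lemma xA_sub_ne_zero (ξ : K) : xA E - algebraMap K _ ξ ≠ 0 := by
  rw [← algebraMap_CC, ← algebraMap_X, ← map_sub, Ne,
    map_eq_zero_iff _ algebraMap_poly_injective]
  exact X_sub_C_ne_zero ξ

variable (E) in
/-- The function `(y - η) / (x - ξ)`. -/
def slopeFunction (ξ η : K) : E.FunctionField :=
  algebraMap _ _ (yA E - algebraMap K _ η) / algebraMap _ _ (xA E - algebraMap K _ ξ)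

lemma slopeFunction_mul_x (ξ η : K) :
    slopeFunction E ξ η * algebraMap _ _ (xA E - algebraMap K _ ξ) =
      algebraMap _ _ (yA E - algebraMap K _ η) :=
  div_mul_cancel₀ _ (algebraMap_F_ne_zero (xA_sub_ne_zero ξ))

/-- Subtracting the Weierstrass equation at (ξ, η) from the generic one shows that x - ξ divides (y
- η)(y - η'), where (ξ, η') is the negative of (ξ, η). So the slope can have an affine pole only at
that negative. -/
lemma slopeFunction_mul_y {ξ η : K} (hE : E.Equation ξ η) :
    ∃ b, slopeFunction E ξ η * algebraMap _ _ (yA E - algebraMap K _ (E.negY ξ η)) =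
      algebraMap E.CoordinateRing _ b := by
  refine ⟨xA E ^ 2 + algebraMap K _ (ξ + E.a₂) * xA E +
    algebraMap K _ (ξ ^ 2 + E.a₂ * ξ + E.a₄) - algebraMap K _ E.a₁ * yA E, ?_⟩
  refine mul_right_cancel₀ (algebraMap_F_ne_zero (xA_sub_ne_zero ξ)) ?_
  rw [mul_right_comm, slopeFunction_mul_x, ← map_mul, ← map_mul]
  congr 1
  have h := congrArg (algebraMap K E.CoordinateRing) ((equation_iff _ _).mp hE)
  simp only [map_add, map_mul, map_pow, map_sub, map_neg, negY] at h ⊢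
  linear_combination weierstrass_const (E := E) - h

/-- Expand k (x - ξ) = α + γ (y - η) + (x - ξ) β. The terms γ and β are the claimed ones; the second
hypothesis forces α = 0. -/
lemma exists_eq_smul_slopeFunction_add {ξ η : K} (hE : E.Equation ξ η) {k : E.FunctionField}
    (hx : ∃ a, k * algebraMap _ _ (xA E - algebraMap K _ ξ) = algebraMap E.CoordinateRing _ a)
    (hy : ∃ b, k * algebraMap _ _ (yA E - algebraMap K _ (E.negY ξ η)) =
      algebraMap E.CoordinateRing _ b) :
    ∃ (γ : K) (β : E.CoordinateRing), k = algebraMap K _ γ * slopeFunction E ξ η +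
      algebraMap _ _ β := by
  obtain ⟨a, ha⟩ := hx
  obtain ⟨b, hb⟩ := hy
  obtain ⟨m, hm⟩ := slopeFunction_mul_y hE
  have hl := slopeFunction_mul_x (E := E) ξ η
  obtain ⟨α, γ, β, rfl⟩ := exists_taylor ξ η a
  have hX := algebraMap_F_ne_zero (xA_sub_ne_zero (E := E) ξ)
  set ζ := E.negY ξ η
  set l := slopeFunction E ξ η
  have key : algebraMap K E.CoordinateRing α * (yA E - algebraMap K _ ζ) = (xA E - algebraMap K _ ξ) *
      (b - algebraMap K _ γ * m - β * (yA E - algebraMap K _ ζ)) := by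
    apply IsFractionRing.injective E.CoordinateRing E.FunctionField
    generalize yA E - algebraMap K _ ζ = Y₂ at *
    generalize yA E - algebraMap K _ η = Y₁ at *
    generalize xA E - algebraMap K _ ξ = X₁ at *
    simp only [map_mul, map_sub, map_add, ← hb, ← hm] at ha ⊢
    linear_combination (-algebraMap E.CoordinateRing E.FunctionField Y₂) * ha +
      algebraMap E.CoordinateRing E.FunctionField Y₂ *
        algebraMap E.CoordinateRing E.FunctionField (algebraMap K _ γ) * hl
  -- The displayed identity makes α (y - η') a multiple of x - ξ; compare coefficients of y at x =
  -- ξ.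
  have hα : α = 0 := by
    obtain ⟨p, q, hpq⟩ := exists_add_mul_yA (b - algebraMap K _ γ * m - β * (yA E - algebraMap K _ ζ))
    rw [hpq] at key
    have h0 : algebraMap K[X] E.CoordinateRing ((X - C ξ) * p + C (α * ζ)) +
        algebraMap K[X] E.CoordinateRing ((X - C ξ) * q - C α) * yA E = 0 := by
      simp only [map_add, map_sub, map_mul, algebraMap_CC, algebraMap_X]
      linear_combination (-1 : E.CoordinateRing) * key
    simpa using congrArg (eval ξ) (add_mul_yA_eq_zero h0).2
  refine ⟨γ, β, mul_right_cancel₀ hX ?_⟩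
  rw [ha, hα, add_mul, mul_assoc, hl, algebraMap_K_eq]
  simp only [map_add, map_mul, map_zero]
  ring

lemma valuation_algebraMap_le_one {F : Type*} [Field F] [Algebra K F] (v : Valuation F ℤᵐ⁰)
    [v.IsTrivialOn K] (c : K) : v (algebraMap K F c) ≤ 1 := by
  have := valuation_smul_le v c 1
  rwa [Algebra.smul_def, mul_one, map_one] at this

lemma inftyValuation_const_le (c : K) :
    inftyValuation E (algebraMap E.CoordinateRing _ (algebraMap K _ c)) ≤ 1 := by
  rw [← algebraMap_K_eq]
  exact valuation_algebraMap_le_one _ c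

lemma inftyValuation_slopeFunction (ξ η : K) :
    inftyValuation E (slopeFunction E ξ η) = WithZero.exp 1 := by
  have h1 : ∀ c : K, ∀ n : ℤ, 0 < n →
      inftyValuation E (algebraMap E.CoordinateRing _ (algebraMap K _ c)) < WithZero.exp n :=
    fun c n hn => (inftyValuation_const_le c).trans_lt (by
      rw [← WithZero.exp_zero]; exact WithZero.exp_lt_exp.mpr hn)
  rw [slopeFunction, map_div₀, map_sub (algebraMap _ _), map_sub (algebraMap _ _), Valuation.map_sub_eq_of_lt_left,
    Valuation.map_sub_eq_of_lt_left, inftyValuation_xA, inftyValuation_yA, ← WithZero.exp_sub]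
  · rfl
  · rw [inftyValuation_xA]; exact h1 _ _ (by omega)
  · rw [inftyValuation_yA]; exact h1 _ _ (by omega)

lemma slopeFunction_mul_mem {w : HeightOneSpectrum E.CoordinateRing} {ξ η : K}
    (hE : E.Equation ξ η)
    (hx : xA E - algebraMap K _ ξ ∈ w.asIdeal)
    (hy : yA E - algebraMap K _ (E.negY ξ η) ∈ w.asIdeal)
    {a : E.CoordinateRing} (ha : a ∈ w.asIdeal) :
    ∃ b, slopeFunction E ξ η * algebraMap _ _ a = algebraMap E.CoordinateRing _ b := by
  obtain ⟨α, γ, b, rfl⟩ := exists_taylor ξ (E.negY ξ η) a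
  have hα : algebraMap K E.CoordinateRing α ∈ w.asIdeal := by
    rw [← Ideal.add_mem_iff_left _ (w.asIdeal.mul_mem_left _ hy), ← Ideal.add_mem_iff_left _
      (w.asIdeal.mul_mem_right _ hx)]
    exact ha
  obtain rfl : α = 0 := by
    by_contra h0
    exact w.isPrime.ne_top (Ideal.eq_top_of_isUnit_mem _ hα ((isUnit_iff_ne_zero.mpr h0).map _))
  obtain ⟨m, hm⟩ := slopeFunction_mul_y hE
  refine ⟨algebraMap K _ γ * m + (yA E - algebraMap K _ η) * b, ?_⟩
  rw [map_zero, zero_add, map_add, map_add, map_mul, map_mul, map_mul, map_mul, mul_add,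
    mul_left_comm, hm, ← mul_assoc, slopeFunction_mul_x]

/-- The residues of x and y modulo J are constants. The returned (ξ, η) is the negative of the point
cut out by J, so that the slope function through (ξ, η) has its affine pole at J. -/
lemma exists_point_of_finrank_eq_one {J : Ideal E.CoordinateRing} (hJ : J ≠ ⊥)
    (h1 : Module.finrank K (E.CoordinateRing ⧸ J) = 1) :
    ∃ (w : HeightOneSpectrum E.CoordinateRing) (ξ η : K), w.asIdeal = J ∧ E.Equation ξ η ∧
      xA E - algebraMap K _ ξ ∈ J ∧ yA E - algebraMap K _ (E.negY ξ η) ∈ J := by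
  have hnt : Nontrivial (E.CoordinateRing ⧸ J) := Module.nontrivial_of_finrank_pos (R := K) (by omega)
  have hval : ∀ a : E.CoordinateRing, ∃ c : K, a - algebraMap K _ c ∈ J := by
    intro a
    obtain ⟨c, hc⟩ := (finrank_eq_one_iff_of_nonzero' (1 : E.CoordinateRing ⧸ J) one_ne_zero).mp h1
      (Ideal.Quotient.mk J a)
    refine ⟨c, ?_⟩
    rw [← Ideal.Quotient.mk_eq_mk_iff_sub_mem, ← hc, Algebra.smul_def, mul_one]
    rfl
  have hmax : J.IsMaximal := by
    rw [Ideal.isMaximal_iff]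
    refine ⟨(Ideal.ne_top_iff_one J).mp (Ideal.Quotient.nontrivial_iff.mp hnt), ?_⟩
    intro I a hJI haJ haI
    obtain ⟨c, hc⟩ := hval a
    have hc0 : c ≠ 0 := by
      rintro rfl
      rw [map_zero, sub_zero] at hc
      exact haJ hc
    have hcI : algebraMap K E.CoordinateRing c ∈ I := by
      have := I.sub_mem haI (hJI hc)
      rwa [sub_sub_cancel] at this
    have := I.mul_mem_left (algebraMap K _ c⁻¹) hcI
    rwa [← map_mul, inv_mul_cancel₀ hc0, map_one] at this
  obtain ⟨ξ, hξ⟩ := hval (xA E)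
  obtain ⟨ζ, hζ⟩ := hval (yA E)
  have hEq : E.Equation ξ ζ := by
    rw [equation_iff]
    have h := congrArg (Ideal.Quotient.mk J) (weierstrass_const (E := E))
    simp only [map_add, map_mul, map_pow, Ideal.Quotient.mk_eq_mk_iff_sub_mem (I := J) _ _ |>.mpr hξ,
      Ideal.Quotient.mk_eq_mk_iff_sub_mem (I := J) _ _ |>.mpr hζ] at h
    apply ((Ideal.Quotient.mk J).comp (algebraMap K E.CoordinateRing)).injective
    simp only [map_add, map_mul, map_pow, RingHom.comp_apply]
    linear_combination h
  refine ⟨⟨J, hmax.isPrime, hJ⟩, ξ, E.negY ξ ζ, rfl, (equation_neg ..).mpr hEq, hξ, ?_⟩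
  rwa [negY_negY]

variable [E.IsElliptic]

instance (v : HeightOneSpectrum E.CoordinateRing) : (v.valuation E.FunctionField).IsTrivialOn K where
  eq_one c hc := by
    have h : ∀ c : K, v.valuation E.FunctionField (algebraMap K _ c) ≤ 1 := fun c => by
      rw [algebraMap_K_eq]; exact v.valuation_le_one _
    refine le_antisymm (h c) ?_
    have h2 := h c⁻¹
    have h3 : v.valuation E.FunctionField (algebraMap K _ c) ≠ 0 :=
      (Valuation.ne_zero_iff _).mpr ((_root_.map_ne_zero _).mpr hc)
    rwa [map_inv₀, map_inv₀, inv_le_one₀ (zero_lt_iff.mpr h3)] at h2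

open Classical in
lemma multiplicity_asIdeal (v w : HeightOneSpectrum E.CoordinateRing) :
    multiplicity v.asIdeal w.asIdeal = if v = w then 1 else 0 := by
  have := multiplicity_idealOf v (Finsupp.single w 1)
  rwa [idealOf_single, pow_one, Finsupp.single_apply, eq_comm (a := w)] at this

section Point

variable {w : HeightOneSpectrum E.CoordinateRing} {ξ η : K}

lemma valuation_slopeFunction_le_of_ne (hE : E.Equation ξ η)
    (hx : xA E - algebraMap K _ ξ ∈ w.asIdeal)
    (hy : yA E - algebraMap K _ (E.negY ξ η) ∈ w.asIdeal)
    {v : HeightOneSpectrum E.CoordinateRing} (hv : v ≠ w) :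
    v.valuation E.FunctionField (slopeFunction E ξ η) ≤ 1 := by
  obtain ⟨a, haw, hav⟩ : ∃ a ∈ w.asIdeal, a ∉ v.asIdeal := by
    by_contra! h
    exact hv (HeightOneSpectrum.ext (w.isMaximal.eq_of_le v.isPrime.ne_top h).symm)
  obtain ⟨b, hb⟩ := slopeFunction_mul_mem hE hx hy haw
  have h1 := v.valuation_le_one (K := E.FunctionField) b
  change v.valuation _ (algebraMap _ _ b) ≤ 1 at h1
  rwa [← hb, map_mul, (v.valuation_eq_one_iff_notMem (K := E.FunctionField)).mpr hav, mul_one] at h1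

/-- The order of the pole is at most one. Were the slope regular there, it would belong to the
coordinate ring and have pole order 1 at infinity, which no element of that ring has. -/
lemma valuation_slopeFunction (hE : E.Equation ξ η)
    (hx : xA E - algebraMap K _ ξ ∈ w.asIdeal)
    (hy : yA E - algebraMap K _ (E.negY ξ η) ∈ w.asIdeal) :
    w.valuation E.FunctionField (slopeFunction E ξ η) = WithZero.exp 1 := by
  have hle : w.valuation E.FunctionField (slopeFunction E ξ η) ≤ WithZero.exp 1 := by
    obtain ⟨π, hπ⟩ := w.intValuation_exists_uniformizer
    have hπw : π ∈ w.asIdeal := by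
      rw [← w.intValuation_lt_one_iff_mem, hπ, ← WithZero.exp_zero]
      exact WithZero.exp_lt_exp.mpr (by omega)
    obtain ⟨b, hb⟩ := slopeFunction_mul_mem hE hx hy hπw
    have h1 := w.valuation_le_one (K := E.FunctionField) b
    change w.valuation _ (algebraMap _ _ b) ≤ 1 at h1
    rw [← hb, map_mul, w.valuation_of_algebraMap, hπ, WithZero.exp_neg,
      mul_inv_le_iff₀ WithZero.exp_pos, one_mul] at h1
    exact h1
  refine le_antisymm hle ?_
  by_contra! hlt
  have hle1 : w.valuation E.FunctionField (slopeFunction E ξ η) ≤ 1 := by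
    have h0 : w.valuation E.FunctionField (slopeFunction E ξ η) * WithZero.exp (-1) < 1 := by
      rw [WithZero.exp_neg, mul_inv_lt_iff₀ WithZero.exp_pos, one_mul]
      exact hlt
    rw [lt_one_iff_le_exp_neg_one] at h0
    exact le_of_mul_le_mul_right (by rwa [one_mul]) (WithZero.exp_pos (a := (-1 : ℤ)))
  obtain ⟨c, hc⟩ := HeightOneSpectrum.mem_integers_of_valuation_le_one E.FunctionField
    (slopeFunction E ξ η) fun v => by
      by_cases hv : v = w
      · rw [hv]; exact hle1
      · exact valuation_slopeFunction_le_of_ne hE hx hy hv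
  have h1 := inftyValuation_slopeFunction (E := E) ξ η
  have hc0 : c ≠ 0 := by
    rintro rfl
    rw [map_zero] at hc
    rw [← hc, map_zero] at h1
    exact WithZero.exp_ne_zero h1.symm
  rw [← hc, inftyValuation_algebraMap hc0, WithZero.exp_inj] at h1
  exact CoordinateRing.natDegree_norm_ne_one (W' := E) c (by exact_mod_cast h1)

lemma forall_valuation_le_iff (hE : E.Equation ξ η)
    (hx : xA E - algebraMap K _ ξ ∈ w.asIdeal)
    (hy : yA E - algebraMap K _ (E.negY ξ η) ∈ w.asIdeal)
    (k : E.FunctionField) :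
    (∀ v : HeightOneSpectrum E.CoordinateRing, v.valuation E.FunctionField k ≤
      WithZero.exp (multiplicity v.asIdeal w.asIdeal : ℤ)) ↔
    ∃ (γ : K) (β : E.CoordinateRing), k = algebraMap K _ γ * slopeFunction E ξ η +
      algebraMap _ _ β := by
  classical
  constructor
  · intro h
    have hmem : ∀ a ∈ w.asIdeal, ∃ b, k * algebraMap _ _ a = algebraMap E.CoordinateRing _ b := by
      intro a ha
      obtain ⟨b, hb⟩ := HeightOneSpectrum.mem_integers_of_valuation_le_one E.FunctionField
        (k * algebraMap _ _ a) fun v => by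
          have hk := h v
          rw [multiplicity_asIdeal] at hk
          rw [map_mul]
          split_ifs at hk with hv
          · have ha' := (v.valuation_lt_one_iff_mem (K := E.FunctionField) a).mpr (hv ▸ ha)
            rw [lt_one_iff_le_exp_neg_one] at ha'
            refine (mul_le_mul' hk ha').trans ?_
            rw [← WithZero.exp_add]
            exact le_rfl
          · exact (mul_le_mul' hk (v.valuation_le_one a)).trans (by simp)
      exact ⟨b, hb.symm⟩
    exact exists_eq_smul_slopeFunction_add hE (hmem _ hx) (hmem _ hy)
  · rintro ⟨γ, β, rfl⟩ v
    refine valuation_add_le _ ?_ ((v.valuation_le_one β).trans (one_le_exp (by omega)))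
    rw [multiplicity_asIdeal]
    refine (map_mul (v.valuation E.FunctionField) _ _).trans_le
      ((mul_le_mul' (valuation_algebraMap_le_one _ γ) le_rfl).trans ?_)
    rw [one_mul]
    split_ifs with hv
    · rw [hv, valuation_slopeFunction hE hx hy]
      rfl
    · exact valuation_slopeFunction_le_of_ne hE hx hy hv

end Point

end RationalPoint

end GenusOne

end

/-! ### The models represent the divisor. -/

noncomputable section

open scoped WithZero

namespace GenusOne

open IsDedekindDomain WeierstrassCurve.Affine

section Maps

variable {R S : Type*} [CommRing R] [CommRing S] (φ : R →+* S) (t u h g q a₁ a₂ : R)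

lemma map_modelTwo : (modelTwo t u h g q a₁ a₂).map φ =
    modelTwo (φ t) (φ u) (φ h) (φ g) (φ q) (φ a₁) (φ a₂) := by
  simp [modelTwo, BinaryQuartic.map]

lemma map_modelThree : (modelThree t u h g q a₁ a₂).map φ =
    modelThree (φ t) (φ u) (φ h) (φ g) (φ q) (φ a₁) (φ a₂) := by
  simp [modelThree, TernaryCubic.map]

lemma map_modelFour : (modelFour t u h g q a₁ a₂).map φ =
    modelFour (φ t) (φ u) (φ h) (φ g) (φ q) (φ a₁) (φ a₂) := by
  simp [modelFour, QuadricIntersection.map, Quadric.map]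

end Maps

section Represents

variable {K : Type*} [Field K] {E : WeierstrassCurve.Affine K} [E.IsElliptic]
  {D : Divisor K E.FunctionField} {f : E.FunctionField}

lemma mul_mem_riemannRoch_iff_of_forall {J : Ideal E.CoordinateRing} {r : ℤ}
    (hv : ∀ v : HeightOneSpectrum E.CoordinateRing, v.valuation E.FunctionField f =
      WithZero.exp (D (finitePlace v) - multiplicity v.asIdeal J))
    (hi : inftyValuation E f = WithZero.exp (D (inftyPlace E) - r)) (k : E.FunctionField) :
    f * k ∈ riemannRoch D ↔
      (∀ v : HeightOneSpectrum E.CoordinateRing, v.valuation E.FunctionField k ≤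
        WithZero.exp (multiplicity v.asIdeal J : ℤ)) ∧
      inftyValuation E k ≤ WithZero.exp r := by
  simpa using pow_mul_mem_riemannRoch_iff hv hi 1 k

lemma mem_span_iff_of_forall {F ι : Type*} [Field F] [Algebra K F] {S : Submodule K F} {g : F}
    {b : ι → F} (hb : ∀ i, g * b i ∈ S) (hS : ∀ k, g * k ∈ S → k ∈ Submodule.span K (Set.range b))
    (k : F) : g * k ∈ S ↔ k ∈ Submodule.span K (Set.range b) := by
  refine ⟨hS k, fun h => ?_⟩
  have : Submodule.span K (Set.range b) ≤ S.comap (LinearMap.mulLeft K g) :=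
    Submodule.span_le.mpr (by rintro _ ⟨i, rfl⟩; exact hb i)
  exact this h

lemma valuation_algebraMap_eq_one {F : Type*} [Field F] [Algebra K F] (v : Valuation F ℤᵐ⁰)
    [v.IsTrivialOn K] {c : K} (hc : c ≠ 0) : v (algebraMap K F c) = 1 :=
  Valuation.IsTrivialOn.eq_one (v := v) c hc

lemma valuation_algebraMap_mul_le {F : Type*} [Field F] [Algebra K F] (v : Valuation F ℤᵐ⁰)
    [v.IsTrivialOn K] (c : K) {x : F} {m : ℤ} (hx : v x ≤ WithZero.exp m) :
    v (algebraMap K F c * x) ≤ WithZero.exp m := by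
  rw [← Algebra.smul_def]
  exact (valuation_smul_le v c x).trans hx

/-- The case D ~ n·∞. The bases are x, 1, then x, y + a₁ x, 1, then 1, x, y + a₁ x, x², with pole
orders among 0, 2, 3, 4 at infinity. -/
theorem represents_of_eq_top {t u w h g q : K} (hf : f ≠ 0)
    (hv : ∀ v : HeightOneSpectrum E.CoordinateRing, v.valuation E.FunctionField f =
      WithZero.exp (D (finitePlace v) - multiplicity v.asIdeal (⊤ : Ideal E.CoordinateRing)))
    (hi : inftyValuation E f = WithZero.exp (D (inftyPlace E) - D.degree))
    (H : IsParam E t u w h g q) (ht : t = 0) (hu : u = 1) (hw : w = 0) :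
    (D.degree = 2 → (modelTwo t u h g q E.a₁ E.a₂).Represents D) ∧
    (D.degree = 3 → (modelThree t u h g q E.a₁ E.a₂).Represents D) ∧
    (D.degree = 4 → (modelFour t u h g q E.a₁ E.a₂).Represents D) := by
  subst ht hu hw
  set ι := algebraMap E.CoordinateRing E.FunctionField with hι
  set x := ι (xA E) with hx
  set y := ι (yA E + algebraMap K _ E.a₁ * xA E) with hy
  have hmul : ∀ v : HeightOneSpectrum E.CoordinateRing,
      multiplicity v.asIdeal (⊤ : Ideal E.CoordinateRing) = 0 := fun v =>
    multiplicity_eq_zero.mpr fun h =>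
      v.prime.not_isUnit (isUnit_of_dvd_one (by rwa [Ideal.one_eq_top]))
  have hRR := mul_mem_riemannRoch_iff_of_forall hv hi
  simp only [hmul, Nat.cast_zero, WithZero.exp_zero] at hRR
  have hA : ∀ a, (∀ v : HeightOneSpectrum E.CoordinateRing, v.valuation E.FunctionField (ι a) ≤ 1) :=
    fun a v => v.valuation_le_one a
  have hex : ∀ k : E.FunctionField, (∀ v : HeightOneSpectrum E.CoordinateRing,
      v.valuation E.FunctionField k ≤ 1) → ∃ a, ι a = k := fun k hk =>
    HeightOneSpectrum.mem_integers_of_valuation_le_one E.FunctionField k hk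
  have hvx : inftyValuation E x = WithZero.exp 2 := inftyValuation_xA
  have hvy : inftyValuation E y = WithZero.exp 3 := by
    rw [hy, map_add, Valuation.map_add_eq_of_lt_left, hι, inftyValuation_yA]
    rw [hι, inftyValuation_yA, map_mul, ← algebraMap_K_eq]
    exact (valuation_algebraMap_mul_le _ _ hvx.le).trans_lt (WithZero.exp_lt_exp.mpr (by omega))
  have hvxx : inftyValuation E (x * x) = WithZero.exp 4 := valuation_mul_eq _ hvx hvx
  have hrel : ModelRel 0 1 h g q E.a₁ E.a₂ x y := by
    refine H.modelRel (x := x) (y := ι (yA E)) ?_ ?_ ?_ ?_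
    · have := congrArg ι (weierstrass_const (E := E))
      simpa only [map_add, map_mul, map_pow, ← algebraMap_K_eq, hι] using this
    · simp
    · simp only [hy, map_add, map_mul, map_zero, map_one, hι, ← algebraMap_K_eq]
      ring
    · simp
  refine ⟨fun hd => ?_, fun hd => ?_, fun hd => ?_⟩ <;> rw [hd] at hRR
  · refine BinaryQuartic.represents_of_imageDefinedBy (inftyValuation E) (μ := x) (y := y) hf hvx
      (by omega) (mem_span_iff_of_forall (fun i => (hRR _).mpr ?_) fun k hk => ?_) ?_
      (modelTwo_imageDefinedBy hrel (normalTwo_independent' _ hvx hvy))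
    · fin_cases i
      · exact ⟨hA _, hvx.le⟩
      · exact ⟨fun v => (map_one _).le, by simpa using one_le_exp (m := 2) (by omega)⟩
    · obtain ⟨a, rfl⟩ := hex k ((hRR k).mp hk).1
      obtain ⟨c, d, rfl⟩ := exists_add_mul_xA_of_inftyValuation_le ((hRR _).mp hk).2
      rw [Submodule.mem_span_range_iff_exists_fun]
      refine ⟨![d, c], ?_⟩
      simp only [Fin.sum_univ_succ, Algebra.smul_def, map_add, map_mul, hι, ← algebraMap_K_eq]
      simp
      ring
    · refine (pow_mul_mem_riemannRoch_iff hv hi 2 y).mpr ⟨fun v => ?_, ?_⟩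
      · rw [hmul]
        simpa using hA _ v
      · rw [hvy, hd]
        exact WithZero.exp_le_exp.mpr (by norm_num)
  · refine TernaryCubic.represents_of_imageDefinedBy (inftyValuation E) (μ := x) (y := y) hf hvx hvy
      (by omega) (by omega) (by omega)
      (mem_span_iff_of_forall (fun i => (hRR _).mpr ?_) fun k hk => ?_)
      (modelThree_imageDefinedBy' hrel (normalThree_independent' _ hvx hvy))
    · fin_cases i
      · exact ⟨hA _, hvx.trans_le (WithZero.exp_le_exp.mpr (by omega))⟩
      · exact ⟨hA _, hvy.le⟩
      · exact ⟨fun v => (map_one _).le, by simpa using one_le_exp (m := 3) (by omega)⟩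
    · obtain ⟨a, rfl⟩ := hex k ((hRR k).mp hk).1
      obtain ⟨c, d, e, rfl⟩ := exists_add_mul_yA_of_inftyValuation_le ((hRR _).mp hk).2
      rw [Submodule.mem_span_range_iff_exists_fun]
      refine ⟨![d - e * E.a₁, e, c], ?_⟩
      simp only [Fin.sum_univ_succ, Algebra.smul_def, map_add, map_mul, hι, ← algebraMap_K_eq]
      simp [hy, hx, hι, ← algebraMap_K_eq]
      ring
  · refine QuadricIntersection.represents_of_imageDefinedBy (inftyValuation E) (μ := x) (y := y)
      (z := x * x) hf hvx hvy hvxx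
      (by omega) (by omega) (by omega) (by omega) (by omega) (by omega)
      (mem_span_iff_of_forall (fun i => (hRR _).mpr ?_) fun k hk => ?_)
      (modelFour_imageDefinedBy' hrel (by simp) (normalFour_independent' _ hvx hvy hvxx))
    · fin_cases i
      · exact ⟨fun v => (map_one _).le, by simpa using one_le_exp (m := 4) (by omega)⟩
      · exact ⟨hA _, hvx.trans_le (WithZero.exp_le_exp.mpr (by omega))⟩
      · exact ⟨hA _, hvy.trans_le (WithZero.exp_le_exp.mpr (by omega))⟩
      · refine ⟨?_, hvxx.le⟩
        have := hA (xA E * xA E)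
        rwa [map_mul] at this
    · obtain ⟨a, rfl⟩ := hex k ((hRR k).mp hk).1
      obtain ⟨c, d, e, e', rfl⟩ := exists_add_mul_xA_sq_of_inftyValuation_le ((hRR _).mp hk).2
      rw [Submodule.mem_span_range_iff_exists_fun]
      refine ⟨![c, d - e * E.a₁, e, e'], ?_⟩
      simp only [Fin.sum_univ_succ, Algebra.smul_def, map_add, map_mul, map_pow, hι,
        ← algebraMap_K_eq]
      simp [hy, hx, hι, ← algebraMap_K_eq]
      ring

/-- The case D ~ (n - 1)·∞ + v₀. The functions 1, μ, z, μ x have orders 0, 1, 2, 3 at infinity and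
at most a simple pole at v₀; since μ has exactly one there, v₀ supplies the second valuation in the
independence arguments. -/
theorem represents_of_eq_asIdeal {v₀ : HeightOneSpectrum E.CoordinateRing} {ξ η : K}
    {t u w h g q : K} (hf : f ≠ 0)
    (hv : ∀ v : HeightOneSpectrum E.CoordinateRing, v.valuation E.FunctionField f =
      WithZero.exp (D (finitePlace v) - multiplicity v.asIdeal v₀.asIdeal))
    (hi : inftyValuation E f = WithZero.exp (D (inftyPlace E) - (D.degree - 1)))
    (hE : E.Equation ξ η) (hξ : xA E - algebraMap K _ ξ ∈ v₀.asIdeal)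
    (hη : yA E - algebraMap K _ (E.negY ξ η) ∈ v₀.asIdeal) (H : IsParam E t u w h g q) (ht : t ≠ 0)
    (hr : u ^ 2 + E.a₁ * u * t - (E.a₂ + t * h) * t ^ 2 = ξ * t ^ 2)
    (hs : u * (u ^ 2 + E.a₁ * u * t - (E.a₂ + t * h) * t ^ 2) - w * t ^ 3 = η * t ^ 3) :
    (D.degree = 2 → (modelTwo t u h g q E.a₁ E.a₂).Represents D) ∧
    (D.degree = 3 → (modelThree t u h g q E.a₁ E.a₂).Represents D) ∧
    (D.degree = 4 → (modelFour t u h g q E.a₁ E.a₂).Represents D) := by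
  set ι := algebraMap E.CoordinateRing E.FunctionField with hι
  set κ := algebraMap K E.FunctionField with hκ
  set x := ι (xA E) with hx
  set y := ι (yA E) with hy
  set l := slopeFunction E ξ η with hl
  have hT : κ t ≠ 0 := (map_ne_zero κ).mpr ht
  -- Although μ and z are only K-linear modifications of l and x, they are chosen so that their
  -- relation has integral coefficients.
  obtain ⟨μ, hμ⟩ : ∃ μ, l = κ t * μ + κ (u / t) := ⟨(l - κ (u / t)) / κ t, by field_simp; ring⟩
  obtain ⟨z, hz⟩ : ∃ z, x = κ t * z + κ u * μ := ⟨(x - κ u * μ) / κ t, by field_simp; ring⟩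
  have hslope : l * (x - κ ξ) = y - κ η := by
    have := slopeFunction_mul_x (E := E) ξ η
    rwa [map_sub, map_sub, ← algebraMap_K_eq, ← algebraMap_K_eq] at this
  have hr' := congrArg κ hr
  have hs' := congrArg κ hs
  rw [hr] at hs'
  simp only [map_sub, map_mul, map_pow] at hs'
  have hμ' : κ t ^ 2 * μ = κ t * l - κ u := by
    rw [hμ, map_div₀]
    field_simp
    ring
  -- This is t² μ = t l - u multiplied by x - ξ. The constant w t comes from u ξ - t η, because η t³
  -- = u ξ t² - w t³.
  have hμx : μ * (κ t ^ 2 * x - κ ξ * κ t ^ 2) = κ t * y - κ u * x + κ w * κ t := by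
    refine mul_left_cancel₀ (pow_ne_zero 2 hT) ?_
    linear_combination (κ t ^ 2 * x - κ ξ * κ t ^ 2) * hμ' + κ t ^ 3 * hslope + hs'
  have hy' : y = κ u * z - κ w - κ E.a₁ * κ u * μ + κ t * μ * (x + κ (E.a₂ + t * h)) := by
    refine mul_left_cancel₀ hT ?_
    simp only [map_add, map_sub, map_mul, map_pow] at hr' ⊢
    linear_combination κ u * hz - hμx + μ * hr'
  have hrel : ModelRel t u h g q E.a₁ E.a₂ μ z := by
    refine H.modelRel (x := x) (y := y) ?_ hz hy' ?_
    · have := congrArg ι (weierstrass_const (E := E))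
      simpa only [map_add, map_mul, map_pow, ← algebraMap_K_eq, hι] using this
    · rw [hr, map_mul, map_pow, mul_comm (algebraMap K _ ξ), ← mul_sub]
      refine mul_ne_zero (pow_ne_zero 2 hT) ?_
      have := algebraMap_F_ne_zero (xA_sub_ne_zero (E := E) ξ)
      rwa [map_sub, ← algebraMap_K_eq] at this
  have hμl : μ = κ t⁻¹ * (l - κ (u / t)) := by
    rw [hμ, map_inv₀]
    field_simp
    ring
  have hzx : z = κ t⁻¹ * (x - κ u * μ) := by
    rw [hz, map_inv₀]
    field_simp
    ring
  have hμ1 : ∀ v : Valuation E.FunctionField ℤᵐ⁰, [v.IsTrivialOn K] → v l = WithZero.exp 1 →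
      v μ = WithZero.exp 1 := fun v _ hvl => by
    rw [hμl, map_mul, valuation_algebraMap_eq_one v (inv_ne_zero ht), one_mul,
      Valuation.map_sub_eq_of_lt_left, hvl]
    rw [hvl]
    refine (valuation_algebraMap_le_one v _).trans_lt ?_
    rw [← WithZero.exp_zero]
    exact WithZero.exp_lt_exp.mpr one_pos
  have hvx : inftyValuation E x = WithZero.exp 2 := inftyValuation_xA
  have hvμ : inftyValuation E μ = WithZero.exp 1 := hμ1 _ (inftyValuation_slopeFunction ξ η)
  have hvz : inftyValuation E z = WithZero.exp 2 := by
    rw [hzx, map_mul, valuation_algebraMap_eq_one _ (inv_ne_zero ht), one_mul,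
      Valuation.map_sub_eq_of_lt_left, hvx]
    rw [hvx]
    exact (valuation_algebraMap_mul_le _ _ hvμ.le).trans_lt (WithZero.exp_lt_exp.mpr (by omega))
  have hvv : inftyValuation E (μ * x) = WithZero.exp 3 := valuation_mul_eq _ hvμ hvx
  have hle := forall_valuation_le_iff hE hξ hη
  have hx1 : ∀ v : HeightOneSpectrum E.CoordinateRing, v.valuation E.FunctionField x ≤ 1 :=
    fun v => v.valuation_le_one _
  have hpos : ∀ v : HeightOneSpectrum E.CoordinateRing,
      (1 : ℤᵐ⁰) ≤ WithZero.exp (multiplicity v.asIdeal v₀.asIdeal : ℤ) :=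
    fun v => one_le_exp (by omega)
  have hwμ : ∀ v : HeightOneSpectrum E.CoordinateRing, v.valuation E.FunctionField μ ≤
      WithZero.exp (multiplicity v.asIdeal v₀.asIdeal : ℤ) := (hle μ).mpr
    ⟨t⁻¹, algebraMap K _ (-(t⁻¹ * (u / t))), by
      rw [hμl, ← algebraMap_K_eq, mul_sub, map_neg, map_mul (algebraMap _ _), sub_eq_add_neg]⟩
  have hwz : ∀ v : HeightOneSpectrum E.CoordinateRing, v.valuation E.FunctionField z ≤
      WithZero.exp (multiplicity v.asIdeal v₀.asIdeal : ℤ) := fun v => by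
    rw [hzx, mul_sub, sub_eq_add_neg, ← mul_neg, ← mul_neg]
    exact valuation_add_le _ (valuation_algebraMap_mul_le _ _ ((hx1 v).trans (hpos v)))
      (valuation_algebraMap_mul_le _ _ (valuation_algebraMap_mul_le _ _
        (by rw [Valuation.map_neg]; exact hwμ v)))
  have hwv : ∀ v : HeightOneSpectrum E.CoordinateRing, v.valuation E.FunctionField (μ * x) ≤
      WithZero.exp (multiplicity v.asIdeal v₀.asIdeal : ℤ) := fun v => by
    rw [map_mul]
    exact (mul_le_mul' (hwμ v) (hx1 v)).trans (by rw [mul_one])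
  have h0μ := hμ1 _ (valuation_slopeFunction hE hξ hη)
  have h0z := hwz v₀
  have h0v := hwv v₀
  rw [multiplicity_asIdeal, if_pos rfl, Nat.cast_one] at h0z h0v
  have hRR := mul_mem_riemannRoch_iff_of_forall hv hi
  have hex : ∀ {r : ℤ}, 1 ≤ r → ∀ k : E.FunctionField, inftyValuation E k ≤ WithZero.exp r →
      (∀ v : HeightOneSpectrum E.CoordinateRing, v.valuation E.FunctionField k ≤
        WithZero.exp (multiplicity v.asIdeal v₀.asIdeal : ℤ)) →
      ∃ (γ : K) (β : E.CoordinateRing), k = κ γ * (κ t * μ + κ (u / t)) + ι β ∧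
        inftyValuation E (ι β) ≤ WithZero.exp r := by
    intro r h1 k hk hkv
    obtain ⟨γ, β, rfl⟩ := (hle k).mp hkv
    refine ⟨γ, β, by rw [← hμ], ?_⟩
    -- Since r ≥ 1, subtracting a multiple of the slope does not spoil the bound at infinity, so β
    -- obeys it too.
    have h2 : inftyValuation E (algebraMap K _ (-γ) * slopeFunction E ξ η) ≤ WithZero.exp r :=
      valuation_algebraMap_mul_le _ _ ((inftyValuation_slopeFunction ξ η).trans_le
        (WithZero.exp_le_exp.mpr h1))
    have := valuation_add_le _ h2 hk
    rwa [map_neg, neg_mul, neg_add_cancel_left] at this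
  refine ⟨fun hd => ?_, fun hd => ?_, fun hd => ?_⟩ <;> rw [hd] at hRR <;> norm_num at hRR
  · refine BinaryQuartic.represents_of_imageDefinedBy (inftyValuation E) (μ := μ) (y := z) hf hvμ
      (by omega) (mem_span_iff_of_forall (fun i => (hRR _).mpr ?_) fun k hk => ?_) ?_
      (modelTwo_imageDefinedBy hrel (normalTwo_independent _ _ hvμ hvz h0μ h0z))
    · fin_cases i
      · exact ⟨hwμ, hvμ.le⟩
      · exact ⟨fun v => (map_one _).trans_le (hpos v), by simpa using one_le_exp (m := 1) (by omega)⟩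
    · obtain ⟨γ, β, rfl, hβ⟩ := hex le_rfl k ((hRR k).mp hk).2 ((hRR k).mp hk).1
      obtain ⟨c, rfl⟩ := exists_const_of_inftyValuation_le hβ
      rw [Submodule.mem_span_range_iff_exists_fun]
      refine ⟨![γ * t, γ * (u / t) + c], ?_⟩
      simp only [Fin.sum_univ_succ, Algebra.smul_def, hι, ← algebraMap_K_eq]
      simp [hκ]
      ring
    · refine (pow_mul_mem_riemannRoch_iff hv hi 2 z).mpr ⟨fun v => ?_, ?_⟩
      · refine (hwz v).trans (WithZero.exp_le_exp.mpr ?_)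
        push_cast
        omega
      · rw [hvz, hd]
        exact WithZero.exp_le_exp.mpr (by norm_num)
  · refine TernaryCubic.represents_of_imageDefinedBy (inftyValuation E) (μ := μ) (y := z) hf hvμ hvz
      (by omega) (by omega) (by omega)
      (mem_span_iff_of_forall (fun i => (hRR _).mpr ?_) fun k hk => ?_)
      (modelThree_imageDefinedBy ht hrel (normalThree_independent _ _ hvμ hvz h0μ h0z))
    · fin_cases i
      · exact ⟨hwμ, hvμ.trans_le (WithZero.exp_le_exp.mpr (by omega))⟩
      · exact ⟨hwz, hvz.le⟩
      · exact ⟨fun v => (map_one _).trans_le (hpos v), by simpa using one_le_exp (m := 2) (by omega)⟩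
    · obtain ⟨γ, β, rfl, hβ⟩ := hex (by omega) k ((hRR k).mp hk).2 ((hRR k).mp hk).1
      obtain ⟨c, d, rfl⟩ := exists_add_mul_xA_of_inftyValuation_le hβ
      rw [Submodule.mem_span_range_iff_exists_fun]
      refine ⟨![γ * t + d * u, d * t, γ * (u / t) + c], ?_⟩
      simp only [Fin.sum_univ_succ, Algebra.smul_def, map_add ι, map_mul ι, ← hx]
      simp only [hι, ← algebraMap_K_eq]
      rw [hz]
      simp [hκ]
      ring
  · refine QuadricIntersection.represents_of_imageDefinedBy (inftyValuation E) (μ := μ) (y := z)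
      (z := μ * x) hf hvμ hvz hvv
      (by omega) (by omega) (by omega) (by omega) (by omega) (by omega)
      (mem_span_iff_of_forall (fun i => (hRR _).mpr ?_) fun k hk => ?_)
      (modelFour_imageDefinedBy ht hrel (by rw [← hz])
        (normalFour_independent _ _ hvμ hvz hvv h0μ h0z h0v))
    · fin_cases i
      · exact ⟨fun v => (map_one _).trans_le (hpos v), by simpa using one_le_exp (m := 3) (by omega)⟩
      · exact ⟨hwμ, hvμ.trans_le (WithZero.exp_le_exp.mpr (by omega))⟩
      · exact ⟨hwz, hvz.trans_le (WithZero.exp_le_exp.mpr (by omega))⟩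
      · exact ⟨hwv, hvv.le⟩
    · obtain ⟨γ, β, rfl, hβ⟩ := hex (by omega) k ((hRR k).mp hk).2 ((hRR k).mp hk).1
      obtain ⟨c, d, e, rfl⟩ := exists_add_mul_yA_of_inftyValuation_le hβ
      rw [Submodule.mem_span_range_iff_exists_fun]
      -- The coefficients come from rewriting γ l + c + d x + e y in 1, μ, z, μ x, with l, x, y
      -- replaced by their expressions in μ, z and μ x.
      refine ⟨![γ * (u / t) + c - e * w, γ * t + d * u - e * E.a₁ * u + e * t * (E.a₂ + t * h),
        d * t + e * u, e * t], ?_⟩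
      simp only [Fin.sum_univ_succ, Algebra.smul_def, map_add ι, map_mul ι, ← hx, ← hy]
      simp only [hι, ← algebraMap_K_eq]
      rw [hy']
      simp [hκ]
      linear_combination (-algebraMap K E.FunctionField d) * hz

end Represents

end GenusOne

end

theorem mainTheorem2 {O : Type*} {K : Type*} [CommRing O] [IsDomain O] [IsPrincipalIdealRing O]
    [Field K] [Algebra O K] [IsFractionRing O K] (W : WeierstrassCurve O)
    (hE : (W.map (algebraMap O K)).IsElliptic)
    (D : GenusOne.Divisor K (W.map (algebraMap O K)).toAffine.FunctionField) :
    (D.degree = 2 → ∃ Φ : GenusOne.BinaryQuartic O,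
      (Φ.map (algebraMap O K)).Represents D ∧ Φ.Δ = W.Δ) ∧
    (D.degree = 3 → ∃ Φ : GenusOne.TernaryCubic O,
      (Φ.map (algebraMap O K)).Represents D ∧ Φ.Δ = W.Δ) ∧
    (D.degree = 4 → ∃ Φ : GenusOne.QuadricIntersection O,
      (Φ.map (algebraMap O K)).Represents D ∧ Φ.Δ = W.Δ) := by
  open GenusOne in
  have key : ∃ t u w h g q : O, IsParam W t u w h g q ∧
      (D.degree = 2 → ((modelTwo t u h g q W.a₁ W.a₂).map (algebraMap O K)).Represents D) ∧
      (D.degree = 3 → ((modelThree t u h g q W.a₁ W.a₂).map (algebraMap O K)).Represents D) ∧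
      (D.degree = 4 → ((modelFour t u h g q W.a₁ W.a₂).map (algebraMap O K)).Represents D) := by
    simp only [map_modelTwo, map_modelThree, map_modelFour]
    obtain ⟨f, J, hf, hJ, hJ1, hv, hi⟩ := exists_reduction D
    -- Colength zero means D ~ n·∞ and uses the parameters t = 0, u = 1, w = 0; colength one gives
    -- an affine rational point, whose coordinates determine the parameters. The same six parameters
    -- serve all three degrees.
    obtain h0 | h1 := Nat.le_one_iff_eq_zero_or_eq_one.mp hJ1
    · have := finite_quotient hJ
      have hsub := Module.finrank_zero_iff.mp h0
      obtain rfl : J = ⊤ := Ideal.Quotient.subsingleton_iff.mp hsub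
      rw [h0, Nat.cast_zero, sub_zero] at hi
      exact ⟨_, _, _, _, _, _, isParam_zero W, represents_of_eq_top hf hv hi
        ((isParam_zero W).map (algebraMap O K)) (map_zero _) (map_one _) (map_zero _)⟩
    · obtain ⟨v₀, ξ, η, rfl, hEq, hξ, hη⟩ := exists_point_of_finrank_eq_one hJ h1
      rw [h1, Nat.cast_one] at hi
      obtain ⟨t, u, w, h, g, q, H, ht, hr, hs⟩ := exists_isParam W hEq
      refine ⟨t, u, w, h, g, q, H, represents_of_eq_asIdeal hf hv hi hEq hξ hη
        (H.map (algebraMap O K)) ?_ ?_ ?_⟩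
      · exact (map_ne_zero_iff _ (IsFractionRing.injective O K)).mpr ht
      · simpa using hr
      · simpa using hs
  obtain ⟨t, u, w, h, g, q, H, h2, h3, h4⟩ := key
  exact ⟨fun hd => ⟨_, h2 hd, H.Δ_modelTwo⟩, fun hd => ⟨_, h3 hd, H.Δ_modelThree⟩,
    fun hd => ⟨_, h4 hd, H.Δ_modelFour⟩⟩
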